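/- Let $\alpha>0$, $0<x_0<1$ and $0<M'<M$. For $L>0$ let $F(\alpha,L)$ be the Hölder class of functions $f$ on $[0,1]$ that are $k$ times continuously differentiable with $|f^{(k)}(x)-f^{(k)}(y)|\le L|x-y|^{\alpha-k}$ for all $0\le x<y\le 1$, where $k$ is the greatest integer strictly less than $\alpha$. For $n\ge 1$ one observes the Gaussian process $$Z_n(t)=\int_0^t f(x)\,dx+\frac1{\sqrt n}W(t),\qquad 0\le t\le 1,$$ where $W$ is a standard Brownian motion. An estimator $\hat f_n(x)$ is a real-valued function of the observed path and of $x$, jointly measurable. For $c>0$ its risk is $$R(\hat f_n,f;x_0,c)=\frac1{2c}\,E_f\int_{x_0-c}^{x_0+c}(\hat f_n(x)-f(x))^2\,dx\in[0,\infty],$$ and $R(\hat f_n,f;x_0,0)=E_f(\hat f_n(x_0)-f(x_0))^2$. Let $d_n\ge 0$ and $c_n=d_n n^{-1/(1+2\alpha)}$, with $[x_0-c_n,x_0+c_n]\subseteq[0,1]$ for all sufficiently large $n$. Let $B_n$ be real numbers with $B_n\to\infty$ and $n/\log B_n\to\infty$, let $f_0\in F(\alpha,M')$, and let $\Delta(f_0)$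 be the collection of sequences of estimators $(\hat f_n)$ with $$\limsup_{n\to\infty} n^{2\alpha/(1+2\alpha)}B_n R(\hat f_n,f_0;x_0,c_n)<\infty .$$ (i) If $\limsup_{n\to\infty} d_n(\log B_n)^{-1/(1+2\alpha)}=0$, then for every $(\hat f_n)\in\Delta(f_0)$ $$\liminf_{n\to\infty}\Big(\frac n{\log B_n}\Big)^{2\alpha/(1+2\alpha)}\sup_{f\in F(\alpha,M)}R(\hat f_n,f;x_0,c_n)>0,$$ and there is some $(\hat f_n)\in\Delta(f_0)$ with $$\limsup_{n\to\infty}\Big(\frac n{\log B_n}\Big)^{2\alpha/(1+2\alpha)}\sup_{f\in F(\alpha,M)}R(\hat f_n,f;x_0,c_n)<\infty.$$ (ii) If $\liminf_{n\to\infty} d_n(\log B_n)^{-1/(1+2\alpha)}>0$ and $\limsup_{n\to\infty} d_n(\log B_n)^{-1}=0$, then for every $(\hat f_n)\in\Delta(f_0)$ $$\liminf_{n\to\infty}n^{2\alpha/(1+2\alpha)}\frac{d_n}{\log B_n}\sup_{f\in F(\alpha,M)}R(\hat f_n,f;x_0,c_n)>0,$$ and there is some $(\hat f_n)\in\Delta(f_0)$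 with $$\limsup_{n\to\infty}n^{2\alpha/(1+2\alpha)}\frac{d_n}{\log B_n}\sup_{f\in F(\alpha,M)}R(\hat f_n,f;x_0,c_n)<\infty.$$ (iii) If $\liminf_{n\to\infty} d_n/\log B_n>0$, then there is some $(\hat f_n)\in\Delta(f_0)$ with $$\limsup_{n\to\infty}n^{2\alpha/(1+2\alpha)}\sup_{f\in F(\alpha,M)}R(\hat f_n,f;x_0,c_n)<\infty.$$ This rate is sharp, being the minimax rate: for every sequence of estimators $(\hat f_n)$, superefficient or not, $$\liminf_{n\to\infty}n^{2\alpha/(1+2\alpha)}\sup_{f\in F(\alpha,M)}R(\hat f_n,f;x_0,c_n)>0.$$ -/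

import Mathlib

open MeasureTheory ProbabilityTheory Filter Topology Set
open scoped ENNReal NNReal

noncomputable section

namespace WhiteNoise

/-- The Hölder class `F(α, M)` on `[0, 1]`: with `k = ⌈α⌉₊ - 1` the greatest integer strictly less
than `α` (for `α > 0`), the functions that are `k` times continuously differentiable on `[0, 1]`
and whose `k`-th derivative satisfies `|f⁽ᵏ⁾(x) - f⁽ᵏ⁾(y)| ≤ M |x - y| ^ (α - k)` there.
Only the values of `f` on `[0, 1]` matter. -/
def holderClass (α M : ℝ) : Set (ℝ → ℝ) :=
  {f | ContDiffOn ℝ ((⌈α⌉₊ - 1 : ℕ) : ℕ∞) f (Icc 0 1) ∧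
    ∀ x ∈ Icc (0 : ℝ) 1, ∀ y ∈ Icc (0 : ℝ) 1, x < y →
      |iteratedDerivWithin (⌈α⌉₊ - 1) f (Icc 0 1) x -
        iteratedDerivWithin (⌈α⌉₊ - 1) f (Icc 0 1) y| ≤
          M * |x - y| ^ (α - ((⌈α⌉₊ - 1 : ℕ) : ℝ))}

/-- The observed path `t ↦ ∫₀ᵗ f(x) dx + w(t) / √n`, `0 ≤ t ≤ 1`, when the realized path of the
driving Brownian motion is `w`. -/
def observation (n : ℕ) (f : ℝ → ℝ) (w : ℝ≥0 → ℝ) : unitInterval → ℝ :=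
  fun t => (∫ x in (0 : ℝ)..(t : ℝ), f x) + w (unitInterval.toNNReal t) / √(n : ℝ)

/-- A sequence of estimators: for each `n` a jointly measurable function of the observed path
(with the σ-algebra generated by the coordinates) and of the point at which the unknown function
is estimated. -/
def IsEstimator (fhat : ℕ → (unitInterval → ℝ) → ℝ → ℝ) : Prop :=
  ∀ n, Measurable (Function.uncurry (fhat n))

variable {Ω : Type*} [MeasurableSpace Ω]

/-- The average mean squared error
`(1 / (2 c)) E_f ∫_{x₀ - c}^{x₀ + c} (fhat(x) - f(x))² dx`, with values in `[0, ∞]`,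
when the observation has noise level `1 / √n`.
For `c = 0` it is the pointwise mean squared error at `x₀`. -/
def risk (P : Measure Ω) (W : ℝ≥0 → Ω → ℝ) (n : ℕ) (fhat : (unitInterval → ℝ) → ℝ → ℝ)
    (f : ℝ → ℝ) (x₀ c : ℝ) : ℝ≥0∞ :=
  if c = 0 then
    ∫⁻ ω, ENNReal.ofReal ((fhat (observation n f (W · ω)) x₀ - f x₀) ^ 2) ∂P
  else
    ENNReal.ofReal (1 / (2 * c)) *
      ∫⁻ ω, (∫⁻ x in Icc (x₀ - c) (x₀ + c),
        ENNReal.ofReal ((fhat (observation n f (W · ω)) x - f x) ^ 2)) ∂P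

/-- The worst-case risk over the Hölder class `F(α, M)`. -/
def maxRisk (P : Measure Ω) (W : ℝ≥0 → Ω → ℝ) (α M : ℝ) (n : ℕ)
    (fhat : (unitInterval → ℝ) → ℝ → ℝ) (x₀ c : ℝ) : ℝ≥0∞ :=
  ⨆ f ∈ holderClass α M, risk P W n fhat f x₀ c

/-- The class `Δ(f₀)` of estimators that are superefficient at rate `B n` at `f₀`:
`limsup n ^ (2α / (1 + 2α)) B_n R(fhat_n, f₀; x₀, c_n) < ∞`. -/
def superefficient (P : Measure Ω) (W : ℝ≥0 → Ω → ℝ) (α : ℝ) (B : ℕ → ℝ) (x₀ : ℝ) (c : ℕ → ℝ)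
    (f₀ : ℝ → ℝ) : Set (ℕ → (unitInterval → ℝ) → ℝ → ℝ) :=
  {fhat | IsEstimator fhat ∧
    limsup (fun n : ℕ => ENNReal.ofReal ((n : ℝ) ^ (2 * α / (1 + 2 * α)) * B n) *
      risk P W n (fhat n) f₀ x₀ (c n)) atTop < ∞}

end WhiteNoise

end

/-! Lower bounds. The likelihood ratio of `f + g` to `f` has second moment `exp(n‖g‖²)`. By
Cauchy-Schwarz, an event of probability at least 1/2 under `f + g` has probability at least
`exp(-n‖g‖²) / 4` under `f`, so an estimator that is very accurate at `f` must err by the order of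
`|g|` at `f + g` (`sq_le_pointRisk_add_pointRisk`). Superefficiency gains a factor `B n` at `f₀`, so
perturbations with `n‖g‖² ≤ log (B n) / 2` are affordable: they cost only `√(B n)`. Let `g` be a
bump of height `A` whose plateau, of half-width `w`, covers the window. The constraints are `A ≲ w ^
α` and `n A² w ≲ log B`. If the window is short, both can be made tight, which gives `A² ≍ (log B /
n) ^ (2α / (1 + 2α))`. If it is longer, `w` is the window itself and `A² ≍ log B / (n c)`. Once `d ≳
log B` this falls to the minimax rate or below it, and that rate comes from a hypercube of about `d`
disjoint bumps (`sq_le_maxRisk`).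

Upper bounds. The window is covered by `m` cells of length `δ`, with a polynomial fitted on each to
increments of the path centred at `f₀`. The fit is added to `f₀` only if the sum of squared
increments exceeds a threshold proportional to `Λ`. At `f₀` that sum is a scaled chi-square variable
with about `m` degrees of freedom, so `Λ = log B + O(m)` makes the risk there smaller by a factor
`B`. Elsewhere, a sum below the threshold bounds the fit itself, so that staying at `f₀` costs at
most a term `Λ / (n m δ)` on top of the usual `δ ^ (2α) + 1 / (n δ)` (`exists_estimator_risk_le`).
One cell with `δ ≍ (log B / n) ^ (1 / (1 + 2α))` serves short windows; `m ≍ d` cells with `δ ≍ n ^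
(-1 / (1 + 2α))` serve all others. -/

namespace WhiteNoise

/-! ### Cameron-Martin inequality for Gaussian processes -/

section CameronMartin

lemma sq_lintegral_le {α : Type*} [MeasurableSpace α] (μ : Measure α) {f : α → ℝ≥0∞}
    (hf : AEMeasurable f μ) : (∫⁻ a, f a ∂μ) ^ 2 ≤ μ univ * ∫⁻ a, f a ^ 2 ∂μ := by
  have h := ENNReal.lintegral_mul_le_Lp_mul_Lq μ Real.HolderConjugate.two_two
    (aemeasurable_const (b := (1 : ℝ≥0∞))) hf
  simp only [Pi.mul_apply, one_mul, ENNReal.one_rpow, lintegral_const] at h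
  calc (∫⁻ a, f a ∂μ) ^ 2
      ≤ ((μ univ) ^ (1 / 2 : ℝ) * (∫⁻ a, f a ^ (2 : ℝ) ∂μ) ^ (1 / 2 : ℝ)) ^ 2 := by gcongr
    _ = μ univ * ∫⁻ a, f a ^ 2 ∂μ := by
      rw [mul_pow, ← ENNReal.rpow_natCast, ← ENNReal.rpow_natCast, ← ENNReal.rpow_mul,
        ← ENNReal.rpow_mul]
      norm_num

/-- Moving the mean from `0` to `v` multiplies the density by `exp (x - v / 2)`, whose second moment
under the centred law is `exp v`; Cauchy-Schwarz on `E` does the rest. -/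
lemma gaussianReal_shift_sq_le (v : ℝ≥0) {E : Set ℝ} (hE : MeasurableSet E) :
    gaussianReal v v E ^ 2 ≤ ENNReal.ofReal (Real.exp v) * gaussianReal 0 v E := by
  rcases eq_or_ne v 0 with rfl | hv
  · simp only [gaussianReal_zero_var, NNReal.coe_zero, Real.exp_zero, ENNReal.ofReal_one, one_mul]
    exact pow_le_of_le_one zero_le prob_le_one two_ne_zero
  have hpdf : ∀ x, gaussianPDF v v x =
      gaussianPDF 0 v x * ENNReal.ofReal (Real.exp (x - v / 2)) := by
    intro x
    rw [gaussianPDF, gaussianPDF, ← ENNReal.ofReal_mul (gaussianPDFReal_nonneg _ _ _)]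
    congr 1
    simp only [gaussianPDFReal]
    rw [mul_assoc _ (Real.exp _), ← Real.exp_add]
    congr 2
    have : (v : ℝ) ≠ 0 := by exact_mod_cast hv
    field_simp
    ring
  have hm : Measurable fun x : ℝ => ENNReal.ofReal (Real.exp (x - v / 2)) := by fun_prop
  have h1 : gaussianReal v v E =
      ∫⁻ x in E, ENNReal.ofReal (Real.exp (x - v / 2)) ∂(gaussianReal 0 v) := by
    rw [gaussianReal_apply _ hv, gaussianReal_of_var_ne_zero 0 hv,
      setLIntegral_withDensity_eq_setLIntegral_mul _ (measurable_gaussianPDF _ _) hm hE]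
    simp only [hpdf, Pi.mul_apply]
  have h2 : ∫⁻ x, ENNReal.ofReal (Real.exp (x - v / 2)) ^ 2 ∂(gaussianReal 0 v) =
      ENNReal.ofReal (Real.exp v) := by
    have e1 : ∀ x : ℝ, ENNReal.ofReal (Real.exp (x - v / 2)) ^ 2 =
        ENNReal.ofReal (Real.exp (-v)) * ENNReal.ofReal (Real.exp (2 * x)) := by
      intro x
      rw [← ENNReal.ofReal_pow (Real.exp_pos _).le, ← ENNReal.ofReal_mul (Real.exp_pos _).le,
        ← Real.exp_add, ← Real.exp_nat_mul]
      congr 2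
      push_cast
      ring
    simp only [e1]
    rw [lintegral_const_mul _ (by fun_prop), ← ofReal_integral_eq_lintegral_ofReal
      (integrable_exp_mul_gaussianReal 2) (ae_of_all _ fun x => (Real.exp_pos _).le)]
    have := congrFun (mgf_fun_id_gaussianReal (μ := 0) (v := v)) 2
    simp only [mgf] at this
    rw [this, ← ENNReal.ofReal_mul (Real.exp_pos _).le, ← Real.exp_add]
    congr 2
    ring
  calc gaussianReal v v E ^ 2
      ≤ (gaussianReal 0 v).restrict E univ *
        ∫⁻ x in E, ENNReal.ofReal (Real.exp (x - v / 2)) ^ 2 ∂(gaussianReal 0 v) := by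
        rw [h1]; exact sq_lintegral_le _ hm.aemeasurable
    _ ≤ gaussianReal 0 v E * ENNReal.ofReal (Real.exp v) := by
        rw [Measure.restrict_apply_univ, ← h2]
        gcongr
        exact Measure.restrict_le_self
    _ = _ := mul_comm _ _

variable {Ω : Type*} [MeasurableSpace Ω] {P : Measure Ω}

/-- A Cameron-Martin inequality: shifting a centred Gaussian process by its covariances with a
linear combination of its values. -/
lemma gaussianProcess_shift_sq_le {T : Type*} [IsProbabilityMeasure P] {X : T → Ω → ℝ}
    (hX : IsGaussianProcess X P) (hXm : ∀ t, Measurable (X t)) (hX0 : ∀ t, P[X t] = 0)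
    (I : Finset T) (a : T → ℝ) (b : T → ℝ) (s : ℝ≥0)
    (hb : ∀ t, b t = ∑ i ∈ I, a i * cov[X t, X i; P])
    (hs : (s : ℝ) = ∑ i ∈ I, a i * b i) {A : Set (T → ℝ)} (hA : MeasurableSet A) :
    P {ω | (fun t => X t ω + b t) ∈ A} ^ 2 ≤
      ENNReal.ofReal (Real.exp s) * P {ω | (X · ω) ∈ A} := by
  classical
  set ξ : Ω → ℝ := fun ω => ∑ i ∈ I, a i * X i ω with hξ
  have hXL : ∀ t, MemLp (X t) 2 P := fun t => (hX.hasGaussianLaw_eval t).memLp_two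
  have haXL : ∀ i, MemLp (fun ω => a i * X i ω) 2 P := fun i => (hXL i).const_mul _
  have hξm : Measurable ξ := by
    simp only [hξ]; fun_prop
  have hcov : ∀ t, cov[X t, ξ; P] = b t := by
    intro t
    rw [hξ, covariance_fun_sum_right' (fun i _ => haXL i) (hXL t), hb]
    simp_rw [covariance_const_mul_right]
  have hξL : MemLp ξ 2 P := memLp_finsetSum I fun i _ => haXL i
  have hvar : Var[ξ; P] = s := by
    rw [← covariance_self hξm.aemeasurable, hs]
    conv_lhs => rw [hξ]
    rw [covariance_fun_sum_left' (fun i _ => haXL i) hξL]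
    simp_rw [covariance_const_mul_left]
    exact Finset.sum_congr rfl fun i _ => by rw [hcov]
  have hlin : ∀ c d : ℝ, ∀ t, ∃ J : Finset T, ∃ L : (J → ℝ) →L[ℝ] ℝ,
      ∀ ω, c * X t ω + d * ξ ω = L (J.restrict (X · ω)) := by
    intro c d t
    refine ⟨insert t I, c • ContinuousLinearMap.proj ⟨t, by simp⟩ +
      d • ∑ i ∈ I.attach, a i • ContinuousLinearMap.proj ⟨i, by simp⟩, fun ω => ?_⟩
    simp only [hξ, add_apply, smul_apply, sum_apply, ContinuousLinearMap.proj_apply, Finset.restrict, smul_eq_mul]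
    rw [Finset.sum_attach I fun i => a i * X i ω]
  -- If `s = 0`, then `ξ` vanishes almost surely and so do its covariances `b t`: there is no shift.
  rcases eq_or_ne s 0 with rfl | hs0
  · have hb0 : ∀ t, b t = 0 := by
      intro t
      have h0 : ∫ ω, ξ ω ∂P = 0 := by
        rw [hξ, integral_finsetSum _ fun i _ => (haXL i).integrable one_le_two]
        exact Finset.sum_eq_zero fun i _ => by rw [integral_const_mul, hX0, mul_zero]
      have h1 : ξ =ᵐ[P] 0 := by
        have := (evariance_eq_zero_iff hξm.aemeasurable (μ := P)).1 (by
          rw [← hξL.ofReal_variance_eq, hvar]; simp)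
        rw [h0] at this
        exact this
      rw [← hcov, covariance, h0]
      refine integral_eq_zero_of_ae ?_
      filter_upwards [h1] with ω hω
      simp [hω]
    simp only [hb0, add_zero, NNReal.coe_zero, Real.exp_zero, ENNReal.ofReal_one, one_mul]
    exact pow_le_of_le_one zero_le prob_le_one two_ne_zero
  have hs0' : (s : ℝ) ≠ 0 := by exact_mod_cast hs0
  -- The residual of the regression of `X t` on `ξ`. It is uncorrelated with `ξ`, hence independent
  -- of it by joint Gaussianity, and shifting `X` by `b` amounts to shifting `ξ` by `s` with the
  -- residual fixed. This reduces the claim to one dimension.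
  set R : T → Ω → ℝ := fun t ω => X t ω - ξ ω * (b t / s) with hR
  have hRm : ∀ t, Measurable (R t) := fun t => by simp only [hR]; fun_prop
  have hRp : Measurable fun ω t => R t ω := measurable_pi_lambda _ hRm
  have hjoint : IsGaussianProcess (Sum.elim R (fun _ : Unit => ξ)) P := by
    refine hX.of_isGaussianProcess ?_
    rintro (t | _)
    · obtain ⟨J, L, h⟩ := hlin 1 (-(b t / s)) t
      exact ⟨J, L, fun ω => by rw [← h]; simp [hR]; ring⟩
    · rcases isEmpty_or_nonempty T with hT | ⟨⟨t⟩⟩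
      · refine ⟨∅, 0, fun ω => ?_⟩
        simp [hξ, Finset.eq_empty_of_isEmpty I]
      · obtain ⟨J, L, h⟩ := hlin 0 1 t
        exact ⟨J, L, fun ω => by rw [← h]; simp⟩
  have hind : IndepFun (fun ω t => R t ω) (fun ω (_ : Unit) => ξ ω) P := by
    refine hjoint.indepFun_of_covariance_eq_zero (fun t => (hRm t).aemeasurable)
      (fun _ => hξm.aemeasurable) fun t _ => ?_
    have : R t = X t - fun ω => (b t / s) * ξ ω := by ext ω; simp [hR]; ring
    rw [this, covariance_sub_left (hXL t) (hξL.const_mul _) hξL, covariance_const_mul_left, hcov,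
      covariance_self hξm.aemeasurable, hvar]
    field_simp
    ring
  have hind' : IndepFun (fun ω t => R t ω) ξ P :=
    hind.comp measurable_id (measurable_pi_apply ())
  have hlaw : P.map ξ = gaussianReal 0 s := by
    have hg : HasGaussianLaw ξ P := hjoint.hasGaussianLaw_eval (Sum.inr ())
    rw [hg.map_eq_gaussianReal, hvar]
    congr 1
    · rw [hξ, integral_finsetSum _ fun i _ => (haXL i).integrable one_le_two]
      exact Finset.sum_eq_zero fun i _ => by rw [integral_const_mul, hX0, mul_zero]
    · simp
  have hprod : P.map (fun ω => ((fun t => R t ω), ξ ω)) =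
      (P.map fun ω t => R t ω).prod (gaussianReal 0 s) := by
    rw [(indepFun_iff_map_prod_eq_prod_map_map hRp.aemeasurable hξm.aemeasurable).1 hind', hlaw]
  set ν := P.map fun ω t => R t ω with hν
  have : IsProbabilityMeasure ν := Measure.isProbabilityMeasure_map hRp.aemeasurable
  have hpair : Measurable fun ω => ((fun t => R t ω), ξ ω) := hRp.prodMk hξm
  set Φ : (T → ℝ) × ℝ → T → ℝ := fun p t => p.1 t + p.2 * (b t / s) with hΦ
  have hΦm : Measurable Φ := by
    refine measurable_pi_lambda _ fun t => ?_
    simp only [hΦ]; fun_prop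
  have hΨm : Measurable fun p : (T → ℝ) × ℝ => Φ (p.1, p.2 + s) := by fun_prop
  have e0 : P {ω | (X · ω) ∈ A} = ∫⁻ r, gaussianReal 0 s {x | Φ (r, x) ∈ A} ∂ν := by
    have : {ω | (X · ω) ∈ A} = (fun ω => ((fun t => R t ω), ξ ω)) ⁻¹' (Φ ⁻¹' A) := by
      ext ω; simp [hΦ, hR]
    rw [this, ← Measure.map_apply hpair (hΦm hA), hprod, Measure.prod_apply (hΦm hA)]
    rfl
  have e1 : P {ω | (fun t => X t ω + b t) ∈ A} =
      ∫⁻ r, gaussianReal s s {x | Φ (r, x) ∈ A} ∂ν := by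
    have : {ω | (fun t => X t ω + b t) ∈ A} =
        (fun ω => ((fun t => R t ω), ξ ω)) ⁻¹' ((fun p => Φ (p.1, p.2 + s)) ⁻¹' A) := by
      ext ω
      have : (fun t => X t ω + b t) = fun t => R t ω + (ξ ω + s) * (b t / s) := by
        ext t; simp only [hR]; field_simp; ring
      simp [hΦ, this]
    rw [this, ← Measure.map_apply hpair (hΨm hA), hprod, Measure.prod_apply (hΨm hA)]
    refine lintegral_congr fun r => ?_
    have hE : MeasurableSet {x | Φ (r, x) ∈ A} := (hΦm.comp measurable_prodMk_left) hA
    have := gaussianReal_map_add_const (μ := 0) (v := s) (s : ℝ)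
    rw [zero_add] at this
    rw [← this, Measure.map_apply (by fun_prop) hE]
    rfl
  rw [e0, e1, ← lintegral_const_mul' _ _ ENNReal.ofReal_ne_top]
  have hmeas : Measurable fun r => gaussianReal s s {x | Φ (r, x) ∈ A} :=
    measurable_measure_prodMk_left (hΦm hA)
  -- Cauchy-Schwarz moves the square inside the integral over the residual, where the
  -- one-dimensional inequality holds fibre by fibre.
  refine (sq_lintegral_le ν hmeas.aemeasurable).trans ?_
  rw [measure_univ, one_mul]
  exact lintegral_mono fun r =>
    gaussianReal_shift_sq_le s ((hΦm.comp measurable_prodMk_left) hA)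

end CameronMartin

/-! ### Cameron-Martin inequality for Brownian motion -/

section CameronMartinBrownian

variable {Ω : Type*} [MeasurableSpace Ω] {P : Measure Ω}

/-- A function in `L²(0, 1)` projected on the span of finitely many indicators of `(0, t]`. -/
lemma exists_step_projection {g : ℝ → ℝ} (hg : MemLp g 2 (volume.restrict (Ioc (0 : ℝ) 1)))
    (I : Finset unitInterval) : ∃ a : unitInterval → ℝ,
      (∀ t ∈ I, ∑ i ∈ I, a i * min (t : ℝ) i = ∫ x in (0 : ℝ)..(t : ℝ), g x) ∧
      ∑ t ∈ I, a t * (∑ i ∈ I, a i * min (t : ℝ) i) ≤ ∫ x in (0 : ℝ)..1, g x ^ 2 := by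
  classical
  set μ : Measure ℝ := volume.restrict (Ioc (0 : ℝ) 1) with hμ
  have hIm : ∀ t : unitInterval, MeasurableSet (Ioc (0 : ℝ) t) := fun t => measurableSet_Ioc
  have hIf : ∀ t : unitInterval, μ (Ioc (0 : ℝ) t) ≠ ∞ := fun t => measure_ne_top _ _
  set e : unitInterval → Lp ℝ 2 μ := fun t => indicatorConstLp 2 (hIm t) (hIf t) 1 with he
  have hee : ∀ s t, inner ℝ (e s) (e t) = min (s : ℝ) t := by
    intro s t
    simp only [he]
    rw [L2.real_inner_indicatorConstLp_one_indicatorConstLp_one, Ioc_inter_Ioc, hμ,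
      measureReal_restrict_apply measurableSet_Ioc, Ioc_inter_Ioc, Real.volume_real_Ioc_of_le]
    · rw [max_self, max_self, sub_zero, min_eq_left]
      exact min_le_of_left_le s.2.2
    · rw [max_self, max_self]
      exact le_min (le_min s.2.1 t.2.1) zero_le_one
  set u : Lp ℝ 2 μ := hg.toLp g with hu
  have heg : ∀ t, inner ℝ (e t) u = ∫ x in (0 : ℝ)..(t : ℝ), g x := by
    intro t
    simp only [he]
    rw [L2.inner_indicatorConstLp_one, intervalIntegral.integral_of_le t.2.1,
      setIntegral_congr_ae (g := g) (hIm t) (hg.coeFn_toLp.mono fun x hx _ => hx), hμ,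
      Measure.restrict_restrict (hIm t), Ioc_inter_Ioc, max_self, min_eq_left t.2.2]
  have huu : ‖u‖ ^ 2 = ∫ x in (0 : ℝ)..1, g x ^ 2 := by
    rw [← real_inner_self_eq_norm_sq, L2.inner_def, intervalIntegral.integral_of_le zero_le_one]
    refine integral_congr_ae (hg.coeFn_toLp.mono fun x hx => ?_)
    simp only [hu, hx, real_inner_self_eq_norm_sq, Real.norm_eq_abs, sq_abs]
  -- The Gram matrix of the indicators is the Brownian covariance `min s t`. The orthogonal
  -- projection on their span keeps the inner products with them, that is, the integrals of `g` up
  -- to the times in `I`, and does not increase the norm.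
  set K : Submodule ℝ (Lp ℝ 2 μ) := Submodule.span ℝ (range fun i : I => e i) with hK
  have : FiniteDimensional ℝ K := FiniteDimensional.span_of_finite ℝ (finite_range _)
  obtain ⟨a', ha'⟩ := (Submodule.mem_span_range_iff_exists_fun ℝ).1
    (Submodule.starProjection_apply_mem K u)
  set a : unitInterval → ℝ := fun t => if h : t ∈ I then a' ⟨t, h⟩ else 0 with ha
  have hsum : K.starProjection u = ∑ i ∈ I, a i • e i := by
    rw [← ha', ← Finset.sum_attach I]
    exact Finset.sum_congr rfl fun i _ => by simp [ha]
  have hin : ∀ t ∈ I, ∑ i ∈ I, a i * min (t : ℝ) i = inner ℝ (e t) (K.starProjection u) := by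
    intro t _
    rw [hsum, inner_sum]
    exact Finset.sum_congr rfl fun i _ => by rw [inner_smul_right, hee]
  refine ⟨a, fun t ht => ?_, ?_⟩
  · rw [hin t ht, ← heg, ← Submodule.inner_starProjection_left_eq_right K,
      Submodule.starProjection_eq_self_iff.2 
        (show e t ∈ K from Submodule.subset_span ⟨⟨t, ht⟩, rfl⟩)]
  · have h1 : ∑ t ∈ I, a t * (∑ i ∈ I, a i * min (t : ℝ) i) = ‖K.starProjection u‖ ^ 2 := by
      rw [← real_inner_self_eq_norm_sq]
      conv_rhs => rw [hsum, sum_inner]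
      refine Finset.sum_congr rfl fun t ht => ?_
      rw [hin t ht, inner_smul_left, hsum]
      rfl
    rw [h1, ← huu]
    gcongr
    exact K.norm_starProjection_apply_le u

/-- The Cameron-Martin inequality for Brownian motion on the unit interval. -/
lemma brownian_shift_sq_le [IsProbabilityMeasure P] {W : ℝ≥0 → Ω → ℝ} (hWm : ∀ t, Measurable (W t))
    (hW : IsPreBrownianReal W P) {g : ℝ → ℝ} (hg : MemLp g 2 (volume.restrict (Ioc (0 : ℝ) 1)))
    {A : Set (unitInterval → ℝ)} (hA : MeasurableSet A) :
    P {ω | (fun t => W (unitInterval.toNNReal t) ω + ∫ x in (0 : ℝ)..(t : ℝ), g x) ∈ A} ^ 2 ≤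
      ENNReal.ofReal (Real.exp (∫ x in (0 : ℝ)..1, g x ^ 2)) *
        P {ω | (fun t => W (unitInterval.toNNReal t) ω) ∈ A} := by
  set X : unitInterval → Ω → ℝ := fun t => W (unitInterval.toNNReal t) with hX
  set G : unitInterval → ℝ := fun t => ∫ x in (0 : ℝ)..(t : ℝ), g x with hG
  set q := ∫ x in (0 : ℝ)..1, g x ^ 2 with hq
  have hXG : IsGaussianProcess X P := hW.isGaussianProcess.comp_right _
  have hXm : ∀ t, Measurable (X t) := fun t => hWm _
  have hX0 : ∀ t, P[X t] = 0 := fun t => hW.integral_eval _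
  have hXc : ∀ s t, cov[X s, X t; P] = min (s : ℝ) t := by
    intro s t
    simp only [hX, hW.covariance_eval]
    rfl
  have hm0 : Measurable fun ω t => X t ω := measurable_pi_lambda _ hXm
  have hm1 : Measurable fun ω t => X t ω + G t :=
    measurable_pi_lambda _ fun t => (hXm t).add_const _
  -- A cylinder sees finitely many times, and at these the shift agrees with a combination of
  -- covariances, as the inequality for Gaussian processes requires.
  have hcyl : ∀ A ∈ measurableCylinders fun _ : unitInterval => ℝ,
      P {ω | (fun t => X t ω + G t) ∈ A} ^ 2 ≤
      ENNReal.ofReal (Real.exp q) * P {ω | (X · ω) ∈ A} := by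
    intro A hA
    obtain ⟨I, S, hS, rfl⟩ := (mem_measurableCylinders _).1 hA
    obtain ⟨a, ha1, ha2⟩ := exists_step_projection hg I
    have hpos : 0 ≤ ∑ t ∈ I, a t * (∑ i ∈ I, a i * min (t : ℝ) i) := by
      have : ∑ t ∈ I, a t * (∑ i ∈ I, a i * min (t : ℝ) i) =
          Var[fun ω => ∑ i ∈ I, a i * X i ω; P] := by
        have hL : ∀ i, MemLp (fun ω => a i * X i ω) 2 P :=
          fun i => (hXG.hasGaussianLaw_eval i).memLp_two.const_mul _
        rw [← covariance_self (by fun_prop),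
          covariance_fun_sum_left' (fun i _ => hL i) (memLp_finsetSum I fun i _ => hL i)]
        refine Finset.sum_congr rfl fun t _ => ?_
        rw [covariance_const_mul_left, covariance_fun_sum_right' (fun i _ => hL i)
          (hXG.hasGaussianLaw_eval t).memLp_two]
        simp_rw [covariance_const_mul_right, hXc]
      rw [this]
      exact variance_nonneg _ _
    have key := gaussianProcess_shift_sq_le hXG hXm hX0 I a (fun t => ∑ i ∈ I, a i * min (t : ℝ) i)
      ⟨_, hpos⟩ (fun t => by simp_rw [hXc]) rfl (hS.cylinder I)
    have e1 : {ω | (fun t => X t ω + G t) ∈ cylinder I S} =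
        {ω | (fun t : unitInterval => X t ω + ∑ i ∈ I, a i * min (t : ℝ) i) ∈ cylinder I S} := by
      ext ω
      simp only [mem_ofPred_eq, mem_cylinder]
      have : I.restrict (fun t => X t ω + G t) =
          I.restrict (fun t : unitInterval => X t ω + ∑ i ∈ I, a i * min (t : ℝ) i) := by
        ext ⟨t, ht⟩
        simp [hG, ha1 t ht]
      rw [this]
    rw [e1]
    refine key.trans ?_
    gcongr
    exact ha2
  set ν₀ := P.map fun ω t => X t ω with hν₀
  set ν₁ := P.map fun ω t => X t ω + G t with hν₁
  have : IsProbabilityMeasure ν₀ := Measure.isProbabilityMeasure_map hm0.aemeasurable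
  have : IsProbabilityMeasure ν₁ := Measure.isProbabilityMeasure_map hm1.aemeasurable
  have E0 : ∀ {B : Set (unitInterval → ℝ)}, MeasurableSet B → P {ω | (X · ω) ∈ B} = ν₀ B :=
    fun hB => (Measure.map_apply hm0 hB).symm
  have E1 : ∀ {B : Set (unitInterval → ℝ)}, MeasurableSet B →
      P {ω | (fun t => X t ω + G t) ∈ B} = ν₁ B := fun hB => (Measure.map_apply hm1 hB).symm
  have real_iff : ∀ B : Set (unitInterval → ℝ),
      ν₁ B ^ 2 ≤ ENNReal.ofReal (Real.exp q) * ν₀ B ↔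
      ν₁.real B ^ 2 ≤ Real.exp q * ν₀.real B := by
    intro B
    rw [← ENNReal.toReal_le_toReal (by finiteness) (by finiteness), ENNReal.toReal_pow,
      ENNReal.toReal_mul, ENNReal.toReal_ofReal (Real.exp_pos _).le]
    rfl
  change P {ω | (fun t => X t ω + G t) ∈ A} ^ 2 ≤ _ * P {ω | (X · ω) ∈ A}
  rw [E0 hA, E1 hA, real_iff]
  -- Cylinders form an algebra that generates the σ-algebra; approximation in `ν₀ + ν₁` controls
  -- both laws at once.
  have hdense : (ν₀ + ν₁).MeasureDense (measurableCylinders fun _ : unitInterval => ℝ) :=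
    Measure.MeasureDense.of_generateFrom_isSetAlgebra_finite _ isSetAlgebra_measurableCylinders
      generateFrom_measurableCylinders.symm
  refine le_of_forall_pos_le_add fun η hη => ?_
  -- Replacing `A` by a cylinder costs `3 ε` on the left, since `(y + ε)² ≤ y² + 3 ε` for `y, ε ≤
  -- 1`, and `exp q * ε` on the right.
  set ε := min 1 (η / (Real.exp q + 3)) with hε
  have hε0 : 0 < ε := lt_min one_pos (by positivity)
  have hε1 : ε ≤ 1 := min_le_left _ _
  have hε2 : ε * (Real.exp q + 3) ≤ η := by
    have := min_le_right 1 (η / (Real.exp q + 3))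
    rwa [← hε, le_div_iff₀ (by positivity)] at this
  obtain ⟨B, hBc, hB⟩ := hdense.approx A hA (measure_ne_top _ _) ε hε0
  have hBm := MeasurableSet.of_mem_measurableCylinders hBc
  have hAB : (ν₀ + ν₁).real (symmDiff A B) < ε := by
    rw [Measure.real]
    exact (ENNReal.lt_ofReal_iff_toReal_lt (measure_ne_top _ _)).1 hB
  rw [measureReal_add_apply] at hAB
  have hB' := hcyl B hBc
  rw [E0 hBm, E1 hBm, real_iff] at hB'
  have h1 : ν₁.real A ≤ ν₁.real B + ε := by
    have : ν₁.real A ≤ ν₁.real (B ∪ symmDiff A B) := measureReal_mono fun x hx => by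
      by_cases hxB : x ∈ B
      · exact Or.inl hxB
      · exact Or.inr (Or.inl ⟨hx, hxB⟩)
    have h2 := measureReal_union_le (μ := ν₁) B (symmDiff A B)
    have h3 : 0 ≤ ν₀.real (symmDiff A B) := measureReal_nonneg
    linarith
  have h0 : ν₀.real B ≤ ν₀.real A + ε := by
    have : ν₀.real B ≤ ν₀.real (A ∪ symmDiff A B) := measureReal_mono fun x hx => by
      by_cases hxA : x ∈ A
      · exact Or.inl hxA
      · exact Or.inr (Or.inr ⟨hx, hxA⟩)
    have h2 := measureReal_union_le (μ := ν₀) A (symmDiff A B)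
    have h3 : 0 ≤ ν₁.real (symmDiff A B) := measureReal_nonneg
    linarith
  have hy1 : ν₁.real B ≤ 1 := measureReal_le_one
  have hy0 : 0 ≤ ν₁.real B := measureReal_nonneg
  have hx0 : 0 ≤ ν₁.real A := measureReal_nonneg
  have hE : Real.exp q * ν₀.real B ≤ Real.exp q * (ν₀.real A + ε) := by gcongr
  calc ν₁.real A ^ 2 ≤ (ν₁.real B + ε) ^ 2 := by gcongr
    _ ≤ ν₁.real B ^ 2 + 3 * ε := by nlinarith
    _ ≤ _ := by nlinarith

end CameronMartinBrownian

/-! ### The constrained risk inequality -/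

section TwoPoint

variable {Ω : Type*} [MeasurableSpace Ω] {P : Measure Ω}

/-- The mean squared error at the point `x`. -/
noncomputable def pointRisk (P : Measure Ω) (W : ℝ≥0 → Ω → ℝ) (n : ℕ)
    (fhat : (unitInterval → ℝ) → ℝ → ℝ) (f : ℝ → ℝ) (x : ℝ) : ℝ≥0∞ :=
  ∫⁻ ω, ENNReal.ofReal ((fhat (observation n f (W · ω)) x - f x) ^ 2) ∂P

/-- The uniform distribution on `[x₀ - c, x₀ + c]`. -/
noncomputable def avgMeasure (x₀ c : ℝ) : Measure ℝ :=
  if c = 0 then Measure.dirac x₀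
  else ENNReal.ofReal (1 / (2 * c)) • volume.restrict (Icc (x₀ - c) (x₀ + c))

/-- Treats the pointwise risk and the windowed risk as one integral, so that later estimates need
not distinguish `c = 0`. -/
lemma risk_eq_lintegral_avgMeasure (W : ℝ≥0 → Ω → ℝ) (n : ℕ)
    (fhat : (unitInterval → ℝ) → ℝ → ℝ) (f : ℝ → ℝ) (x₀ c : ℝ) :
    risk P W n fhat f x₀ c = ∫⁻ ω, (∫⁻ x,
      ENNReal.ofReal ((fhat (observation n f (W · ω)) x - f x) ^ 2) ∂(avgMeasure x₀ c)) ∂P := by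
  unfold risk avgMeasure
  split_ifs with hc
  · simp_rw [lintegral_dirac]
  · simp_rw [lintegral_smul_measure, smul_eq_mul]
    rw [lintegral_const_mul' _ _ ENNReal.ofReal_ne_top]

instance (x₀ c : ℝ) : SFinite (avgMeasure x₀ c) := by
  unfold avgMeasure
  split_ifs <;> infer_instance

lemma measurable_observation {W : ℝ≥0 → Ω → ℝ} (hWm : ∀ t, Measurable (W t)) (n : ℕ) (f : ℝ → ℝ) :
    Measurable fun ω => observation n f (W · ω) :=
  measurable_pi_lambda _ fun _ => ((hWm _).div_const _).const_add _

lemma avgMeasure_absolutelyContinuous {x₀ c : ℝ} (hc : 0 ≤ c) :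
    ∀ᵐ x ∂(avgMeasure x₀ c), x ∈ Icc (x₀ - c) (x₀ + c) := by
  unfold avgMeasure
  split_ifs with h
  · subst h
    rw [ae_dirac_iff (by simp)]
    simp
  · exact Measure.ae_smul_measure (ae_restrict_mem measurableSet_Icc) _

lemma aemeasurable_avgMeasure {f : ℝ → ℝ} {x₀ c : ℝ} (hf : ContinuousOn f (Icc (x₀ - c) (x₀ + c))) :
    AEMeasurable f (avgMeasure x₀ c) := by
  unfold avgMeasure
  split_ifs with h
  · exact aemeasurable_dirac
  · exact (hf.aemeasurable measurableSet_Icc).smul_measure _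

/-- Tonelli; inequalities between risks at a point can then be integrated over the window. -/
lemma risk_eq_lintegral_pointRisk [SFinite P] {W : ℝ≥0 → Ω → ℝ} (hWm : ∀ t, Measurable (W t))
    (n : ℕ) {fhat : (unitInterval → ℝ) → ℝ → ℝ} (hfhat : Measurable (Function.uncurry fhat))
    {f : ℝ → ℝ} {x₀ c : ℝ} (hf : ContinuousOn f (Icc (x₀ - c) (x₀ + c))) :
    risk P W n fhat f x₀ c = ∫⁻ x, pointRisk P W n fhat f x ∂(avgMeasure x₀ c) := by
  rw [risk_eq_lintegral_avgMeasure, lintegral_lintegral_swap]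
  · rfl
  have h1 : AEMeasurable (fun p : Ω × ℝ => f p.2) (P.prod (avgMeasure x₀ c)) :=
    (aemeasurable_avgMeasure hf).comp_snd
  have h2 : Measurable fun p : Ω × ℝ => fhat (observation n f (W · p.1)) p.2 :=
    hfhat.comp (((measurable_observation hWm n f).comp measurable_fst).prodMk measurable_snd)
  exact ((h2.aemeasurable.sub h1).pow_const 2).ennreal_ofReal

/-- The constrained risk inequality at a point, for two functions that differ by `g`. -/
lemma sq_le_pointRisk_add_pointRisk [IsProbabilityMeasure P] {W : ℝ≥0 → Ω → ℝ}
    (hWm : ∀ t, Measurable (W t)) (hW : IsPreBrownianReal W P) {n : ℕ} (hn : n ≠ 0)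
    {fhat : (unitInterval → ℝ) → ℝ → ℝ} (hfhat : Measurable (Function.uncurry fhat))
    {f g : ℝ → ℝ} (hf : ContinuousOn f (Icc 0 1)) (hg : ContinuousOn g (Icc 0 1)) (x : ℝ) :
    ENNReal.ofReal (g x ^ 2) ≤ 8 * pointRisk P W n fhat (fun y => f y + g y) x +
      16 * ENNReal.ofReal (Real.exp (n * ∫ y in (0 : ℝ)..1, g y ^ 2)) *
        pointRisk P W n fhat f x := by
  have hn0 : (0 : ℝ) < √n := Real.sqrt_pos.2 (by exact_mod_cast Nat.pos_of_ne_zero hn)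
  have hint : ∀ {h : ℝ → ℝ}, ContinuousOn h (Icc 0 1) → ∀ t : unitInterval,
      IntervalIntegrable h volume 0 t := fun {h} hh t =>
    (hh.mono (by rw [uIcc_of_le t.2.1]; exact Icc_subset_Icc le_rfl t.2.2)).intervalIntegrable
  -- The paths for which the estimate at `x` is at least half the separation away from `f x`. Off
  -- this event it is at least as far from `f x + g x`.
  set B : Set (unitInterval → ℝ) := {z | |g x| / 2 ≤ |fhat z x - f x|} with hB
  have hfx : Measurable fun z => fhat z x := hfhat.comp (measurable_id.prodMk measurable_const)
  have hBm : MeasurableSet B := measurableSet_le measurable_const (by fun_prop)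
  -- `S` sends the driving path to the observation under `f`; shifting that path by the integral of
  -- `√n * g` turns it into the observation under `f + g`.
  set S : (unitInterval → ℝ) → unitInterval → ℝ :=
    fun z t => (∫ y in (0 : ℝ)..(t : ℝ), f y) + z t / √n with hS
  have hSm : Measurable S := by
    refine measurable_pi_lambda _ fun t => ?_
    simp only [hS]; fun_prop
  have hgL : MemLp (fun y => √n * g y) 2 (volume.restrict (Ioc (0 : ℝ) 1)) := by
    have h1 : ContinuousOn (fun y => √n * g y) (Icc 0 1) := by fun_prop
    refine (memLp_two_iff_integrable_sq ((h1.mono Ioc_subset_Icc_self).aestronglyMeasurable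
      measurableSet_Ioc)).2 ?_
    exact ((h1.pow 2).integrableOn_compact isCompact_Icc).mono_set Ioc_subset_Icc_self
  have hcm := brownian_shift_sq_le hWm hW hgL (hSm hBm)
  have hexp : ∫ y in (0 : ℝ)..1, (√n * g y) ^ 2 = n * ∫ y in (0 : ℝ)..1, g y ^ 2 := by
    rw [← intervalIntegral.integral_const_mul]
    congr 1
    ext y
    rw [mul_pow, Real.sq_sqrt (Nat.cast_nonneg _)]
  rw [hexp] at hcm
  set E := ENNReal.ofReal (Real.exp (n * ∫ y in (0 : ℝ)..1, g y ^ 2)) with hE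
  have hobs0 : {ω | (fun t => W (unitInterval.toNNReal t) ω) ∈ S ⁻¹' B} =
      {ω | observation n f (W · ω) ∈ B} := rfl
  have hobs1 : {ω | (fun t => W (unitInterval.toNNReal t) ω +
      ∫ y in (0 : ℝ)..(t : ℝ), √n * g y) ∈ S ⁻¹' B} =
      {ω | observation n (fun y => f y + g y) (W · ω) ∈ B} := by
    have : ∀ ω, S (fun t => W (unitInterval.toNNReal t) ω +
        ∫ y in (0 : ℝ)..(t : ℝ), √n * g y) = observation n (fun y => f y + g y) (W · ω) := by
      intro ω
      ext t
      simp only [hS, observation]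
      rw [intervalIntegral.integral_add (hint hf t) (hint hg t),
        intervalIntegral.integral_const_mul]
      field_simp
      ring
    ext ω
    simp only [mem_ofPred_eq, mem_preimage, this]
  rw [hobs0, hobs1] at hcm
  set γ := ENNReal.ofReal (g x ^ 2 / 4) with hγ
  have h4 : ENNReal.ofReal (g x ^ 2) = 4 * γ := by
    rw [hγ, ← ENNReal.ofReal_ofNat, ← ENNReal.ofReal_mul (by norm_num)]
    congr 1; ring
  have hR0 : γ * P {ω | observation n f (W · ω) ∈ B} ≤ pointRisk P W n fhat f x := by
    refine le_trans ?_ (mul_meas_ge_le_lintegral ((((hfx.comp (measurable_observation hWm n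
      f)).sub_const _).pow_const 2).ennreal_ofReal) γ)
    gcongr with ω
    intro hω
    refine ENNReal.ofReal_le_ofReal ?_
    have h1 : |g x| / 2 ≤ |fhat (observation n f (W · ω)) x - f x| := hω
    have h2 := pow_le_pow_left₀ (by positivity) h1 2
    rw [sq_abs, div_pow, sq_abs] at h2
    simp only [Function.comp]
    linarith
  have hR1 : γ * P {ω | observation n (fun y => f y + g y) (W · ω) ∈ B}ᶜ ≤
      pointRisk P W n fhat (fun y => f y + g y) x := by
    refine le_trans ?_ (mul_meas_ge_le_lintegral ((((hfx.comp (measurable_observation hWm n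
      (fun y => f y + g y))).sub_const _).pow_const 2).ennreal_ofReal) γ)
    gcongr
    intro ω hω
    refine ENNReal.ofReal_le_ofReal ?_
    have h1 : |fhat (observation n (fun y => f y + g y) (W · ω)) x - f x| < |g x| / 2 :=
      not_le.1 hω
    simp only [Function.comp]
    set u := fhat (observation n (fun y => f y + g y) (W · ω)) x
    have h3 : |g x| / 2 ≤ |u - (f x + g x)| := by
      have := abs_sub_abs_le_abs_sub (g x) (u - f x)
      rw [abs_sub_comm (g x), show u - f x - g x = u - (f x + g x) by ring] at this
      linarith
    have h2 := pow_le_pow_left₀ (by positivity) h3 2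
    rw [sq_abs, div_pow, sq_abs] at h2
    linarith
  have hBm1 : MeasurableSet {ω | observation n (fun y => f y + g y) (W · ω) ∈ B} :=
    measurable_observation hWm n _ hBm
  set p₁ := P {ω | observation n (fun y => f y + g y) (W · ω) ∈ B} with hp₁
  set p₀ := P {ω | observation n f (W · ω) ∈ B} with hp₀
  have hadd : p₁ + P {ω | observation n (fun y => f y + g y) (W · ω) ∈ B}ᶜ = 1 :=
    prob_add_prob_compl hBm1
  set q₁ := P {ω | observation n (fun y => f y + g y) (W · ω) ∈ B}ᶜ with hq₁
  -- If `p₁ ≥ 1/2`, the shift inequality gives `p₀ ≥ 1 / (4 E)` and the risk at `f` pays, with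
  -- factor `4 * 4 = 16`. Otherwise `q₁ ≥ 1/2` and the risk at `f + g` pays, with factor `4 * 2 =
  -- 8`.
  have hcase : 1 ≤ 2 * p₁ ∨ 1 ≤ 2 * q₁ := by
    by_contra! h
    have h1 : 2 * p₁ + 2 * q₁ < 1 + 1 := ENNReal.add_lt_add h.1 h.2
    rw [← mul_add, hadd] at h1
    norm_num at h1
  rw [h4]
  rcases hcase with h | h
  · have h2 : 1 ≤ 4 * (E * p₀) := by
      calc (1 : ℝ≥0∞) ≤ (2 * p₁) ^ 2 := one_le_pow₀ h
        _ = 4 * p₁ ^ 2 := by rw [mul_pow]; norm_num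
        _ ≤ 4 * (E * p₀) := by gcongr
    calc 4 * γ ≤ 4 * γ * (4 * (E * p₀)) := le_mul_of_one_le_right zero_le h2
      _ = 16 * E * (γ * p₀) := by ring
      _ ≤ 16 * E * pointRisk P W n fhat f x := by gcongr
      _ ≤ _ := le_add_self
  · calc 4 * γ ≤ 4 * γ * (2 * q₁) := le_mul_of_one_le_right zero_le h
      _ = 8 * (γ * q₁) := by ring
      _ ≤ 8 * pointRisk P W n fhat (fun y => f y + g y) x := by gcongr
      _ ≤ _ := le_self_add

end TwoPoint

/-! ### Hölder classes, bumps and Taylor's theorem -/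

section Holder

lemma ceil_sub_one_lt {α : ℝ} (hα : 0 < α) : ((⌈α⌉₊ - 1 : ℕ) : ℝ) < α := by
  have h1 : 1 ≤ ⌈α⌉₊ := Nat.one_le_iff_ne_zero.2 (Nat.ceil_pos.2 hα).ne'
  rw [Nat.cast_sub h1, Nat.cast_one]
  have := Nat.ceil_lt_add_one hα.le
  linarith

lemma le_ceil_sub_one_add_one {α : ℝ} (hα : 0 < α) : α ≤ ((⌈α⌉₊ - 1 : ℕ) : ℝ) + 1 := by
  have h1 : 1 ≤ ⌈α⌉₊ := Nat.one_le_iff_ne_zero.2 (Nat.ceil_pos.2 hα).ne'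
  rw [Nat.cast_sub h1, Nat.cast_one]
  have := Nat.le_ceil α
  linarith

lemma continuousOn_of_mem_holderClass {α M : ℝ} {f : ℝ → ℝ} (hf : f ∈ holderClass α M) :
    ContinuousOn f (Icc 0 1) := hf.1.continuousOn

lemma holderClass_mono {α M M' : ℝ} (h : M ≤ M') : holderClass α M ⊆ holderClass α M' :=
  fun _ hf => ⟨hf.1, fun x hx y hy hxy => (hf.2 x hx y hy hxy).trans (by gcongr)⟩

lemma add_mem_holderClass {α M M' : ℝ} {f g : ℝ → ℝ} (hf : f ∈ holderClass α M)
    (hg : g ∈ holderClass α M') : (fun x => f x + g x) ∈ holderClass α (M + M') := by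
  refine ⟨hf.1.add hg.1, fun x hx y hy hxy => ?_⟩
  have e : ∀ z ∈ Icc (0 : ℝ) 1, iteratedDerivWithin (⌈α⌉₊ - 1) (fun x => f x + g x) (Icc 0 1) z =
      iteratedDerivWithin (⌈α⌉₊ - 1) f (Icc 0 1) z +
        iteratedDerivWithin (⌈α⌉₊ - 1) g (Icc 0 1) z := fun z hz =>
    iteratedDerivWithin_fun_add hz (uniqueDiffOn_Icc zero_lt_one) (hf.1 z hz) (hg.1 z hz)
  rw [e x hx, e y hy, add_sub_add_comm, add_mul]
  exact (abs_add_le _ _).trans (add_le_add (hf.2 x hx y hy hxy) (hg.2 x hx y hy hxy))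

lemma neg_mem_holderClass {α M : ℝ} {f : ℝ → ℝ} (hf : f ∈ holderClass α M) :
    (fun x => -f x) ∈ holderClass α M := by
  refine ⟨hf.1.neg, fun x hx y hy hxy => ?_⟩
  have e : ∀ z ∈ Icc (0 : ℝ) 1, iteratedDerivWithin (⌈α⌉₊ - 1) (fun x => -f x) (Icc 0 1) z =
      -iteratedDerivWithin (⌈α⌉₊ - 1) f (Icc 0 1) z := fun z hz =>
    iteratedDerivWithin_fun_neg _
  rw [e x hx, e y hy, ← neg_sub', abs_neg]
  exact hf.2 x hx y hy hxy

lemma sub_mem_holderClass {α M M' : ℝ} {f g : ℝ → ℝ} (hf : f ∈ holderClass α M)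
    (hg : g ∈ holderClass α M') : (fun x => f x - g x) ∈ holderClass α (M + M') := by
  simpa only [sub_eq_add_neg] using add_mem_holderClass hf (neg_mem_holderClass hg)

lemma mem_holderClass_of_contDiff {α M : ℝ} {f : ℝ → ℝ} (hf : ContDiff ℝ (⊤ : ℕ∞) f)
    (h : ∀ x y, |iteratedDeriv (⌈α⌉₊ - 1) f x - iteratedDeriv (⌈α⌉₊ - 1) f y| ≤
      M * |x - y| ^ (α - ((⌈α⌉₊ - 1 : ℕ) : ℝ))) : f ∈ holderClass α M := by
  have hk : ContDiff ℝ ((⌈α⌉₊ - 1 : ℕ) : ℕ∞) f := hf.of_le (by exact_mod_cast le_top)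
  refine ⟨hk.contDiffOn, fun x hx y hy _ => ?_⟩
  have e : ∀ z ∈ Icc (0 : ℝ) 1, iteratedDerivWithin (⌈α⌉₊ - 1) f (Icc 0 1) z =
      iteratedDeriv (⌈α⌉₊ - 1) f z := fun z hz =>
    iteratedDerivWithin_eq_iteratedDeriv (uniqueDiffOn_Icc zero_lt_one) hk.contDiffAt hz
  rw [e x hx, e y hy]
  exact h x y

/-- The derivative of order `k` of a smooth bump is bounded and Lipschitz. As `0 < α - k ≤ 1`, the
Lipschitz bound implies the Hölder bound at distances at most `1`, and the sup bound implies it at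
larger ones. -/
lemma exists_bump {α : ℝ} (hα : 0 < α) : ∃ ψ : ℝ → ℝ, ∃ C : ℝ, 0 < C ∧ ContDiff ℝ (⊤ : ℕ∞) ψ ∧
    (∀ x, 0 ≤ ψ x) ∧ (∀ x, ψ x ≤ 1) ∧ (∀ x, |x| ≤ 1 → ψ x = 1) ∧ (∀ x, 2 < |x| → ψ x = 0) ∧
    (∀ x, 2 < |x| → iteratedDeriv (⌈α⌉₊ - 1) ψ x = 0) ∧
    ∀ x y, |iteratedDeriv (⌈α⌉₊ - 1) ψ x - iteratedDeriv (⌈α⌉₊ - 1) ψ y| ≤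
      C * |x - y| ^ (α - ((⌈α⌉₊ - 1 : ℕ) : ℝ)) := by
  set k := ⌈α⌉₊ - 1 with hk
  let ψ : ContDiffBump (0 : ℝ) := ⟨1, 2, one_pos, one_lt_two⟩
  have hψ : ContDiff ℝ (⊤ : ℕ∞) ψ := ψ.contDiff
  have hsub : ∀ x, iteratedDeriv k ψ x ≠ 0 → |x| ≤ 2 := by
    intro x hx
    have h1 : x ∈ tsupport (iteratedFDeriv ℝ k (ψ : ℝ → ℝ)) := by
      apply subset_tsupport
      rw [Function.mem_support]
      intro h0
      exact hx (by rw [iteratedDeriv_eq_iteratedFDeriv, h0]; rfl)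
    have h2 := tsupport_iteratedFDeriv_subset (𝕜 := ℝ) (f := (ψ : ℝ → ℝ)) k h1
    rw [ψ.tsupport_eq] at h2
    simpa [ψ] using h2
  have hcs : HasCompactSupport (iteratedDeriv k ψ) := by
    refine HasCompactSupport.of_support_subset_isCompact (isCompact_closedBall (0 : ℝ) 2) ?_
    intro x hx
    simpa using hsub x hx
  have hCD : ContDiff ℝ 1 (iteratedDeriv k ψ) :=
    (contDiff_nat_succ_iff_contDiff_one_iteratedDeriv.1 (hψ.of_le (by exact_mod_cast le_top))).2
  obtain ⟨K₀, hK₀⟩ := hcs.exists_bound_of_continuous hCD.continuous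
  obtain ⟨K₁, hK₁⟩ := hCD.lipschitzWith_of_hasCompactSupport hcs one_ne_zero
  have hK₀0 : 0 ≤ K₀ := (norm_nonneg _).trans (hK₀ 0)
  refine ⟨ψ, 2 * K₀ + K₁ + 1, by positivity, hψ, fun x => ψ.nonneg, fun x => ψ.le_one,
    fun x hx => ψ.one_of_mem_closedBall (by simpa [ψ] using hx), fun x hx => ?_, fun x hx => ?_, ?_⟩
  · refine ψ.zero_of_le_dist ?_
    simpa [ψ] using hx.le
  · by_contra h
    exact absurd (hsub x h) (not_le.2 hx)
  · intro x y
    set β := α - (k : ℝ) with hβ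
    have hβ0 : 0 < β := sub_pos.2 (ceil_sub_one_lt hα)
    have hβ1 : β ≤ 1 := by have := le_ceil_sub_one_add_one hα; simp only [hβ]; linarith
    have hL : |iteratedDeriv k ψ x - iteratedDeriv k ψ y| ≤ K₁ * |x - y| := by
      simpa [Real.dist_eq] using hK₁.dist_le_mul x y
    have hpow : 0 ≤ |x - y| ^ β := by positivity
    rcases le_total |x - y| 1 with h | h
    · have h1 : |x - y| ≤ |x - y| ^ β := Real.self_le_rpow_of_le_one (abs_nonneg _) h hβ1
      calc _ ≤ (K₁ : ℝ) * |x - y| := hL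
        _ ≤ K₁ * |x - y| ^ β := by gcongr
        _ ≤ (2 * K₀ + K₁ + 1) * |x - y| ^ β := by gcongr; linarith
    · have h1 : 1 ≤ |x - y| ^ β := Real.one_le_rpow h hβ0.le
      have hx := hK₀ x
      have hy := hK₀ y
      rw [Real.norm_eq_abs] at hx hy
      calc _ ≤ |iteratedDeriv k ψ x| + |iteratedDeriv k ψ y| := abs_sub _ _
        _ ≤ (2 * K₀) * 1 := by linarith
        _ ≤ (2 * K₀ + K₁ + 1) * |x - y| ^ β := by
          gcongr
          have : (0 : ℝ) ≤ K₁ := K₁.2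
          linarith

/-- Combinations of rescaled copies of a smooth bump with separated supports lie in a Hölder
class. -/
lemma sum_bump_mem_holderClass {α : ℝ} {ψ : ℝ → ℝ} {C : ℝ} (hC : 0 < C)
    (hψ : ContDiff ℝ (⊤ : ℕ∞) ψ)
    (hsupp : ∀ x, 2 < |x| → iteratedDeriv (⌈α⌉₊ - 1) ψ x = 0)
    (hhol : ∀ x y, |iteratedDeriv (⌈α⌉₊ - 1) ψ x - iteratedDeriv (⌈α⌉₊ - 1) ψ y| ≤
      C * |x - y| ^ (α - ((⌈α⌉₊ - 1 : ℕ) : ℝ)))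
    {ι : Type*} (s : Finset ι) (ε : ι → ℝ) (hε : ∀ i, |ε i| ≤ 1) (z : ι → ℝ)
    {A w : ℝ} (hA : 0 ≤ A) (hw : 0 < w) (hz : ∀ i j, i ≠ j → 4 * w < |z i - z j|) :
    (fun x => ∑ i ∈ s, ε i * (A * ψ ((x - z i) / w))) ∈ holderClass α (2 * (A * w ^ (-α) * C)) := by
  classical
  set k := ⌈α⌉₊ - 1 with hk
  have hb : ∀ i, ContDiff ℝ (⊤ : ℕ∞) fun x => ε i * (A * ψ ((x - z i) / w)) := fun i =>
    contDiff_const.mul (contDiff_const.mul (hψ.comp ((contDiff_id.sub contDiff_const).div_const _)))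
  have hder : ∀ i x, iteratedDeriv k (fun x => ε i * (A * ψ ((x - z i) / w))) x =
      ε i * (A * (w⁻¹ ^ k * iteratedDeriv k ψ ((x - z i) / w))) := by
    intro i x
    rw [iteratedDeriv_const_mul_field, iteratedDeriv_const_mul_field]
    have h1 := congrFun (iteratedDeriv_comp_sub_const k (fun y => ψ (w⁻¹ * y)) (z i)) x
    have h2 := congrFun (iteratedDeriv_comp_const_mul (n := k) (f := ψ)
      (hψ.of_le (by exact_mod_cast le_top)) w⁻¹) (x - z i)
    simp only [div_eq_inv_mul]
    rw [h1, h2]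
  set D : ι → ℝ → ℝ := fun i x => ε i * (A * (w⁻¹ ^ k * iteratedDeriv k ψ ((x - z i) / w))) with hD
  have hD0 : ∀ i x, 2 * w < |x - z i| → D i x = 0 := by
    intro i x hx
    simp only [hD]
    rw [hsupp, mul_zero, mul_zero, mul_zero]
    rwa [abs_div, abs_of_pos hw, lt_div_iff₀ hw]
  -- Differentiating `k` times gives `w ^ (-k)` and rescaling the Hölder quotient gives `w ^ (-(α -
  -- k))`; together they make `w ^ (-α)`.
  have hDh : ∀ i x y, |D i x - D i y| ≤ A * w ^ (-α) * C * |x - y| ^ (α - (k : ℝ)) := by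
    intro i x y
    have e : D i x - D i y = ε i * (A * w⁻¹ ^ k *
        (iteratedDeriv k ψ ((x - z i) / w) - iteratedDeriv k ψ ((y - z i) / w))) := by
      simp only [hD]; ring
    have e2 : (x - z i) / w - (y - z i) / w = (x - y) / w := by field_simp; ring
    have e3 : w ^ (-α) = w⁻¹ ^ k * (w ^ (α - (k : ℝ)))⁻¹ := by
      rw [← Real.rpow_neg hw.le, inv_pow, ← Real.rpow_natCast w k, ← Real.rpow_neg hw.le,
        ← Real.rpow_add hw]
      congr 1; ring
    rw [e, abs_mul]
    calc _ ≤ 1 * |A * w⁻¹ ^ k *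
          (iteratedDeriv k ψ ((x - z i) / w) - iteratedDeriv k ψ ((y - z i) / w))| := by
          gcongr; exact hε i
      _ = A * w⁻¹ ^ k *
          |iteratedDeriv k ψ ((x - z i) / w) - iteratedDeriv k ψ ((y - z i) / w)| := by
          rw [one_mul, abs_mul, abs_of_nonneg (by positivity)]
      _ ≤ A * w⁻¹ ^ k * (C * |(x - z i) / w - (y - z i) / w| ^ (α - (k : ℝ))) := by
          gcongr; exact hhol _ _
      _ = _ := by
          rw [e2, abs_div, abs_of_pos hw, Real.div_rpow (abs_nonneg _) hw.le, e3]
          ring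
  -- Separation leaves at most one active bump at each point (`none` when there is none). A
  -- difference between two points thus involves at most two bumps, whence the factor `2` in the
  -- Hölder constant.
  have hone : ∀ x, ∃ i₀ : Option ι, ∀ i, some i ≠ i₀ → D i x = 0 := by
    intro x
    by_cases h : ∃ i, |x - z i| ≤ 2 * w
    · obtain ⟨i, hi⟩ := h
      refine ⟨some i, fun j hj => hD0 j x ?_⟩
      by_contra! hcon
      have h3 := hz i j (fun h => hj (by rw [h]))
      have h4 : |z i - z j| ≤ |x - z i| + |x - z j| := by
        have := abs_sub (x - z j) (x - z i)
        rw [show x - z j - (x - z i) = z i - z j by ring] at this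
        linarith
      linarith
    · push Not at h
      exact ⟨none, fun i _ => hD0 i x (h i)⟩
  refine mem_holderClass_of_contDiff (ContDiff.sum fun i _ => hb i) fun x y => ?_
  have hbk : ∀ i, ContDiff ℝ k fun x => ε i * (A * ψ ((x - z i) / w)) := fun i =>
    (hb i).of_le (by exact_mod_cast le_top)
  rw [← hk, iteratedDeriv_fun_sum fun i _ => (hbk i).contDiffAt,
    iteratedDeriv_fun_sum fun i _ => (hbk i).contDiffAt]
  simp_rw [hder]
  change |∑ i ∈ s, D i x - ∑ i ∈ s, D i y| ≤ _
  obtain ⟨i₀, hi₀⟩ := hone x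
  obtain ⟨j₀, hj₀⟩ := hone y
  set H := A * w ^ (-α) * C * |x - y| ^ (α - (k : ℝ)) with hH
  have hH0 : 0 ≤ H := by positivity
  rw [← Finset.sum_sub_distrib]
  calc |∑ i ∈ s, (D i x - D i y)| ≤ ∑ i ∈ s, |D i x - D i y| := Finset.abs_sum_le_sum_abs _ _
    _ ≤ ∑ i ∈ s, ((if some i = i₀ then H else 0) + (if some i = j₀ then H else 0)) := by
        refine Finset.sum_le_sum fun i _ => ?_
        by_cases h1 : some i = i₀
        · rw [if_pos h1]
          split_ifs <;> linarith [hDh i x y]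
        · by_cases h2 : some i = j₀
          · rw [if_neg h1, if_pos h2]
            linarith [hDh i x y]
          · rw [if_neg h1, if_neg h2, hi₀ i h1, hj₀ i h2]
            simp
    _ ≤ H + H := by
        rw [Finset.sum_add_distrib]
        have : ∀ o : Option ι, ∑ i ∈ s, (if some i = o then H else 0) ≤ H := by
          rintro (_ | o)
          · simpa using hH0
          · simp only [Option.some.injEq, Finset.sum_ite_eq']
            split_ifs <;> linarith
        exact add_le_add (this _) (this _)
    _ = 2 * (A * w ^ (-α) * C) * |x - y| ^ (α - (k : ℝ)) := by rw [hH]; ring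

/-- Reconciles the Lagrange remainder, stated with derivatives within `Icc a x`, with the Hölder
condition, stated within `Icc 0 1`. -/
lemma iteratedDerivWithin_Icc_eq {f : ℝ → ℝ} {n : ℕ} (hf : ContDiffOn ℝ n f (Icc 0 1)) {a x : ℝ}
    (ha : 0 ≤ a) (hax : a < x) (hx : x ≤ 1) {y : ℝ} (hy : y ∈ Icc a x) :
    iteratedDerivWithin n f (Icc a x) y = iteratedDerivWithin n f (Icc 0 1) y := by
  rw [iteratedDerivWithin_eq_iteratedFDerivWithin, iteratedDerivWithin_eq_iteratedFDerivWithin,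
    iteratedFDerivWithin_subset (Icc_subset_Icc ha hx) (uniqueDiffOn_Icc hax)
      (uniqueDiffOn_Icc zero_lt_one) hf hy]

/-- Taylor's theorem in a Hölder class. -/
lemma abs_sub_taylor_le {α M : ℝ} (hα : 0 < α) (hM : 0 ≤ M) {f : ℝ → ℝ} (hf : f ∈ holderClass α M)
    {a x : ℝ} (ha : 0 ≤ a) (hax : a ≤ x) (hx : x ≤ 1) :
    |f x - taylorWithinEval f (⌈α⌉₊ - 1) (Icc 0 1) a x| ≤ M * (x - a) ^ α := by
  have hk1 := ceil_sub_one_lt hα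
  obtain ⟨hf1, hf2⟩ := hf
  generalize ⌈α⌉₊ - 1 = k at *
  rcases eq_or_lt_of_le hax with rfl | hax
  · simp [Real.zero_rpow hα.ne']
  have haI : a ∈ Icc (0 : ℝ) 1 := ⟨ha, hax.le.trans hx⟩
  have hhol : ∀ y ∈ Icc a x, |iteratedDerivWithin k f (Icc 0 1) y -
      iteratedDerivWithin k f (Icc 0 1) a| ≤ M * (x - a) ^ (α - (k : ℝ)) := by
    intro y hy
    rcases eq_or_lt_of_le hy.1 with rfl | hay
    · have := sub_pos.2 hax
      simp only [sub_self, abs_zero]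
      positivity
    · have := hf2 a haI y ⟨ha.trans hy.1, hy.2.trans hx⟩ hay
      rw [abs_sub_comm] at this
      refine this.trans ?_
      rw [abs_sub_comm, abs_of_pos (sub_pos.2 hay)]
      have h0 := sub_pos.2 hay
      have h1 := sub_pos.2 hk1
      gcongr
      exact hy.2
  rcases k with _ | j
  · have := hhol x ⟨hax.le, le_rfl⟩
    simpa [taylor_within_zero_eval] using this
  have hfj : ContDiffOn ℝ (j + 1 : ℕ) f (Icc 0 1) := by exact_mod_cast hf1
  have hsub : Icc a x ⊆ Icc 0 1 := Icc_subset_Icc ha hx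
  have hfj' : ContDiffOn ℝ (j + 1 : ℕ) f (Icc a x) := hfj.mono hsub
  -- The expansion stops at degree `j = k - 1`, so its remainder contains the derivative of order
  -- `k` at `y`. Subtracting the Taylor term of degree `k` leaves the increment of that derivative
  -- from `a` to `y`, which the Hölder condition bounds.
  obtain ⟨y, hy, hyeq⟩ := taylor_mean_remainder_lagrange (f := f) (x := x) (x₀ := a) (n := j) hax.ne
    (by rw [uIcc_of_le hax.le]; exact hfj'.of_le (by exact_mod_cast Nat.le_succ j))
    (by
      rw [uIcc_of_le hax.le, uIoo_of_le hax.le]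
      exact (hfj'.differentiableOn_iteratedDerivWithin (by exact_mod_cast Nat.lt_succ_self j)
        (uniqueDiffOn_Icc hax)).mono Ioo_subset_Icc_self)
  rw [uIcc_of_le hax.le] at hyeq
  rw [uIoo_of_le hax.le] at hy
  have hyI : y ∈ Icc a x := Ioo_subset_Icc_self hy
  have hT : taylorWithinEval f j (Icc a x) a x = taylorWithinEval f j (Icc 0 1) a x := by
    rw [taylor_within_apply, taylor_within_apply]
    refine Finset.sum_congr rfl fun i hi => ?_
    rw [iteratedDerivWithin_Icc_eq (hfj.of_le ?_) ha hax hx ⟨le_rfl, hax.le⟩]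
    have := Finset.mem_range.1 hi
    exact_mod_cast this.le
  rw [hT, iteratedDerivWithin_Icc_eq hfj ha hax hx hyI] at hyeq
  have hxa := sub_pos.2 hax
  have hfac : (1 : ℝ) ≤ (j + 1).factorial := by exact_mod_cast Nat.one_le_iff_ne_zero.2 (Nat.factorial_ne_zero _)
  have e : f x - taylorWithinEval f (j + 1) (Icc 0 1) a x =
      (iteratedDerivWithin (j + 1) f (Icc 0 1) y - iteratedDerivWithin (j + 1) f (Icc 0 1) a) *
        ((x - a) ^ (j + 1) / (j + 1).factorial) := by
    rw [taylorWithinEval_succ, ← sub_sub, hyeq, smul_eq_mul, Nat.factorial_succ]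
    push_cast
    field_simp
  rw [e, abs_mul, abs_of_nonneg (a := (x - a) ^ (j + 1) / ((j + 1).factorial : ℝ)) (by positivity)]
  calc _ ≤ M * (x - a) ^ (α - ((j + 1 : ℕ) : ℝ)) * ((x - a) ^ (j + 1) / 1) := by
        gcongr
        exact hhol y hyI
    _ = M * (x - a) ^ α := by
        rw [div_one, mul_assoc, ← Real.rpow_natCast (x - a) (j + 1), ← Real.rpow_add hxa]
        congr 2; ring

end Holder

/-! ### Lower bounds from one bump and from a hypercube of bumps -/

section LowerBounds

variable {Ω : Type*} [MeasurableSpace Ω] {P : Measure Ω}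

lemma avgMeasure_univ {x₀ c : ℝ} (hc : 0 ≤ c) : avgMeasure x₀ c univ = 1 := by
  unfold avgMeasure
  split_ifs with h
  · simp
  · have hc' : 0 < c := lt_of_le_of_ne hc (Ne.symm h)
    rw [Measure.smul_apply, Measure.restrict_apply_univ, Real.volume_Icc, smul_eq_mul,
      ← ENNReal.ofReal_mul (by positivity), ← ENNReal.ofReal_one]
    congr 1
    field_simp
    ring

lemma avgMeasure_Icc {x₀ c a b : ℝ} (hc : 0 < c) (ha : x₀ - c ≤ a) (hb : b ≤ x₀ + c) :
    avgMeasure x₀ c (Icc a b) = ENNReal.ofReal ((b - a) / (2 * c)) := by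
  rw [avgMeasure, if_neg hc.ne', Measure.smul_apply, Measure.restrict_apply measurableSet_Icc,
    inter_eq_left.2 (Icc_subset_Icc ha hb), Real.volume_Icc, smul_eq_mul,
    ← ENNReal.ofReal_mul (by positivity)]
  congr 1
  ring

lemma aemeasurable_pointRisk [SFinite P] {W : ℝ≥0 → Ω → ℝ} (hWm : ∀ t, Measurable (W t))
    (n : ℕ) {fhat : (unitInterval → ℝ) → ℝ → ℝ} (hfhat : Measurable (Function.uncurry fhat))
    {f : ℝ → ℝ} {x₀ c : ℝ} (hf : ContinuousOn f (Icc (x₀ - c) (x₀ + c))) :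
    AEMeasurable (pointRisk P W n fhat f) (avgMeasure x₀ c) := by
  have h1 : AEMeasurable (fun p : Ω × ℝ => f p.2) (P.prod (avgMeasure x₀ c)) :=
    (aemeasurable_avgMeasure hf).comp_snd
  have h2 : Measurable fun p : Ω × ℝ => fhat (observation n f (W · p.1)) p.2 :=
    hfhat.comp (((measurable_observation hWm n f).comp measurable_fst).prodMk measurable_snd)
  exact ((h2.aemeasurable.sub h1).pow_const 2).ennreal_ofReal.lintegral_prod_left'

/-- The bump is at most `A` in absolute value and lives on an interval of length `4 * w`. The factor
`s` allows for the sign of a flip in the hypercube. -/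
lemma integral_sq_bump_le {ψ : ℝ → ℝ} (hψc : Continuous ψ) (hψ0 : ∀ x, 0 ≤ ψ x)
    (hψ1 : ∀ x, ψ x ≤ 1) (hψs : ∀ x, 2 < |x| → ψ x = 0) {s A w z : ℝ} (hs : |s| ≤ 1)
    (hw : 0 < w) :
    ∫ y in (0 : ℝ)..1, (s * (A * ψ ((y - z) / w))) ^ 2 ≤ 4 * A ^ 2 * w := by
  have hcont : Continuous fun y => (s * (A * ψ ((y - z) / w))) ^ 2 := by fun_prop
  have hle : ∀ y, (s * (A * ψ ((y - z) / w))) ^ 2 ≤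
      (Icc (z - 2 * w) (z + 2 * w)).indicator (fun _ => A ^ 2) y := by
    intro y
    by_cases hy : y ∈ Icc (z - 2 * w) (z + 2 * w)
    · rw [indicator_of_mem hy, mul_pow, mul_pow]
      have h1 : s ^ 2 ≤ 1 := by rwa [sq_le_one_iff_abs_le_one]
      have h2 : ψ ((y - z) / w) ^ 2 ≤ 1 := pow_le_one₀ (hψ0 _) (hψ1 _)
      calc s ^ 2 * (A ^ 2 * ψ ((y - z) / w) ^ 2) ≤ 1 * (A ^ 2 * 1) := by gcongr
        _ = A ^ 2 := by ring
    · rw [indicator_of_notMem hy, hψs]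
      · simp
      · rw [abs_div, abs_of_pos hw, lt_div_iff₀ hw]
        by_contra! h
        have := abs_le.1 h
        exact hy ⟨by linarith [this.1], by linarith [this.2]⟩
  rw [intervalIntegral.integral_of_le zero_le_one]
  have hfin : volume (Icc (z - 2 * w) (z + 2 * w)) ≠ ∞ := measure_Icc_lt_top.ne
  have hint : Integrable ((Icc (z - 2 * w) (z + 2 * w)).indicator fun _ : ℝ => A ^ 2) volume :=
    (integrable_indicator_iff measurableSet_Icc).2 (integrableOn_const hfin)
  calc ∫ y in Ioc (0 : ℝ) 1, (s * (A * ψ ((y - z) / w))) ^ 2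
      ≤ ∫ y in Ioc (0 : ℝ) 1, (Icc (z - 2 * w) (z + 2 * w)).indicator (fun _ => A ^ 2) y :=
        setIntegral_mono (hcont.integrableOn_Icc.mono_set Ioc_subset_Icc_self) hint.integrableOn hle
    _ ≤ ∫ y, (Icc (z - 2 * w) (z + 2 * w)).indicator (fun _ => A ^ 2) y :=
        setIntegral_le_integral hint (ae_of_all _ fun y => indicator_nonneg (fun _ _ => sq_nonneg A) y)
    _ = 4 * A ^ 2 * w := by
        rw [integral_indicator measurableSet_Icc, setIntegral_const, Real.volume_real_Icc_of_le
          (by linarith), smul_eq_mul]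
        ring

lemma continuousOn_window {f : ℝ → ℝ} {α M x₀ c : ℝ} (hf : f ∈ holderClass α M)
    (hI : Icc (x₀ - c) (x₀ + c) ⊆ Icc 0 1) : ContinuousOn f (Icc (x₀ - c) (x₀ + c)) :=
  (continuousOn_of_mem_holderClass hf).mono hI

/-- The constrained risk inequality for a bump of height `A` and width `w` around `x₀`. -/
lemma sq_le_maxRisk_add_risk [IsProbabilityMeasure P] {W : ℝ≥0 → Ω → ℝ}
    (hWm : ∀ t, Measurable (W t)) (hW : IsPreBrownianReal W P) {α M M' : ℝ}
    {ψ : ℝ → ℝ} {C : ℝ} (hC : 0 < C)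
    (hψ : ContDiff ℝ (⊤ : ℕ∞) ψ) (hψ0 : ∀ x, 0 ≤ ψ x) (hψ1 : ∀ x, ψ x ≤ 1)
    (hψe : ∀ x, |x| ≤ 1 → ψ x = 1) (hψs : ∀ x, 2 < |x| → ψ x = 0)
    (hsupp : ∀ x, 2 < |x| → iteratedDeriv (⌈α⌉₊ - 1) ψ x = 0)
    (hhol : ∀ x y, |iteratedDeriv (⌈α⌉₊ - 1) ψ x - iteratedDeriv (⌈α⌉₊ - 1) ψ y| ≤
      C * |x - y| ^ (α - ((⌈α⌉₊ - 1 : ℕ) : ℝ)))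
    {f₀ : ℝ → ℝ} (hf₀ : f₀ ∈ holderClass α M') {n : ℕ} (hn : n ≠ 0)
    {fhat : (unitInterval → ℝ) → ℝ → ℝ} (hfhat : Measurable (Function.uncurry fhat))
    {x₀ c A w : ℝ} (hc : 0 ≤ c) (hI : Icc (x₀ - c) (x₀ + c) ⊆ Icc 0 1)
    (hA : 0 ≤ A) (hw : 0 < w) (hcw : c ≤ w) (hAw : 2 * (A * w ^ (-α) * C) ≤ M - M') :
    ENNReal.ofReal (A ^ 2) ≤ 8 * maxRisk P W α M n fhat x₀ c +
      16 * ENNReal.ofReal (Real.exp (n * (4 * A ^ 2 * w))) * risk P W n fhat f₀ x₀ c := by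
  set g : ℝ → ℝ := fun x => 1 * (A * ψ ((x - x₀) / w)) with hg
  have hgH : g ∈ holderClass α (M - M') := by
    have := sum_bump_mem_holderClass hC hψ hsupp hhol (Finset.univ : Finset Unit) (fun _ => 1)
      (by simp) (fun _ => x₀) hA hw (by simp)
    simp only [Finset.univ_unique, Finset.sum_singleton] at this
    exact holderClass_mono hAw this
  have hfg : (fun x => f₀ x + g x) ∈ holderClass α M := by
    have := add_mem_holderClass hf₀ hgH
    rwa [add_sub_cancel] at this
  have hgi : ∫ y in (0 : ℝ)..1, g y ^ 2 ≤ 4 * A ^ 2 * w :=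
    integral_sq_bump_le hψ.continuous hψ0 hψ1 hψs (by simp) hw
  -- Since `c ≤ w`, the plateau covers the window, where the bump equals `A`.
  have hge : ∀ᵐ x ∂(avgMeasure x₀ c), ENNReal.ofReal (g x ^ 2) = ENNReal.ofReal (A ^ 2) := by
    filter_upwards [avgMeasure_absolutelyContinuous (x₀ := x₀) hc] with x hx
    simp only [hg]
    rw [hψe, mul_one, one_mul]
    rw [abs_div, abs_of_pos hw, div_le_one hw, abs_le]
    exact ⟨by linarith [hx.1], by linarith [hx.2]⟩
  calc ENNReal.ofReal (A ^ 2) = ∫⁻ x, ENNReal.ofReal (g x ^ 2) ∂(avgMeasure x₀ c) := by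
        rw [lintegral_congr_ae hge, lintegral_const, avgMeasure_univ hc, mul_one]
    _ ≤ ∫⁻ x, (8 * pointRisk P W n fhat (fun y => f₀ y + g y) x +
          16 * ENNReal.ofReal (Real.exp (n * (4 * A ^ 2 * w))) * pointRisk P W n fhat f₀ x)
          ∂(avgMeasure x₀ c) := by
        refine lintegral_mono fun x => (sq_le_pointRisk_add_pointRisk hWm hW hn hfhat
          (continuousOn_of_mem_holderClass hf₀) (continuousOn_of_mem_holderClass hgH) x).trans ?_
        gcongr
    _ = 8 * risk P W n fhat (fun y => f₀ y + g y) x₀ c +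
          16 * ENNReal.ofReal (Real.exp (n * (4 * A ^ 2 * w))) * risk P W n fhat f₀ x₀ c := by
        rw [lintegral_add_left' ((aemeasurable_pointRisk hWm n hfhat
          (continuousOn_window hfg hI)).const_mul _), lintegral_const_mul' _ _ (by finiteness),
          lintegral_const_mul' _ _ (by finiteness),
          risk_eq_lintegral_pointRisk hWm n hfhat (continuousOn_window hfg hI),
          risk_eq_lintegral_pointRisk hWm n hfhat (continuousOn_window hf₀ hI)]
    _ ≤ _ := by
        gcongr
        exact le_iSup₂_of_le _ hfg le_rfl

/-- The minimax lower bound from a hypercube of `m` separated bumps. -/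
lemma sq_le_maxRisk [IsProbabilityMeasure P] {W : ℝ≥0 → Ω → ℝ}
    (hWm : ∀ t, Measurable (W t)) (hW : IsPreBrownianReal W P) {α M : ℝ}
    {ψ : ℝ → ℝ} {C : ℝ} (hC : 0 < C)
    (hψ : ContDiff ℝ (⊤ : ℕ∞) ψ) (hψ0 : ∀ x, 0 ≤ ψ x) (hψ1 : ∀ x, ψ x ≤ 1)
    (hψe : ∀ x, |x| ≤ 1 → ψ x = 1) (hψs : ∀ x, 2 < |x| → ψ x = 0)
    (hsupp : ∀ x, 2 < |x| → iteratedDeriv (⌈α⌉₊ - 1) ψ x = 0)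
    (hhol : ∀ x y, |iteratedDeriv (⌈α⌉₊ - 1) ψ x - iteratedDeriv (⌈α⌉₊ - 1) ψ y| ≤
      C * |x - y| ^ (α - ((⌈α⌉₊ - 1 : ℕ) : ℝ)))
    {n : ℕ} (hn : n ≠ 0) {fhat : (unitInterval → ℝ) → ℝ → ℝ}
    (hfhat : Measurable (Function.uncurry fhat))
    {x₀ c A : ℝ} (hc : 0 < c) (hI : Icc (x₀ - c) (x₀ + c) ⊆ Icc 0 1)
    (hA : 0 ≤ A) {m : ℕ} (hm : m ≠ 0) {w : ℝ} (hw : w = 2 * c / (5 * m))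
    (hAw : 2 * (A * w ^ (-α) * C) ≤ M) :
    ENNReal.ofReal (A ^ 2 * (2 / 5)) ≤
      (8 + 16 * ENNReal.ofReal (Real.exp (n * (4 * A ^ 2 * w)))) *
        maxRisk P W α M n fhat x₀ c := by
  have hm0 : (0 : ℝ) < m := by exact_mod_cast Nat.pos_of_ne_zero hm
  have hw0 : 0 < w := by rw [hw]; positivity
  have hwc : 5 * m * w = 2 * c := by rw [hw]; field_simp
  -- Centres of `m` slots of length `5 * w` that tile the window. Neighbouring centres are more than
  -- `4 * w` apart, so the supports, of half-width `2 * w`, are disjoint.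
  set z : Fin m → ℝ := fun j => x₀ - c + (2 * (j : ℕ) + 1) * (5 * w / 2) with hz
  have hzsep : ∀ i j, i ≠ j → 4 * w < |z i - z j| := by
    intro i j hij
    have h1 : z i - z j = ((i : ℕ) - (j : ℕ) : ℝ) * (5 * w) := by simp only [hz]; ring
    have h2 : (1 : ℝ) ≤ |((i : ℕ) - (j : ℕ) : ℝ)| := by
      have : ((i : ℕ) : ℤ) - ((j : ℕ) : ℤ) ≠ 0 := by
        intro h; exact hij (Fin.ext (by omega))
      exact_mod_cast Int.one_le_abs this
    rw [h1, abs_mul, abs_of_pos (by positivity : 0 < 5 * w)]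
    nlinarith
  set b : Fin m → ℝ → ℝ := fun j x => A * ψ ((x - z j) / w) with hb
  set F : (Fin m → Bool) → ℝ → ℝ := fun ε x => ∑ j, (if ε j then 1 else 0) * b j x with hF
  have hFH : ∀ ε, F ε ∈ holderClass α M := fun ε => holderClass_mono hAw
    (sum_bump_mem_holderClass hC hψ hsupp hhol Finset.univ (fun j => if ε j then 1 else 0)
      (fun j => by split_ifs <;> simp) z hA hw0 hzsep)
  set E := ENNReal.ofReal (Real.exp (n * (4 * A ^ 2 * w))) with hE
  -- Flipping one coordinate permutes the vertices of the cube, so in the two-point inequality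
  -- summed over all vertices both risks have the same total.
  set flip : Fin m → (Fin m → Bool) → (Fin m → Bool) := fun j ε => Function.update ε j (!ε j)
    with hflip
  have hinv : ∀ j, Function.Involutive (flip j) := by
    intro j ε
    simp [hflip]
  have hpt : ∀ j ε x, ENNReal.ofReal (b j x ^ 2) ≤
      8 * pointRisk P W n fhat (F (flip j ε)) x + 16 * E * pointRisk P W n fhat (F ε) x := by
    intro j ε x
    set s : ℝ := if ε j then -1 else 1 with hs
    have hs1 : |s| ≤ 1 := by simp only [hs]; split_ifs <;> simp
    have hs2 : s ^ 2 = 1 := by simp only [hs]; split_ifs <;> simp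
    have hflipF : F (flip j ε) = fun y => F ε y + s * (A * ψ ((y - z j) / w)) := by
      ext y
      simp only [hF]
      rw [← Finset.add_sum_erase _ _ (Finset.mem_univ j),
        ← Finset.add_sum_erase _ _ (Finset.mem_univ j)]
      have h1 : ∑ i ∈ Finset.univ.erase j, (if flip j ε i then (1 : ℝ) else 0) * b i y =
          ∑ i ∈ Finset.univ.erase j, (if ε i then (1 : ℝ) else 0) * b i y := by
        refine Finset.sum_congr rfl fun i hi => ?_
        simp [hflip, Function.update_of_ne (Finset.ne_of_mem_erase hi)]
      rw [h1]
      cases h : ε j <;> simp [hflip, hs, h, hb] <;> ring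
    have hcont : ContinuousOn (fun y => s * (A * ψ ((y - z j) / w))) (Icc 0 1) := by
      have := hψ.continuous
      fun_prop
    have key := sq_le_pointRisk_add_pointRisk hWm hW hn hfhat
      (continuousOn_of_mem_holderClass (hFH ε)) hcont x
    rw [← hflipF, mul_pow, hs2, one_mul] at key
    refine key.trans ?_
    rw [hE]
    gcongr
    exact integral_sq_bump_le hψ.continuous hψ0 hψ1 hψs hs1 hw0
  have hsum : ∀ j x, 2 ^ m * ENNReal.ofReal (b j x ^ 2) ≤
      (8 + 16 * E) * ∑ ε, pointRisk P W n fhat (F ε) x := by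
    intro j x
    calc 2 ^ m * ENNReal.ofReal (b j x ^ 2) =
        ∑ _ε : Fin m → Bool, ENNReal.ofReal (b j x ^ 2) := by
          simp
      _ ≤ ∑ ε, (8 * pointRisk P W n fhat (F (flip j ε)) x +
            16 * E * pointRisk P W n fhat (F ε) x) := Finset.sum_le_sum fun ε _ => hpt j ε x
      _ = _ := by
          have h1 : ∑ ε, pointRisk P W n fhat (F (flip j ε)) x =
              ∑ ε, pointRisk P W n fhat (F ε) x :=
            Equiv.sum_comp (hinv j).toPerm (fun ε => pointRisk P W n fhat (F ε) x)
          rw [Finset.sum_add_distrib, ← Finset.mul_sum, ← Finset.mul_sum, h1, add_mul]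
  -- At each `x` at most one bump is nonzero, so the sum over `j` costs no factor `m`.
  have hall : ∀ x, 2 ^ m * ∑ j, ENNReal.ofReal (b j x ^ 2) ≤
      (8 + 16 * E) * ∑ ε, pointRisk P W n fhat (F ε) x := by
    intro x
    by_cases h : ∃ j, |x - z j| ≤ 2 * w
    · obtain ⟨j, hj⟩ := h
      rw [Finset.sum_eq_single_of_mem j (Finset.mem_univ j)]
      · exact hsum j x
      · intro i _ hij
        simp only [hb]
        rw [hψs]
        · simp
        · rw [abs_div, abs_of_pos hw0, lt_div_iff₀ hw0]
          have h3 := hzsep i j hij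
          have h4 : |z i - z j| ≤ |x - z i| + |x - z j| := by
            have := abs_sub (x - z j) (x - z i)
            rw [show x - z j - (x - z i) = z i - z j by ring] at this
            linarith
          linarith
    · push Not at h
      rw [Finset.sum_eq_zero]
      · simp
      · intro j _
        simp only [hb]
        rw [hψs]
        · simp
        · rw [abs_div, abs_of_pos hw0, lt_div_iff₀ hw0]
          exact h j
  -- Only the plateau, of length `2 * w`, is counted; it is the fraction `2 / (5 * m)` of the
  -- window.
  have hbint : ∀ j, ENNReal.ofReal (A ^ 2 * (2 / (5 * m))) ≤
      ∫⁻ x, ENNReal.ofReal (b j x ^ 2) ∂(avgMeasure x₀ c) := by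
    intro j
    have hj : ((j : ℕ) : ℝ) + 1 ≤ m := by exact_mod_cast j.2
    have hj0 : (0 : ℝ) ≤ (j : ℕ) := Nat.cast_nonneg _
    have hmes := avgMeasure_Icc (x₀ := x₀) (a := z j - w) (b := z j + w) hc
      (by simp only [hz]; nlinarith) (by simp only [hz]; nlinarith)
    have e : (z j + w - (z j - w)) / (2 * c) = 2 / (5 * m) := by
      rw [← hwc]; field_simp; ring
    rw [e] at hmes
    calc ENNReal.ofReal (A ^ 2 * (2 / (5 * m)))
        = ∫⁻ _ in Icc (z j - w) (z j + w), ENNReal.ofReal (A ^ 2) ∂(avgMeasure x₀ c) := by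
          rw [setLIntegral_const, hmes, ENNReal.ofReal_mul (sq_nonneg _)]
      _ ≤ ∫⁻ x in Icc (z j - w) (z j + w), ENNReal.ofReal (b j x ^ 2) ∂(avgMeasure x₀ c) := by
          refine setLIntegral_mono_ae' measurableSet_Icc (ae_of_all _ fun x hx => ?_)
          simp only [hb]
          rw [hψe, mul_one]
          rw [abs_div, abs_of_pos hw0, div_le_one hw0, abs_le]
          exact ⟨by linarith [hx.1], by linarith [hx.2]⟩
      _ ≤ _ := setLIntegral_le_lintegral _ _
  have h2m : (2 : ℝ≥0∞) ^ m ≠ 0 := by positivity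
  have h2m' : (2 : ℝ≥0∞) ^ m ≠ ∞ := by finiteness
  have hbm : ∀ j, Measurable fun x => ENNReal.ofReal (b j x ^ 2) := by
    intro j
    have := hψ.continuous.measurable
    simp only [hb]
    fun_prop
  rw [← ENNReal.mul_le_mul_iff_right h2m h2m']
  calc 2 ^ m * ENNReal.ofReal (A ^ 2 * (2 / 5))
      = 2 ^ m * ∑ _j : Fin m, ENNReal.ofReal (A ^ 2 * (2 / (5 * m))) := by
        rw [Finset.sum_const, Finset.card_univ, Fintype.card_fin, nsmul_eq_mul,
          ← ENNReal.ofReal_natCast m, ← ENNReal.ofReal_mul hm0.le]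
        congr 2
        field_simp
    _ ≤ 2 ^ m * ∑ j : Fin m, ∫⁻ x, ENNReal.ofReal (b j x ^ 2) ∂(avgMeasure x₀ c) := by
        gcongr with j
        exact hbint j
    _ = ∫⁻ x, 2 ^ m * ∑ j : Fin m, ENNReal.ofReal (b j x ^ 2) ∂(avgMeasure x₀ c) := by
        rw [lintegral_const_mul' _ _ h2m', lintegral_finsetSum _ fun j _ => hbm j]
    _ ≤ ∫⁻ x, (8 + 16 * E) * ∑ ε, pointRisk P W n fhat (F ε) x ∂(avgMeasure x₀ c) :=
        lintegral_mono hall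
    _ = (8 + 16 * E) * ∑ ε, risk P W n fhat (F ε) x₀ c := by
        rw [lintegral_const_mul' _ _ (by finiteness), lintegral_finsetSum' _ fun ε _ =>
          aemeasurable_pointRisk hWm n hfhat (continuousOn_window (hFH ε) hI)]
        congr 1
        refine Finset.sum_congr rfl fun ε _ => ?_
        rw [risk_eq_lintegral_pointRisk hWm n hfhat (continuousOn_window (hFH ε) hI)]
    _ ≤ (8 + 16 * E) * ∑ _ε : Fin m → Bool, maxRisk P W α M n fhat x₀ c := by
        gcongr with ε
        exact le_iSup₂_of_le _ (hFH ε) le_rfl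
    _ = _ := by
        simp
        ring

end LowerBounds

/-! ### Lower bounds in the three regimes -/

section Regimes

variable {Ω : Type*} [MeasurableSpace Ω] {P : Measure Ω}

lemma eventually_lt_of_limsup_ofReal_eq_zero {u : ℕ → ℝ}
    (h : limsup (fun n => ENNReal.ofReal (u n)) atTop = 0) {ε : ℝ} (hε : 0 < ε) :
    ∀ᶠ n in atTop, u n < ε := by
  have h1 : limsup (fun n => ENNReal.ofReal (u n)) atTop < ENNReal.ofReal ε := by
    rw [h]; exact ENNReal.ofReal_pos.2 hε
  filter_upwards [eventually_lt_of_limsup_lt h1] with n hn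
  exact (ENNReal.ofReal_lt_ofReal_iff hε).1 hn

lemma exists_eventually_le_of_liminf_ofReal_pos {u : ℕ → ℝ}
    (h : 0 < liminf (fun n => ENNReal.ofReal (u n)) atTop) :
    ∃ a : ℝ, 0 < a ∧ ∀ᶠ n in atTop, a ≤ u n := by
  obtain ⟨b, hb0, hb⟩ := exists_between h
  have hbt : b ≠ ∞ := (hb.trans_le le_top).ne
  refine ⟨b.toReal, ENNReal.toReal_pos hb0.ne' hbt, ?_⟩
  filter_upwards [eventually_lt_of_lt_liminf hb] with n hn
  rw [← ENNReal.ofReal_toReal hbt] at hn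
  exact ((ENNReal.ofReal_lt_ofReal_iff_of_nonneg ENNReal.toReal_nonneg).1 hn).le

lemma exists_eventually_le_of_limsup_lt_top {u : ℕ → ℝ≥0∞} (h : limsup u atTop < ∞) :
    ∃ K : ℝ, 0 < K ∧ ∀ᶠ n in atTop, u n ≤ ENNReal.ofReal K := by
  obtain ⟨b, hb0, hb⟩ := exists_between h
  refine ⟨b.toReal + 1, by positivity, ?_⟩
  filter_upwards [eventually_lt_of_limsup_lt hb0] with n hn
  refine hn.le.trans ?_
  rw [← ENNReal.ofReal_toReal hb.ne]
  exact ENNReal.ofReal_le_ofReal (by simp)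

lemma limsup_lt_top_of_eventually_le {u : ℕ → ℝ≥0∞} {K : ℝ}
    (h : ∀ᶠ n in atTop, u n ≤ ENNReal.ofReal K) : limsup u atTop < ∞ :=
  (limsup_le_of_le (by isBoundedDefault) h).trans_lt ENNReal.ofReal_lt_top

lemma liminf_pos_of_eventually_le {u : ℕ → ℝ≥0∞} {η : ℝ} (hη : 0 < η)
    (h : ∀ᶠ n in atTop, ENNReal.ofReal η ≤ u n) : 0 < liminf u atTop :=
  (ENNReal.ofReal_pos.2 hη).trans_le (le_liminf_of_le (by isBoundedDefault) h)

/-- Lower bounds for superefficient estimators from bumps of heights `A n` and widths `w n`. -/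
lemma liminf_maxRisk_pos_of_superefficient [IsProbabilityMeasure P] {W : ℝ≥0 → Ω → ℝ}
    (hWm : ∀ t, Measurable (W t)) (hW : IsPreBrownianReal W P) {α M M' x₀ : ℝ}
    {ψ : ℝ → ℝ} {C : ℝ} (hC : 0 < C)
    (hψ : ContDiff ℝ (⊤ : ℕ∞) ψ) (hψ0 : ∀ x, 0 ≤ ψ x) (hψ1 : ∀ x, ψ x ≤ 1)
    (hψe : ∀ x, |x| ≤ 1 → ψ x = 1) (hψs : ∀ x, 2 < |x| → ψ x = 0)
    (hsupp : ∀ x, 2 < |x| → iteratedDeriv (⌈α⌉₊ - 1) ψ x = 0)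
    (hhol : ∀ x y, |iteratedDeriv (⌈α⌉₊ - 1) ψ x - iteratedDeriv (⌈α⌉₊ - 1) ψ y| ≤
      C * |x - y| ^ (α - ((⌈α⌉₊ - 1 : ℕ) : ℝ)))
    {c B : ℕ → ℝ} (hc : ∀ n, 0 ≤ c n)
    (hcI : ∀ᶠ n in atTop, Icc (x₀ - c n) (x₀ + c n) ⊆ Icc 0 1)
    (hB : Tendsto B atTop atTop) {f₀ : ℝ → ℝ} (hf₀ : f₀ ∈ holderClass α M')
    {fhat : ℕ → (unitInterval → ℝ) → ℝ → ℝ} (hfhat : fhat ∈ superefficient P W α B x₀ c f₀)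
    {A w r : ℕ → ℝ} {η : ℝ} (hη : 0 < η)
    (hA : ∀ᶠ n in atTop, 0 ≤ A n) (hw : ∀ᶠ n in atTop, 0 < w n) (hcw : ∀ᶠ n in atTop, c n ≤ w n)
    (hAw : ∀ᶠ n in atTop, 2 * (A n * w n ^ (-α) * C) ≤ M - M')
    (hKL : ∀ᶠ n : ℕ in atTop, n * (4 * A n ^ 2 * w n) ≤ Real.log (B n) / 2)
    (hrA : ∀ᶠ n in atTop, η ≤ r n * A n ^ 2) (hr0 : ∀ᶠ n in atTop, 0 ≤ r n)
    (hr : ∀ᶠ n : ℕ in atTop, r n ≤ (n : ℝ) ^ (2 * α / (1 + 2 * α))) :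
    0 < liminf (fun n => ENNReal.ofReal (r n) * maxRisk P W α M n (fhat n) x₀ (c n)) atTop := by
  obtain ⟨K, hK0, hK⟩ := exists_eventually_le_of_limsup_lt_top hfhat.2
  -- The condition `B n ≥ (32 * K / η) ^ 2` below makes the term at `f₀` at most `16 * (η / 32) = η
  -- / 2`. The other half of `η`, divided by the factor `8` of the worst-case risk, is `η / 16`.
  refine liminf_pos_of_eventually_le (η := η / 16) (by positivity) ?_
  filter_upwards [hA, hw, hcw, hAw, hKL, hrA, hr0, hr, hK, hcI, eventually_ne_atTop 0,
    hB.eventually_ge_atTop ((32 * K / η) ^ 2), hB.eventually_gt_atTop 0]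
    with n hA hw hcw hAw hKL hrA hr0 hr hK hcI hn hB1 hB0
  have key := sq_le_maxRisk_add_risk hWm hW hC hψ hψ0 hψ1 hψe hψs hsupp hhol hf₀ hn (hfhat.1 n)
    (hc n) hcI hA hw hcw hAw
  set R := maxRisk P W α M n (fhat n) x₀ (c n)
  set R₀ := risk P W n (fhat n) f₀ x₀ (c n)
  set ρ := (n : ℝ) ^ (2 * α / (1 + 2 * α)) with hρ
  have hρ0 : 0 ≤ ρ := by positivity
  set s := √(B n) with hs
  have hs0 : 0 < s := Real.sqrt_pos.2 hB0
  have hss : s * s = B n := Real.mul_self_sqrt hB0.le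
  have hs1 : 32 * K / η ≤ s := Real.le_sqrt_of_sq_le hB1
  -- The exponential costs only `√(B n)`, while superefficiency gains `B n`; a factor `√(B n)`
  -- remains to make the term at `f₀` negligible.
  have hexp : Real.exp (n * (4 * A n ^ 2 * w n)) ≤ s := by
    calc _ ≤ Real.exp (Real.log (B n) / 2) := Real.exp_le_exp.2 hKL
      _ = s := by rw [hs, Real.sqrt_eq_rpow, Real.rpow_def_of_pos hB0]; congr 1; ring
  set X := ENNReal.ofReal (ρ * s) * R₀ with hX
  have hX1 : X * ENNReal.ofReal s ≤ ENNReal.ofReal K := by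
    refine le_trans (le_of_eq ?_) hK
    rw [hX, ← hss, ← mul_assoc ρ, ENNReal.ofReal_mul (p := ρ * s) (by positivity)]
    ring
  have hX2 : X ≤ ENNReal.ofReal (η / 32) := by
    refine (ENNReal.le_div_iff_mul_le (Or.inl (by simpa using hs0))
      (Or.inl ENNReal.ofReal_ne_top)).2 hX1 |>.trans ?_
    rw [← ENNReal.ofReal_div_of_pos hs0]
    refine ENNReal.ofReal_le_ofReal ?_
    rw [div_le_iff₀ hs0]
    rw [div_le_iff₀ hη] at hs1
    linarith
  have h1 : ENNReal.ofReal η ≤ 8 * (ENNReal.ofReal (r n) * R) + ENNReal.ofReal (η / 2) := by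
    calc ENNReal.ofReal η ≤ ENNReal.ofReal (r n * A n ^ 2) := ENNReal.ofReal_le_ofReal hrA
      _ = ENNReal.ofReal (r n) * ENNReal.ofReal (A n ^ 2) := ENNReal.ofReal_mul hr0
      _ ≤ ENNReal.ofReal (r n) * (8 * R +
          16 * ENNReal.ofReal (Real.exp (n * (4 * A n ^ 2 * w n))) * R₀) := by gcongr
      _ ≤ ENNReal.ofReal (r n) * (8 * R) + ENNReal.ofReal ρ * (16 * ENNReal.ofReal s * R₀) := by
          rw [mul_add]; gcongr
      _ = 8 * (ENNReal.ofReal (r n) * R) + 16 * X := by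
          rw [hX, ENNReal.ofReal_mul hρ0]; ring
      _ ≤ _ := by
          have : ENNReal.ofReal (η / 2) = 16 * ENNReal.ofReal (η / 32) := by
            rw [← ENNReal.ofReal_ofNat, ← ENNReal.ofReal_mul (by norm_num)]
            congr 1; ring
          rw [this]
          gcongr
  have h2 : ENNReal.ofReal η = 8 * ENNReal.ofReal (η / 16) + ENNReal.ofReal (η / 2) := by
    rw [← ENNReal.ofReal_ofNat, ← ENNReal.ofReal_mul (by norm_num), ← ENNReal.ofReal_add
      (by positivity) (by positivity)]
    congr 1; ring
  rw [h2] at h1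
  have h3 := (ENNReal.add_le_add_iff_right ENNReal.ofReal_ne_top).1 h1
  exact (ENNReal.mul_le_mul_iff_right (by norm_num) (by norm_num)).1 h3

lemma div_one_add_two_mul {α : ℝ} (hα : 0 < α) :
    (1 : ℝ) + -(2 * α / (1 + 2 * α)) + -1 / (1 + 2 * α) = 0 := by
  field_simp
  ring

/-- The width `h` solves `n * h ^ (1 + 2 * α) = log B`, so a height of order `h ^ α` meets the
smoothness and the information constraint together. The hypothesis on `d` says that `h` eventually
exceeds the window's half-width. -/
lemma lower_bound_short_window [IsProbabilityMeasure P] {W : ℝ≥0 → Ω → ℝ}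
    (hWm : ∀ t, Measurable (W t)) (hW : IsPreBrownianReal W P)
    {α x₀ M M' : ℝ} (hα : 0 < α) (hM : M' < M) {d c B : ℕ → ℝ} (hd : ∀ n, 0 ≤ d n)
    (hc : ∀ n, c n = d n * (n : ℝ) ^ (-1 / (1 + 2 * α)))
    (hcI : ∀ᶠ n in atTop, Icc (x₀ - c n) (x₀ + c n) ⊆ Icc 0 1)
    (hB : Tendsto B atTop atTop) {f₀ : ℝ → ℝ} (hf₀ : f₀ ∈ holderClass α M')
    (hlim : limsup (fun n => ENNReal.ofReal (d n * Real.log (B n) ^ (-1 / (1 + 2 * α)))) atTop = 0)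
    {fhat : ℕ → (unitInterval → ℝ) → ℝ → ℝ} (hfhat : fhat ∈ superefficient P W α B x₀ c f₀) :
    0 < liminf (fun n : ℕ => ENNReal.ofReal (((n : ℝ) / Real.log (B n)) ^ (2 * α / (1 + 2 * α))) *
      maxRisk P W α M n (fhat n) x₀ (c n)) atTop := by
  obtain ⟨ψ, C, hC, hψ, hψ0, hψ1, hψe, hψs, hsupp, hhol⟩ := exists_bump hα
  have hp : 0 < 1 + 2 * α := by positivity
  have hc0 : ∀ n, 0 ≤ c n := fun n => by rw [hc]; have := hd n; positivity
  -- The bound `1 / 4` keeps the information `4 * κ ^ 2 * log B` below `log B / 2`; the other bound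
  -- keeps the perturbed function in the class with constant `M`.
  set κ := min (1 / 4) ((M - M') / (2 * C)) with hκ
  have hMM := sub_pos.2 hM
  have hκ0 : 0 < κ := lt_min (by norm_num) (by positivity)
  have hκ1 : κ ≤ 1 / 4 := min_le_left _ _
  have hκ2 : 2 * C * κ ≤ M - M' := by
    have := min_le_right (1 / 4) ((M - M') / (2 * C))
    rw [← hκ, le_div_iff₀ (by positivity)] at this
    linarith
  have hL : ∀ᶠ n in atTop, 1 ≤ Real.log (B n) :=
    (Real.tendsto_log_atTop.comp hB).eventually_ge_atTop 1
  set h : ℕ → ℝ := fun n => (Real.log (B n) / n) ^ (1 / (1 + 2 * α)) with hh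
  have hpos : ∀ᶠ n : ℕ in atTop, 0 < Real.log (B n) / n := by
    filter_upwards [hL, eventually_gt_atTop 0] with n hn hn0
    have : (0 : ℝ) < n := by exact_mod_cast hn0
    positivity
  refine liminf_maxRisk_pos_of_superefficient hWm hW hC hψ hψ0 hψ1 hψe hψs hsupp hhol hc0 hcI hB
    hf₀ hfhat (A := fun n => κ * h n ^ α) (w := h) (η := κ ^ 2) (by positivity) ?_ ?_ ?_ ?_ ?_ ?_ ?_ ?_
  · filter_upwards [hpos] with n hn
    positivity
  · filter_upwards [hpos] with n hn
    positivity
  · filter_upwards [hL, hpos, eventually_lt_of_limsup_ofReal_eq_zero hlim one_pos,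
      eventually_gt_atTop 0] with n hn hn1 hn2 hn0
    have hn0' : (0 : ℝ) < n := by exact_mod_cast hn0
    have hL0 : 0 < Real.log (B n) := by linarith
    have e1 : h n = Real.log (B n) ^ (1 / (1 + 2 * α)) * (n : ℝ) ^ (-1 / (1 + 2 * α)) := by
      simp only [hh]
      rw [Real.div_rpow hL0.le hn0'.le, neg_div, Real.rpow_neg hn0'.le, div_eq_mul_inv]
    rw [hc, e1]
    gcongr
    rw [neg_div, Real.rpow_neg hL0.le, ← div_eq_mul_inv, div_lt_one (by positivity)] at hn2
    exact hn2.le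
  · filter_upwards [hpos] with n hn
    have hh0 : 0 < h n := by positivity
    rw [mul_assoc κ, ← Real.rpow_add hh0, add_neg_cancel, Real.rpow_zero]
    linarith
  · filter_upwards [hpos, eventually_gt_atTop 0] with n hn hn0
    have hn0' : (0 : ℝ) < n := by exact_mod_cast hn0
    have hh0 : 0 < h n := by positivity
    have hL0 : 0 < Real.log (B n) := by
      have := mul_pos hn hn0'
      rwa [div_mul_cancel₀ _ hn0'.ne'] at this
    have e1 : (h n ^ α) ^ 2 * h n = Real.log (B n) / n := by
      rw [← Real.rpow_natCast, ← Real.rpow_mul hh0.le]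
      conv_lhs => rw [← Real.rpow_one (h n), ← Real.rpow_mul hh0.le]
      rw [← Real.rpow_add hh0]
      simp only [hh]
      rw [← Real.rpow_mul hn.le]
      conv_rhs => rw [← Real.rpow_one (Real.log (B n) / n)]
      congr 1
      push_cast
      field_simp
      ring
    have e2 : (n : ℝ) * (4 * (κ * h n ^ α) ^ 2 * h n) = 4 * κ ^ 2 * Real.log (B n) := by
      rw [mul_pow, show (n : ℝ) * (4 * (κ ^ 2 * (h n ^ α) ^ 2) * h n) =
        n * (4 * κ ^ 2) * ((h n ^ α) ^ 2 * h n) by ring, e1]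
      field_simp
    have e3 : 4 * κ ^ 2 ≤ 1 / 2 := by nlinarith
    rw [e2]
    calc 4 * κ ^ 2 * Real.log (B n) ≤ 1 / 2 * Real.log (B n) := by gcongr
      _ = _ := by ring
  · filter_upwards [hpos, eventually_gt_atTop 0] with n hn hn0
    have hh0 : 0 < h n := by positivity
    have e1 : ((n : ℝ) / Real.log (B n)) ^ (2 * α / (1 + 2 * α)) * (h n ^ α) ^ 2 = 1 := by
      rw [← inv_div, Real.inv_rpow hn.le, ← Real.rpow_natCast, ← Real.rpow_mul hh0.le]
      simp only [hh]
      rw [← Real.rpow_mul hn.le]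
      have : 1 / (1 + 2 * α) * (α * (2 : ℕ)) = 2 * α / (1 + 2 * α) := by push_cast; ring
      rw [this]
      exact inv_mul_cancel₀ (by positivity)
    rw [mul_pow, mul_left_comm, e1, mul_one]
  · filter_upwards [hL] with n hn
    positivity
  · filter_upwards [hL] with n hn
    gcongr
    exact div_le_self (Nat.cast_nonneg _) hn

/-- The bump must be as wide as the window, and the information constraint alone fixes its height.
Smoothness, `A ≲ c ^ α`, then reads `log B ≲ d ^ (1 + 2 * α)`, which is the lower bound on `d`; the
upper bound on `d` keeps the normalisation below the minimax one. -/
lemma lower_bound_middle_window [IsProbabilityMeasure P] {W : ℝ≥0 → Ω → ℝ}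
    (hWm : ∀ t, Measurable (W t)) (hW : IsPreBrownianReal W P)
    {α x₀ M M' : ℝ} (hα : 0 < α) (hM : M' < M) {d c B : ℕ → ℝ} (hd : ∀ n, 0 ≤ d n)
    (hc : ∀ n, c n = d n * (n : ℝ) ^ (-1 / (1 + 2 * α)))
    (hcI : ∀ᶠ n in atTop, Icc (x₀ - c n) (x₀ + c n) ⊆ Icc 0 1)
    (hB : Tendsto B atTop atTop) {f₀ : ℝ → ℝ} (hf₀ : f₀ ∈ holderClass α M')
    (hlow : 0 < liminf (fun n => ENNReal.ofReal (d n * Real.log (B n) ^ (-1 / (1 + 2 * α)))) atTop)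
    (hlim : limsup (fun n => ENNReal.ofReal (d n * (Real.log (B n))⁻¹)) atTop = 0)
    {fhat : ℕ → (unitInterval → ℝ) → ℝ → ℝ} (hfhat : fhat ∈ superefficient P W α B x₀ c f₀) :
    0 < liminf (fun n : ℕ =>
      ENNReal.ofReal ((n : ℝ) ^ (2 * α / (1 + 2 * α)) * (d n / Real.log (B n))) *
      maxRisk P W α M n (fhat n) x₀ (c n)) atTop := by
  obtain ⟨ψ, C, hC, hψ, hψ0, hψ1, hψe, hψs, hsupp, hhol⟩ := exists_bump hα
  obtain ⟨a, ha0, ha⟩ := exists_eventually_le_of_liminf_ofReal_pos hlow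
  have hp : 0 < 1 + 2 * α := by positivity
  have hc0 : ∀ n, 0 ≤ c n := fun n => by rw [hc]; have := hd n; positivity
  have hMM := sub_pos.2 hM
  set D := a ^ (1 + 2 * α) with hD
  have hD0 : 0 < D := by positivity
  -- The factor `√D` comes from `D * log B ≤ d ^ (1 + 2 * α)`, the form in which the lower bound on
  -- `d` enters the smoothness constraint.
  set κ := min (1 / 4) ((M - M') / (2 * C) * √D) with hκ
  have hκ0 : 0 < κ := lt_min (by norm_num) (by positivity)
  have hκ1 : κ ≤ 1 / 4 := min_le_left _ _
  have hκ2 : κ ≤ (M - M') / (2 * C) * √D := min_le_right _ _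
  have hL : ∀ᶠ n in atTop, 1 ≤ Real.log (B n) :=
    (Real.tendsto_log_atTop.comp hB).eventually_ge_atTop 1
  have hd0 : ∀ᶠ n in atTop, 0 < d n := by
    filter_upwards [hL, ha] with n hn hn1
    by_contra! h
    have : d n = 0 := le_antisymm h (hd n)
    rw [this, zero_mul] at hn1
    linarith
  set A : ℕ → ℝ := fun n =>
    κ * √(Real.log (B n) / (d n * (n : ℝ) ^ (2 * α / (1 + 2 * α)))) with hA
  have hA2 : ∀ᶠ n : ℕ in atTop, A n ^ 2 =
      κ ^ 2 * (Real.log (B n) / (d n * (n : ℝ) ^ (2 * α / (1 + 2 * α)))) := by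
    filter_upwards [hL, hd0] with n hn hn1
    simp only [hA]
    rw [mul_pow, Real.sq_sqrt (by positivity)]
  refine liminf_maxRisk_pos_of_superefficient hWm hW hC hψ hψ0 hψ1 hψe hψs hsupp hhol hc0 hcI hB
    hf₀ hfhat (A := A) (w := c) (η := κ ^ 2) (by positivity) ?_ ?_ ?_ ?_ ?_ ?_ ?_ ?_
  · exact Eventually.of_forall fun n => by positivity
  · filter_upwards [hd0, eventually_gt_atTop 0] with n hn hn0
    have hn0' : (0 : ℝ) < n := by exact_mod_cast hn0
    rw [hc]
    positivity
  · exact Eventually.of_forall fun n => le_rfl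
  · filter_upwards [hd0, eventually_gt_atTop 0, hA2, hL, ha] with n hn hn0 hA2 hL ha
    have hn0' : (0 : ℝ) < n := by exact_mod_cast hn0
    have hL0 : 0 < Real.log (B n) := by linarith
    have hA0 : 0 ≤ A n := by positivity
    have hcn : 0 < c n := by rw [hc]; positivity
    have e1 : (c n ^ (-α)) ^ 2 = d n ^ (-(2 * α)) * (n : ℝ) ^ (2 * α / (1 + 2 * α)) := by
      rw [← Real.rpow_natCast, ← Real.rpow_mul hcn.le, hc, Real.mul_rpow hn.le (by positivity),
        ← Real.rpow_mul hn0'.le]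
      congr 2
      · push_cast; ring
      · push_cast; field_simp
    have e2 : (A n * c n ^ (-α)) ^ 2 = κ ^ 2 * (Real.log (B n) / d n ^ (1 + 2 * α)) := by
      rw [mul_pow, hA2, e1, Real.rpow_add hn, Real.rpow_one, Real.rpow_neg hn.le]
      have : (n : ℝ) ^ (2 * α / (1 + 2 * α)) ≠ 0 := by positivity
      field_simp
    have e3 : D * Real.log (B n) ≤ d n ^ (1 + 2 * α) := by
      rw [neg_div, Real.rpow_neg hL0.le, ← div_eq_mul_inv, le_div_iff₀ (by positivity)] at ha
      calc D * Real.log (B n) = (a * Real.log (B n) ^ (1 / (1 + 2 * α))) ^ (1 + 2 * α) := by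
            rw [Real.mul_rpow ha0.le (by positivity), ← Real.rpow_mul hL0.le,
              one_div_mul_cancel hp.ne', Real.rpow_one]
        _ ≤ _ := by gcongr
    have e4 : (A n * c n ^ (-α)) ^ 2 ≤ ((M - M') / (2 * C)) ^ 2 := by
      rw [e2]
      calc κ ^ 2 * (Real.log (B n) / d n ^ (1 + 2 * α))
          ≤ ((M - M') / (2 * C) * √D) ^ 2 * (1 / D) := by
            refine mul_le_mul (by gcongr) ?_ (by positivity) (by positivity)
            rw [div_le_div_iff₀ (by positivity) hD0]
            linarith
        _ = _ := by
            rw [mul_pow, Real.sq_sqrt hD0.le]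
            field_simp
    have e5 : A n * c n ^ (-α) ≤ (M - M') / (2 * C) :=
      (pow_le_pow_iff_left₀ (by positivity) (by positivity) two_ne_zero).1 e4
    rw [le_div_iff₀ (by positivity)] at e5
    linarith
  · filter_upwards [hd0, eventually_gt_atTop 0, hA2, hL] with n hn hn0 hA2 hL
    have hn0' : (0 : ℝ) < n := by exact_mod_cast hn0
    have e0 : (n : ℝ) * ((n : ℝ) ^ (2 * α / (1 + 2 * α)))⁻¹ * (n : ℝ) ^ (-1 / (1 + 2 * α)) = 1 := by
      conv_lhs => rw [← Real.rpow_neg hn0'.le]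
      nth_rewrite 1 [← Real.rpow_one (n : ℝ)]
      rw [← Real.rpow_add hn0', ← Real.rpow_add hn0', div_one_add_two_mul hα, Real.rpow_zero]
    have e2 : (n : ℝ) * (4 * A n ^ 2 * c n) = 4 * κ ^ 2 * Real.log (B n) := by
      rw [hA2, hc]
      calc _ = 4 * κ ^ 2 * Real.log (B n) * ((n : ℝ) * ((n : ℝ) ^ (2 * α / (1 + 2 * α)))⁻¹ *
              (n : ℝ) ^ (-1 / (1 + 2 * α))) := by field_simp
        _ = _ := by rw [e0, mul_one]
    have e3 : 4 * κ ^ 2 ≤ 1 / 2 := by nlinarith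
    rw [e2]
    calc 4 * κ ^ 2 * Real.log (B n) ≤ 1 / 2 * Real.log (B n) := by gcongr
      _ = _ := by ring
  · filter_upwards [hd0, eventually_gt_atTop 0, hA2, hL] with n hn hn0 hA2 hL
    have hn0' : (0 : ℝ) < n := by exact_mod_cast hn0
    have : (n : ℝ) ^ (2 * α / (1 + 2 * α)) ≠ 0 := by positivity
    rw [hA2]
    apply le_of_eq
    field_simp
  · filter_upwards [hL] with n hn
    have := hd n
    positivity
  · filter_upwards [hL, eventually_lt_of_limsup_ofReal_eq_zero hlim one_pos] with n hn hn1
    rw [← div_eq_mul_inv] at hn1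
    exact mul_le_of_le_one_right (by positivity) hn1.le

lemma tendsto_atTop_of_liminf_div_log_pos {d B : ℕ → ℝ} (hB : Tendsto B atTop atTop)
    (h : 0 < liminf (fun n => ENNReal.ofReal (d n / Real.log (B n))) atTop) :
    Tendsto d atTop atTop := by
  obtain ⟨a, ha0, ha⟩ := exists_eventually_le_of_liminf_ofReal_pos h
  have hL : Tendsto (fun n => Real.log (B n)) atTop atTop := Real.tendsto_log_atTop.comp hB
  refine tendsto_atTop_mono' _ ?_ (hL.const_mul_atTop ha0)
  filter_upwards [ha, hL.eventually_gt_atTop 0] with n hn hn1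
  rwa [le_div_iff₀ hn1] at hn

/-- The minimax lower bound over long windows. -/
lemma lower_bound_long_window [IsProbabilityMeasure P] {W : ℝ≥0 → Ω → ℝ}
    (hWm : ∀ t, Measurable (W t)) (hW : IsPreBrownianReal W P)
    {α x₀ M : ℝ} (hα : 0 < α) (hM : 0 < M) {d c : ℕ → ℝ}
    (hc : ∀ n, c n = d n * (n : ℝ) ^ (-1 / (1 + 2 * α)))
    (hcI : ∀ᶠ n in atTop, Icc (x₀ - c n) (x₀ + c n) ⊆ Icc 0 1)
    (hd : Tendsto d atTop atTop)
    {fhat : ℕ → (unitInterval → ℝ) → ℝ → ℝ} (hfhat : IsEstimator fhat) :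
    0 < liminf (fun n : ℕ => ENNReal.ofReal ((n : ℝ) ^ (2 * α / (1 + 2 * α))) *
      maxRisk P W α M n (fhat n) x₀ (c n)) atTop := by
  obtain ⟨ψ, C, hC, hψ, hψ0, hψ1, hψe, hψs, hsupp, hhol⟩ := exists_bump hα
  have hp : 0 < 1 + 2 * α := by positivity
  -- The factor `(2 / 5) ^ α` compensates for bumps that may be as narrow as `2 / 5 * h`.
  set κ := M / (2 * C) * (2 / 5) ^ α with hκ
  have hκ0 : 0 < κ := by positivity
  set E := 8 + 16 * Real.exp (4 * κ ^ 2) with hE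
  have hE0 : 0 < E := by positivity
  refine liminf_pos_of_eventually_le (η := κ ^ 2 * (2 / 5) / E) (by positivity) ?_
  filter_upwards [hcI, hd.eventually_ge_atTop 1, eventually_gt_atTop 0] with n hcI hd hn0
  have hn0' : (0 : ℝ) < n := by exact_mod_cast hn0
  set h := (n : ℝ) ^ (-1 / (1 + 2 * α)) with hh
  have hh0 : 0 < h := by positivity
  -- With this many bumps each width is between `2 / 5 * h` and `h`, so a single flip carries
  -- bounded information.
  set m := ⌊d n⌋₊ with hm
  have hm1 : 1 ≤ m := Nat.le_floor (by simpa using hd)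
  have hm0 : (1 : ℝ) ≤ m := by exact_mod_cast hm1
  have hmd : (m : ℝ) ≤ d n := Nat.floor_le (by linarith)
  have hdm : d n ≤ 2 * m := by have := Nat.lt_floor_add_one (d n); linarith
  set w := 2 * c n / (5 * m) with hw
  have hwl : 2 / 5 * h ≤ w := by
    rw [hw, hc, le_div_iff₀ (by positivity)]
    have := mul_le_mul_of_nonneg_right hmd hh0.le
    linarith
  have hwu : w ≤ h := by
    rw [hw, hc, div_le_iff₀ (by positivity)]
    have := mul_le_mul_of_nonneg_right hdm hh0.le
    nlinarith
  have hw0 : 0 < w := lt_of_lt_of_le (by positivity) hwl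
  have hAw : 2 * (κ * h ^ α * w ^ (-α) * C) ≤ M := by
    have h1 : (2 / 5) ^ α * h ^ α ≤ w ^ α := by
      rw [← Real.mul_rpow (by norm_num) hh0.le]
      exact Real.rpow_le_rpow (by positivity) hwl hα.le
    rw [Real.rpow_neg hw0.le, hκ]
    have hwa : 0 < w ^ α := by positivity
    calc 2 * (M / (2 * C) * (2 / 5) ^ α * h ^ α * (w ^ α)⁻¹ * C)
        = M * (((2 / 5) ^ α * h ^ α) / w ^ α) := by field_simp
      _ ≤ M * 1 := by gcongr; rwa [div_le_one hwa]
      _ = M := mul_one M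
  have key := sq_le_maxRisk hWm hW hC hψ hψ0 hψ1 hψe hψs hsupp hhol hn0.ne' (hfhat n)
    (x₀ := x₀) (c := c n) (A := κ * h ^ α) (M := M)
    (by rw [hc]; have : 0 < d n := by linarith
        positivity) hcI (by positivity) (by omega : m ≠ 0) hw hAw
  have e1 : (h ^ α) ^ 2 * (n : ℝ) ^ (2 * α / (1 + 2 * α)) = 1 := by
    rw [← Real.rpow_natCast, ← Real.rpow_mul hh0.le, hh, ← Real.rpow_mul hn0'.le,
      ← Real.rpow_add hn0']
    rw [show -1 / (1 + 2 * α) * (α * (2 : ℕ)) + 2 * α / (1 + 2 * α) = 0 by push_cast; ring,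
      Real.rpow_zero]
  have e2 : (n : ℝ) * (4 * (κ * h ^ α) ^ 2 * w) ≤ 4 * κ ^ 2 := by
    have e0 : (n : ℝ) * ((h ^ α) ^ 2 * h) = 1 := by
      have : (h ^ α) ^ 2 = (n : ℝ) ^ (-(2 * α / (1 + 2 * α))) := by
        rw [Real.rpow_neg hn0'.le]; exact eq_inv_of_mul_eq_one_left e1
      rw [this, hh, ← mul_assoc]
      nth_rewrite 1 [← Real.rpow_one (n : ℝ)]
      rw [← Real.rpow_add hn0', ← Real.rpow_add hn0', div_one_add_two_mul hα, Real.rpow_zero]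
    calc (n : ℝ) * (4 * (κ * h ^ α) ^ 2 * w) ≤ (n : ℝ) * (4 * (κ * h ^ α) ^ 2 * h) := by gcongr
      _ = 4 * κ ^ 2 * ((n : ℝ) * ((h ^ α) ^ 2 * h)) := by ring
      _ = 4 * κ ^ 2 := by rw [e0, mul_one]
  set R := maxRisk P W α M n (fhat n) x₀ (c n)
  have h3 : ENNReal.ofReal (κ ^ 2 * (2 / 5)) ≤
      ENNReal.ofReal E * (ENNReal.ofReal ((n : ℝ) ^ (2 * α / (1 + 2 * α))) * R) := by
    calc ENNReal.ofReal (κ ^ 2 * (2 / 5))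
        = ENNReal.ofReal ((n : ℝ) ^ (2 * α / (1 + 2 * α))) *
          ENNReal.ofReal ((κ * h ^ α) ^ 2 * (2 / 5)) := by
          rw [← ENNReal.ofReal_mul (by positivity)]
          congr 1
          calc κ ^ 2 * (2 / 5) =
              κ ^ 2 * (2 / 5) * ((h ^ α) ^ 2 * (n : ℝ) ^ (2 * α / (1 + 2 * α))) := by
                rw [e1, mul_one]
            _ = _ := by ring
      _ ≤ ENNReal.ofReal ((n : ℝ) ^ (2 * α / (1 + 2 * α))) * (ENNReal.ofReal E * R) := by
          gcongr
          refine key.trans ?_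
          gcongr
          rw [hE, ENNReal.ofReal_add (by norm_num) (by positivity), ENNReal.ofReal_mul (by norm_num),
            ENNReal.ofReal_ofNat, ENNReal.ofReal_ofNat]
          gcongr
      _ = _ := by ring
  rw [ENNReal.ofReal_div_of_pos hE0]
  exact ENNReal.div_le_of_le_mul' h3

end Regimes

/-! ### Local polynomial reconstruction from increments -/

section LocalPolynomial

open Polynomial in
/-- Weights recovering the derivative of a polynomial of degree at most `r` from its increments
over the intervals `[i / r, (i + 1) / r]`. -/
lemma exists_increment_weights {r : ℕ} (hr : r ≠ 0) : ∃ ω : ℕ → ℝ[X], ∀ Q : ℝ[X],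
    Q.natDegree ≤ r → ∀ u, Q.derivative.eval u = ∑ i ∈ Finset.range r,
      (ω i).eval u * (Q.eval (((i : ℝ) + 1) / r) - Q.eval ((i : ℝ) / r)) := by
  classical
  set v : ℕ → ℝ := fun i => (i : ℝ) / r with hv
  have hr0 : (r : ℝ) ≠ 0 := by exact_mod_cast hr
  have hinj : Set.InjOn v (Finset.range (r + 1)) := by
    intro i _ j _ hij
    simp only [hv] at hij
    exact_mod_cast (div_left_inj' hr0).1 hij
  set L : ℕ → ℝ[X] := fun j => (Lagrange.basis (Finset.range (r + 1)) v j).derivative with hL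
  refine ⟨fun i => ∑ j ∈ Finset.Ioc i r, L j, fun Q hQ u => ?_⟩
  -- With value zero at the node `0`, each node value is a telescoping sum of increments. Lagrange
  -- interpolation at the `r + 1` nodes is exact, and exchanging the sums gives the weights.
  set q : ℝ[X] := Q - C (Q.eval 0) with hq
  have hqd : q.degree < (Finset.range (r + 1)).card := by
    rw [Finset.card_range]
    refine lt_of_le_of_lt (degree_le_natDegree) ?_
    have : q.natDegree ≤ r := (natDegree_sub_C (p := Q)).trans_le hQ
    exact_mod_cast Nat.lt_succ_of_le this
  have h1 := Lagrange.eq_interpolate hinj hqd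
  have h2 : Q.derivative = q.derivative := by simp [hq]
  rw [h2, h1, Lagrange.interpolate_apply, derivative_sum, eval_finsetSum]
  have h3 : ∀ j, q.eval (v j) =
      ∑ i ∈ Finset.range j, (Q.eval (((i : ℝ) + 1) / r) - Q.eval ((i : ℝ) / r)) := by
    intro j
    have := Finset.sum_range_sub (fun i : ℕ => Q.eval ((i : ℝ) / r)) j
    push_cast at this
    rw [this]
    simp [hq, hv]
  simp_rw [derivative_mul, derivative_C, zero_mul, zero_add, eval_mul, eval_C, h3, eval_finsetSum,
    Finset.sum_mul]
  rw [Finset.sum_comm' (t' := Finset.range r) (s' := fun i => Finset.Ioc i r)]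
  · exact Finset.sum_congr rfl fun i _ => Finset.sum_congr rfl fun j _ => mul_comm _ _
  · intro j i
    simp only [Finset.mem_range, Finset.mem_Ioc]
    omega

open Polynomial in
lemma exists_weight_bound (r : ℕ) (ω : ℕ → ℝ[X]) : ∃ K : ℝ, 1 ≤ K ∧
    ∀ i < r, ∀ u ∈ Icc (0 : ℝ) 1, |(ω i).eval u| ≤ K := by
  have h : ∀ i, ∃ K, ∀ u ∈ Icc (0 : ℝ) 1, |(ω i).eval u| ≤ K := fun i =>
    isCompact_Icc.exists_bound_of_continuousOn (ω i).continuous.continuousOn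
  choose K hK using h
  refine ⟨1 + ∑ i ∈ Finset.range r, |K i|, ?_, fun i hi u hu => ?_⟩
  · have : 0 ≤ ∑ i ∈ Finset.range r, |K i| := Finset.sum_nonneg fun i _ => abs_nonneg _
    linarith
  · have h1 : |K i| ≤ ∑ i ∈ Finset.range r, |K i| :=
      Finset.single_le_sum (f := fun i => |K i|) (fun i _ => abs_nonneg _) (Finset.mem_range.2 hi)
    have := (hK i u hu).trans (le_abs_self _)
    linarith

open Polynomial in
/-- The bias of the local polynomial reconstruction of a function of a Hölder class. -/
lemma abs_local_bias_le {α M : ℝ} (hα : 0 < α) (hM : 0 ≤ M) {r : ℕ} (hr : r = ⌈α⌉₊ - 1 + 1)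
    {ω : ℕ → ℝ[X]} (hω : ∀ Q : ℝ[X], Q.natDegree ≤ r → ∀ u, Q.derivative.eval u =
      ∑ i ∈ Finset.range r, (ω i).eval u * (Q.eval (((i : ℝ) + 1) / r) - Q.eval ((i : ℝ) / r)))
    {K : ℝ} (hK : ∀ i < r, ∀ u ∈ Icc (0 : ℝ) 1, |(ω i).eval u| ≤ K)
    {f : ℝ → ℝ} (hf : f ∈ holderClass α M) {a δ x : ℝ} (ha : 0 ≤ a) (hδ : 0 < δ) (haδ : a + δ ≤ 1)
    (hx : x ∈ Icc a (a + δ)) :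
    |∑ i ∈ Finset.range r, (ω i).eval ((x - a) / δ) / δ *
      (∫ y in (a + i * (δ / r))..(a + (i + 1) * (δ / r)), f y) - f x| ≤ (K + 1) * M * δ ^ α := by
  have hr0 : (0 : ℝ) < r := by rw [hr]; positivity
  set k := ⌈α⌉₊ - 1 with hk
  set T : ℝ → ℝ := fun y => taylorWithinEval f k (Icc 0 1) a y with hT
  set b : ℕ → ℝ := fun l => (l.factorial : ℝ)⁻¹ * iteratedDerivWithin l f (Icc 0 1) a with hb
  -- An antiderivative of the Taylor polynomial in the variable `(y - a) / δ`. Its degree is at most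
  -- `k + 1 = r`, so the weights reproduce the Taylor polynomial exactly from its integrals.
  set Q : ℝ[X] := ∑ l ∈ Finset.range (k + 1), C (b l * δ ^ (l + 1) / (l + 1)) * X ^ (l + 1) with hQ
  have hTb : ∀ y, T y = ∑ l ∈ Finset.range (k + 1), b l * (y - a) ^ l := by
    intro y
    simp only [hT, taylor_within_apply, hb, smul_eq_mul]
    exact Finset.sum_congr rfl fun l _ => by ring
  have hQd : Q.natDegree ≤ r := by
    rw [hr]
    refine natDegree_sum_le_of_forall_le _ _ fun l hl => ?_
    refine (natDegree_C_mul_X_pow_le _ _).trans ?_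
    have := Finset.mem_range.1 hl
    omega
  have hQ' : ∀ y, Q.derivative.eval ((y - a) / δ) / δ = T y := by
    intro y
    rw [hTb, hQ, derivative_sum, eval_finsetSum, Finset.sum_div]
    refine Finset.sum_congr rfl fun l _ => ?_
    rw [derivative_C_mul_X_pow]
    simp only [eval_mul, eval_C, eval_pow, eval_X, Nat.add_sub_cancel]
    push_cast
    rw [div_pow, pow_succ]
    field_simp
  have hTint : ∀ p q, ∫ y in p..q, T y = Q.eval ((q - a) / δ) - Q.eval ((p - a) / δ) := by
    intro p q
    refine intervalIntegral.integral_eq_sub_of_hasDerivAt (f := fun y => Q.eval ((y - a) / δ))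
      (fun y _ => ?_) ?_
    · have h1 : HasDerivAt (fun y : ℝ => (y - a) / δ) (1 / δ) y :=
        ((hasDerivAt_id y).sub_const a).div_const δ
      have := (Q.hasDerivAt ((y - a) / δ)).comp y h1
      rwa [mul_one_div, hQ'] at this
    · refine Continuous.intervalIntegrable ?_ _ _
      have : T = fun y => ∑ l ∈ Finset.range (k + 1), b l * (y - a) ^ l := funext hTb
      rw [this]
      fun_prop
  have hTx : T x = ∑ i ∈ Finset.range r, (ω i).eval ((x - a) / δ) / δ *
      ∫ y in (a + i * (δ / r))..(a + (i + 1) * (δ / r)), T y := by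
    rw [← hQ' x, hω Q hQd, Finset.sum_div]
    refine Finset.sum_congr rfl fun i _ => ?_
    rw [hTint]
    have e1 : (a + (i + 1) * (δ / r) - a) / δ = ((i : ℝ) + 1) / r := by field_simp; ring
    have e2 : (a + i * (δ / r) - a) / δ = (i : ℝ) / r := by field_simp; ring
    rw [e1, e2]
    ring
  have hrem : ∀ y ∈ Icc a (a + δ), |f y - T y| ≤ M * δ ^ α := by
    intro y hy
    refine (abs_sub_taylor_le hα hM hf ha hy.1 (hy.2.trans haδ)).trans ?_
    have := sub_nonneg.2 hy.1
    gcongr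
    linarith [hy.2]
  have hu : (x - a) / δ ∈ Icc (0 : ℝ) 1 :=
    ⟨div_nonneg (sub_nonneg.2 hx.1) hδ.le, (div_le_one hδ).2 (by linarith [hx.2])⟩
  have hcf := continuousOn_of_mem_holderClass hf
  have hcT : Continuous T := by
    have : T = fun y => ∑ l ∈ Finset.range (k + 1), b l * (y - a) ^ l := funext hTb
    rw [this]
    fun_prop
  -- Weight at most `K / δ` times a remainder integral of at most `M * δ ^ α * (δ / r)`. The `r`
  -- pieces add up to `K * M * δ ^ α`, and the remainder at `x` itself turns `K` into `K + 1`.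
  have hterm : ∀ i ∈ Finset.range r, |(ω i).eval ((x - a) / δ) / δ *
      (∫ y in (a + i * (δ / r))..(a + (i + 1) * (δ / r)), f y) -
      (ω i).eval ((x - a) / δ) / δ * ∫ y in (a + i * (δ / r))..(a + (i + 1) * (δ / r)), T y| ≤
        K * M * δ ^ α / r := by
    intro i hi
    have hir : ((i : ℝ) + 1) ≤ r := by exact_mod_cast Finset.mem_range.1 hi
    have hi0 : (0 : ℝ) ≤ i := Nat.cast_nonneg i
    have h0 : 0 < δ / r := by positivity
    have hp : a ≤ a + i * (δ / r) := by have := mul_nonneg hi0 h0.le; linarith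
    have hpq : a + i * (δ / r) ≤ a + (i + 1) * (δ / r) := by nlinarith
    have hq : a + (i + 1) * (δ / r) ≤ a + δ := by
      have : (i + 1) * (δ / r) ≤ r * (δ / r) := by gcongr
      rw [mul_div_cancel₀ _ hr0.ne'] at this
      linarith
    have hfi : IntervalIntegrable f volume (a + i * (δ / r)) (a + (i + 1) * (δ / r)) := by
      refine (hcf.mono ?_).intervalIntegrable
      rw [uIcc_of_le hpq]
      exact Icc_subset_Icc (ha.trans hp) (hq.trans haδ)
    rw [← mul_sub, ← intervalIntegral.integral_sub hfi (hcT.intervalIntegrable _ _), abs_mul, abs_div,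
      abs_of_pos hδ]
    have h1 : |∫ y in (a + i * (δ / r))..(a + (i + 1) * (δ / r)), (f y - T y)| ≤
        M * δ ^ α * (δ / r) := by
      have := intervalIntegral.norm_integral_le_of_norm_le_const (f := fun y => f y - T y)
        (C := M * δ ^ α) (a := a + i * (δ / r)) (b := a + (i + 1) * (δ / r)) (fun y hy => by
          rw [uIoc_of_le hpq] at hy
          exact hrem y ⟨hp.trans hy.1.le, hy.2.trans hq⟩)
      rw [Real.norm_eq_abs, show a + (i + 1) * (δ / r) - (a + i * (δ / r)) = δ / r by ring,
        abs_of_pos h0] at this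
      exact this
    have hKi := hK i (Finset.mem_range.1 hi) _ hu
    calc _ ≤ K / δ * (M * δ ^ α * (δ / r)) := by
          have : 0 ≤ K := (abs_nonneg _).trans hKi
          gcongr
      _ = _ := by field_simp
  have hsum : |∑ i ∈ Finset.range r, (ω i).eval ((x - a) / δ) / δ *
      (∫ y in (a + i * (δ / r))..(a + (i + 1) * (δ / r)), f y) - T x| ≤ K * M * δ ^ α := by
    rw [hTx, ← Finset.sum_sub_distrib]
    refine (Finset.abs_sum_le_sum_abs _ _).trans ((Finset.sum_le_sum hterm).trans ?_)
    rw [Finset.sum_const, Finset.card_range, nsmul_eq_mul, mul_div_cancel₀ _ hr0.ne']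
  have hxr := hrem x hx
  rw [abs_sub_comm] at hxr
  calc _ ≤ _ := abs_sub_le _ (T x) _
    _ ≤ K * M * δ ^ α + M * δ ^ α := add_le_add hsum hxr
    _ = _ := by ring

end LocalPolynomial

/-! ### Moments and tails of sums of squared Brownian increments -/

section ChiSquare

variable {Ω : Type*} [MeasurableSpace Ω] {P : Measure Ω}

/-- The exponent is half the critical one, so the integrand is a Gaussian of doubled variance and
the normalisations differ by `√2`. -/
lemma lintegral_exp_sq_gaussianReal {v : ℝ≥0} (hv : v ≠ 0) :
    ∫⁻ x, ENNReal.ofReal (Real.exp (x ^ 2 / (4 * v))) ∂(gaussianReal 0 v) =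
      ENNReal.ofReal √2 := by
  have hv0 : (0 : ℝ) < v := by exact_mod_cast pos_iff_ne_zero.2 hv
  rw [gaussianReal_of_var_ne_zero 0 hv, lintegral_withDensity_eq_lintegral_mul _
    (measurable_gaussianPDF _ _) (by fun_prop)]
  have e : ∀ x : ℝ, (gaussianPDF 0 v * fun x => ENNReal.ofReal (Real.exp (x ^ 2 / (4 * v)))) x =
      ENNReal.ofReal ((√(2 * Real.pi * v))⁻¹ * Real.exp (-(1 / (4 * v)) * x ^ 2)) := by
    intro x
    rw [Pi.mul_apply, gaussianPDF, gaussianPDFReal, ← ENNReal.ofReal_mul (by positivity), mul_assoc,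
      ← Real.exp_add]
    congr 3
    field_simp
    ring
  simp_rw [e]
  have hb : 0 < 1 / (4 * (v : ℝ)) := by positivity
  rw [← ofReal_integral_eq_lintegral_ofReal ((integrable_exp_neg_mul_sq hb).const_mul _)
    (ae_of_all _ fun x => by positivity), integral_const_mul, integral_gaussian]
  congr 1
  rw [inv_mul_eq_div, ← Real.sqrt_div (by positivity)]
  congr 1
  have := Real.pi_pos
  field_simp
  norm_num

variable {W : ℝ≥0 → Ω → ℝ}

lemma lintegral_exp_sq_increment (hWm : ∀ t, Measurable (W t)) (hW : IsPreBrownianReal W P)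
    {s t v : ℝ≥0} (hst : t = s + v) (hv : v ≠ 0) :
    ∫⁻ ω, ENNReal.ofReal (Real.exp ((W t ω - W s ω) ^ 2 / (4 * v))) ∂P = ENNReal.ofReal √2 := by
  have h := (hW.hasLaw_sub t s).map_eq
  have hnn : nndist t.1 s.1 = v := by
    apply NNReal.eq
    rw [coe_nndist, Real.dist_eq, hst]
    change |((s : ℝ) + v) - s| = v
    rw [add_sub_cancel_left, abs_of_nonneg v.coe_nonneg]
  rw [hnn] at h
  rw [← lintegral_exp_sq_gaussianReal hv, ← h, lintegral_map (by fun_prop) ((hWm t).sub (hWm s))]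
  rfl

/-- A crude constant suffices, so the exponential moment is reused through `y ≤ exp y`. -/
lemma lintegral_sq_increment_le (hWm : ∀ t, Measurable (W t)) (hW : IsPreBrownianReal W P)
    {s t v : ℝ≥0} (hst : t = s + v) (hv : v ≠ 0) :
    ∫⁻ ω, ENNReal.ofReal ((W t ω - W s ω) ^ 2) ∂P ≤ ENNReal.ofReal (8 * v) := by
  have hv0 : (0 : ℝ) < v := by exact_mod_cast pos_iff_ne_zero.2 hv
  calc ∫⁻ ω, ENNReal.ofReal ((W t ω - W s ω) ^ 2) ∂P
      ≤ ∫⁻ ω, ENNReal.ofReal (4 * v) *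
        ENNReal.ofReal (Real.exp ((W t ω - W s ω) ^ 2 / (4 * v))) ∂P := by
        refine lintegral_mono fun ω => ?_
        rw [← ENNReal.ofReal_mul (by positivity)]
        refine ENNReal.ofReal_le_ofReal ?_
        have := Real.add_one_le_exp ((W t ω - W s ω) ^ 2 / (4 * v))
        calc (W t ω - W s ω) ^ 2 = 4 * v * ((W t ω - W s ω) ^ 2 / (4 * v)) := by field_simp
          _ ≤ _ := by gcongr; linarith
    _ = ENNReal.ofReal (4 * v * √2) := by
        rw [lintegral_const_mul' _ _ ENNReal.ofReal_ne_top, lintegral_exp_sq_increment hWm hW hst hv,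
          ENNReal.ofReal_mul (p := 4 * v) (by positivity)]
    _ ≤ _ := by
        refine ENNReal.ofReal_le_ofReal ?_
        have : √2 ≤ 2 := by
          rw [Real.sqrt_le_left (by norm_num)]; norm_num
        nlinarith

/-- The tail expectation of a scaled chi-square variable built from Brownian increments. -/
lemma lintegral_sum_sq_tail_le (hWm : ∀ t, Measurable (W t)) (hW : IsPreBrownianReal W P)
    {t : ℕ → ℝ≥0} (ht : Monotone t) {N : ℕ} {v : ℝ≥0} (hv : v ≠ 0)
    (htv : ∀ i < N, t (i + 1) = t i + v) (Λ : ℝ) :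
    ∫⁻ ω, (if Λ < ∑ i ∈ Finset.range N, (W (t (i + 1)) ω - W (t i) ω) ^ 2 / (4 * v)
      then ENNReal.ofReal (∑ i ∈ Finset.range N, (W (t (i + 1)) ω - W (t i) ω) ^ 2 / (4 * v))
      else 0) ∂P ≤ ENNReal.ofReal (2 * Real.exp (N - Λ / 2)) := by
  have hind := hW.hasIndepIncrements.nat ht
  have hg : Measurable fun x : ℝ => ENNReal.ofReal (Real.exp (x ^ 2 / (4 * v))) := by fun_prop
  have hind2 := hind.comp (fun _ x => ENNReal.ofReal (Real.exp (x ^ 2 / (4 * v)))) fun _ => hg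
  have hprod := lintegral_prod_eq_prod_lintegral_of_indepFun (Finset.range N) _ hind2
    fun i => hg.comp ((hWm _).sub (hWm _))
  have hprod2 : ∏ i ∈ Finset.range N, ∫⁻ ω, ((fun x : ℝ => ENNReal.ofReal (Real.exp (x ^ 2 / (4 * v)))) ∘
      fun ω => W (t (i + 1)) ω - W (t i) ω) ω ∂P = ENNReal.ofReal √2 ^ N :=
    (Finset.prod_congr rfl fun i hi => lintegral_exp_sq_increment hWm hW
      (htv i (Finset.mem_range.1 hi)) hv).trans (by rw [Finset.prod_const, Finset.card_range])
  rw [hprod2] at hprod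
  calc _ ≤ ∫⁻ ω, ENNReal.ofReal (2 * Real.exp (-Λ / 2)) * ∏ i ∈ Finset.range N,
        ((fun x : ℝ => ENNReal.ofReal (Real.exp (x ^ 2 / (4 * v)))) ∘
          fun ω => W (t (i + 1)) ω - W (t i) ω) ω ∂P := by
        refine lintegral_mono fun ω => ?_
        set X := ∑ i ∈ Finset.range N, (W (t (i + 1)) ω - W (t i) ω) ^ 2 / (4 * v) with hX
        have e : ∏ i ∈ Finset.range N, ((fun x : ℝ => ENNReal.ofReal (Real.exp (x ^ 2 / (4 * v)))) ∘
          fun ω => W (t (i + 1)) ω - W (t i) ω) ω = ENNReal.ofReal (Real.exp X) := by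
          rw [hX, Real.exp_sum, ENNReal.ofReal_prod_of_nonneg fun i _ => (Real.exp_pos _).le]
          rfl
        rw [e]
        split_ifs with h
        · rw [← ENNReal.ofReal_mul (by positivity)]
          refine ENNReal.ofReal_le_ofReal ?_
          -- The sum itself, not only the event, must be controlled, because the loss after crossing
          -- the threshold is proportional to it: `X ≤ 2 * exp (X / 2)`, and `X / 2 ≤ X - Λ / 2`
          -- when `X > Λ`.
          have h1 := Real.add_one_le_exp (X / 2)
          have h2 : Real.exp (X / 2) ≤ Real.exp (X - Λ / 2) := Real.exp_le_exp.2 (by linarith)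
          rw [mul_assoc, ← Real.exp_add, show -Λ / 2 + X = X - Λ / 2 by ring]
          linarith
        · exact zero_le
    _ = ENNReal.ofReal (2 * Real.exp (-Λ / 2)) * ENNReal.ofReal √2 ^ N := by
        rw [lintegral_const_mul' _ _ ENNReal.ofReal_ne_top, hprod]
    _ ≤ _ := by
        rw [← ENNReal.ofReal_pow (by positivity), ← ENNReal.ofReal_mul (by positivity)]
        refine ENNReal.ofReal_le_ofReal ?_
        have h1 : √2 ≤ Real.exp 1 := by
          have : √2 ≤ 2 := by rw [Real.sqrt_le_left (by norm_num)]; norm_num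
          have := Real.add_one_le_exp 1
          linarith
        calc 2 * Real.exp (-Λ / 2) * √2 ^ N ≤ 2 * Real.exp (-Λ / 2) * Real.exp 1 ^ N := by gcongr
          _ = _ := by
            rw [← Real.exp_nat_mul, mul_assoc, ← Real.exp_add]
            congr 2; ring

end ChiSquare

/-! ### The threshold estimator -/

section Estimator

open Polynomial

/-- The grid point `a + i τ` of the unit interval. -/
noncomputable def gridPoint (a τ : ℝ) (i : ℕ) : unitInterval :=
  projIcc 0 1 zero_le_one (a + i * τ)

/-- The increment of the path over a grid interval, centred at its mean under `f₀`. -/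
noncomputable def centredIncrement (f₀ : ℝ → ℝ) (a τ : ℝ) (z : unitInterval → ℝ) (i : ℕ) : ℝ :=
  z (gridPoint a τ (i + 1)) - z (gridPoint a τ i) -
    ∫ y in (a + i * τ)..(a + (i + 1) * τ), f₀ y

/-- The `j`-th cell of length `δ` of a window that starts at `a`. -/
def cell (a δ : ℝ) (j : ℕ) : Set ℝ := Ico (a + j * δ) (a + (j + 1) * δ)

lemma measurableSet_cell (a δ : ℝ) (j : ℕ) : MeasurableSet (cell a δ j) := measurableSet_Ico

/-- The polynomial fitted on the `j`-th cell to increments `Y`. -/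
noncomputable def localEstimate (ω : ℕ → ℝ[X]) (r : ℕ) (a δ : ℝ) (Y : ℕ → ℝ) (j : ℕ) (x : ℝ) : ℝ :=
  ∑ i ∈ Finset.range r, (ω i).eval ((x - (a + j * δ)) / δ) / δ * Y (j * r + i)

/-- The piecewise polynomial fitted to increments `Y`. -/
noncomputable def cellEstimate (ω : ℕ → ℝ[X]) (r m : ℕ) (a δ : ℝ) (Y : ℕ → ℝ) (x : ℝ) : ℝ :=
  ∑ j ∈ Finset.range m, (cell a δ j).indicator (localEstimate ω r a δ Y j) x

open Classical in
/-- The estimator that departs from `f₀` only when the sum of squared centred increments exceeds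
`l`. -/
noncomputable def thresholdEstimator (f₀ : ℝ → ℝ) (ω : ℕ → ℝ[X]) (r m : ℕ) (a δ l : ℝ)
    (z : unitInterval → ℝ) (x : ℝ) : ℝ :=
  (Icc 0 1).indicator f₀ x +
    if l < ∑ i ∈ Finset.range (m * r), centredIncrement f₀ a (δ / r) z i ^ 2
    then cellEstimate ω r m a δ (centredIncrement f₀ a (δ / r) z) x else 0

lemma measurable_thresholdEstimator {f₀ : ℝ → ℝ} (hf₀ : ContinuousOn f₀ (Icc 0 1))
    (ω : ℕ → ℝ[X]) (r m : ℕ) (a δ l : ℝ) :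
    Measurable (Function.uncurry (thresholdEstimator f₀ ω r m a δ l)) := by
  have hY : ∀ i, Measurable fun z => centredIncrement f₀ a (δ / r) z i := by
    intro i
    unfold centredIncrement
    fun_prop
  -- Off `[0, 1]` the function `f₀` is arbitrary; the indicator in the estimator secures
  -- measurability.
  have hf : Measurable ((Icc (0 : ℝ) 1).indicator f₀) := by
    classical
    rw [← piecewise_eq_indicator]
    exact hf₀.measurable_piecewise continuousOn_const measurableSet_Icc
  have hloc : ∀ j, Measurable fun p : (unitInterval → ℝ) × ℝ =>
      localEstimate ω r a δ (centredIncrement f₀ a (δ / r) p.1) j p.2 := by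
    intro j
    unfold localEstimate
    refine Finset.measurable_fun_sum _ fun i _ => ?_
    have h1 : Measurable fun p : (unitInterval → ℝ) × ℝ =>
        (ω i).eval ((p.2 - (a + j * δ)) / δ) := by
      exact (ω i).continuous.measurable.comp (by fun_prop)
    exact (h1.div_const _).mul ((hY _).comp measurable_fst)
  have hcell : Measurable fun p : (unitInterval → ℝ) × ℝ =>
      cellEstimate ω r m a δ (centredIncrement f₀ a (δ / r) p.1) p.2 := by
    unfold cellEstimate
    refine Finset.measurable_fun_sum _ fun j _ => ?_
    have := (hloc j).indicator (measurable_snd (measurableSet_cell a δ j))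
    convert! this using 1
  refine (hf.comp measurable_snd).add (Measurable.ite ?_ hcell measurable_const)
  refine measurableSet_lt measurable_const ?_
  exact Finset.measurable_fun_sum _ fun i _ => ((hY i).comp measurable_fst).pow_const 2

lemma cellEstimate_of_mem {ω : ℕ → ℝ[X]} {r m : ℕ} {a δ : ℝ} (hδ : 0 < δ) {Y : ℕ → ℝ} {j : ℕ}
    (hj : j < m) {x : ℝ} (hx : x ∈ cell a δ j) :
    cellEstimate ω r m a δ Y x = localEstimate ω r a δ Y j x := by
  unfold cellEstimate
  rw [Finset.sum_eq_single_of_mem j (Finset.mem_range.2 hj), indicator_of_mem hx]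
  intro i _ hij
  refine indicator_of_notMem (fun hi => hij ?_) _
  have h1 : (i : ℝ) * δ < (j + 1) * δ := by linarith [hi.1, hx.2]
  have h2 : (j : ℝ) * δ < (i + 1) * δ := by linarith [hi.2, hx.1]
  have h3 : (i : ℝ) < j + 1 := lt_of_mul_lt_mul_right h1 hδ.le
  have h4 : (j : ℝ) < i + 1 := lt_of_mul_lt_mul_right h2 hδ.le
  have h5 : i < j + 1 := by exact_mod_cast h3
  have h6 : j < i + 1 := by exact_mod_cast h4
  omega

lemma sum_range_mul (g : ℕ → ℝ) (r m : ℕ) :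
    ∑ j ∈ Finset.range m, ∑ i ∈ Finset.range r, g (j * r + i) =
      ∑ l ∈ Finset.range (m * r), g l := by
  induction m with
  | zero => simp
  | succ m ih => rw [Finset.sum_range_succ, ih, Nat.succ_mul, Finset.sum_range_add]

lemma cell_fraction_mem {a δ x : ℝ} (hδ : 0 < δ) {j : ℕ} (hx : x ∈ cell a δ j) :
    (x - (a + j * δ)) / δ ∈ Icc (0 : ℝ) 1 :=
  ⟨div_nonneg (sub_nonneg.2 hx.1) hδ.le, (div_le_one hδ).2 (by linarith [hx.2])⟩

/-- Cauchy-Schwarz over the `r` increments of a cell, with weights at most `K / δ`. Applied to the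
noise it bounds the variance term; applied to the data it bounds the fit when the threshold is not
crossed. -/
lemma localEstimate_sq_le {ω : ℕ → ℝ[X]} {r : ℕ} {K : ℝ}
    (hK : ∀ i < r, ∀ u ∈ Icc (0 : ℝ) 1, |(ω i).eval u| ≤ K) {a δ : ℝ} (hδ : 0 < δ) (Y : ℕ → ℝ)
    {j : ℕ} {x : ℝ} (hx : x ∈ cell a δ j) :
    localEstimate ω r a δ Y j x ^ 2 ≤
      K ^ 2 * r / δ ^ 2 * ∑ i ∈ Finset.range r, Y (j * r + i) ^ 2 := by
  unfold localEstimate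
  refine sq_sum_le_card_mul_sum_sq.trans ?_
  rw [Finset.card_range, mul_div_right_comm, mul_assoc, mul_comm (K ^ 2 / δ ^ 2), mul_assoc,
    Finset.sum_mul]
  gcongr with i hi
  have h := hK i (Finset.mem_range.1 hi) _ (cell_fraction_mem hδ hx)
  have h2 := pow_le_pow_left₀ (abs_nonneg _) h 2
  rw [sq_abs] at h2
  rw [mul_pow, div_pow, mul_comm]
  gcongr

/-- The fit is linear in the increments, so its error is the bias of the reconstruction plus the fit
to the noise. -/
lemma localEstimate_sub_sq_le {α M : ℝ} (hα : 0 < α) (hM : 0 ≤ M) {r : ℕ} (hr : r = ⌈α⌉₊ - 1 + 1)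
    {ω : ℕ → ℝ[X]} (hω : ∀ Q : ℝ[X], Q.natDegree ≤ r → ∀ u, Q.derivative.eval u =
      ∑ i ∈ Finset.range r, (ω i).eval u * (Q.eval (((i : ℝ) + 1) / r) - Q.eval ((i : ℝ) / r)))
    {K : ℝ} (hK : ∀ i < r, ∀ u ∈ Icc (0 : ℝ) 1, |(ω i).eval u| ≤ K)
    {θ : ℝ → ℝ} (hθ : θ ∈ holderClass α M) {a δ : ℝ} (ha : 0 ≤ a) (hδ : 0 < δ) {m : ℕ}
    (haδ : a + m * δ ≤ 1) {Y ζ : ℕ → ℝ}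
    (hY : ∀ i < m * r, Y i = (∫ y in (a + i * (δ / r))..(a + (i + 1) * (δ / r)), θ y) + ζ i)
    {j : ℕ} (hj : j < m) {x : ℝ} (hx : x ∈ cell a δ j) :
    (localEstimate ω r a δ Y j x - θ x) ^ 2 ≤ 2 * ((K + 1) * M * δ ^ α) ^ 2 +
      2 * (K ^ 2 * r / δ ^ 2 * ∑ i ∈ Finset.range r, ζ (j * r + i) ^ 2) := by
  have hr0 : (0 : ℝ) < r := by rw [hr]; positivity
  have hj1 : (j : ℝ) + 1 ≤ m := by exact_mod_cast hj
  have hj0 : (0 : ℝ) ≤ j := Nat.cast_nonneg j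
  have hbias := abs_local_bias_le hα hM hr hω hK hθ (a := a + j * δ) (δ := δ) (x := x)
    (by positivity) hδ (by nlinarith) ⟨hx.1, by linarith [hx.2]⟩
  set b := ∑ i ∈ Finset.range r, (ω i).eval ((x - (a + j * δ)) / δ) / δ *
      (∫ y in (a + j * δ + i * (δ / r))..(a + j * δ + (i + 1) * (δ / r)), θ y) - θ x with hb
  have e : localEstimate ω r a δ Y j x - θ x = b + localEstimate ω r a δ ζ j x := by
    rw [hb, sub_add_eq_add_sub]
    congr 1
    unfold localEstimate
    rw [← Finset.sum_add_distrib]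
    refine Finset.sum_congr rfl fun i hi => ?_
    have hi' := Finset.mem_range.1 hi
    rw [hY _ (by
      calc j * r + i < j * r + r := by omega
        _ = (j + 1) * r := by ring
        _ ≤ m * r := Nat.mul_le_mul_right r hj), ← mul_add]
    have e1 : a + ((j * r + i : ℕ) : ℝ) * (δ / r) = a + j * δ + i * (δ / r) := by
      push_cast; field_simp; ring
    have e2 : a + (((j * r + i : ℕ) : ℝ) + 1) * (δ / r) = a + j * δ + (i + 1) * (δ / r) := by
      push_cast; field_simp; ring
    rw [e1, e2]
  have h1 : b ^ 2 ≤ ((K + 1) * M * δ ^ α) ^ 2 := by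
    rw [← sq_abs b]
    exact pow_le_pow_left₀ (abs_nonneg _) hbias 2
  have h2 := localEstimate_sq_le hK hδ ζ hx
  rw [e]
  nlinarith [sq_nonneg (b - localEstimate ω r a δ ζ j x)]

/-- Each cell has mass at most `1 / m`, so bounds that vary with the cell are averaged. -/
lemma lintegral_le_of_cells {μ : Measure ℝ} (hμ1 : μ univ ≤ 1) {a δ : ℝ} {m : ℕ}
    (hμ : ∀ j < m, μ (cell a δ j) ≤ ENNReal.ofReal (1 / m))
    (hμc : ∀ᵐ x ∂μ, ∃ j < m, x ∈ cell a δ j) {q : ℝ → ℝ} {A : ℝ} {b : ℕ → ℝ} (hA : 0 ≤ A)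
    (hb : ∀ j, 0 ≤ b j) (h : ∀ j < m, ∀ x ∈ cell a δ j, q x ≤ A + b j) :
    ∫⁻ x, ENNReal.ofReal (q x) ∂μ ≤ ENNReal.ofReal (A + (∑ j ∈ Finset.range m, b j) / m) := by
  calc ∫⁻ x, ENNReal.ofReal (q x) ∂μ
      ≤ ∫⁻ x, (ENNReal.ofReal A + ∑ j ∈ Finset.range m,
          (cell a δ j).indicator (fun _ => ENNReal.ofReal (b j)) x) ∂μ := by
        refine lintegral_mono_ae ?_
        filter_upwards [hμc] with x hx
        obtain ⟨j, hj, hxj⟩ := hx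
        calc ENNReal.ofReal (q x) ≤ ENNReal.ofReal (A + b j) := ENNReal.ofReal_le_ofReal (h j hj x hxj)
          _ = ENNReal.ofReal A + (cell a δ j).indicator (fun _ => ENNReal.ofReal (b j)) x := by
              rw [indicator_of_mem hxj, ENNReal.ofReal_add hA (hb j)]
          _ ≤ _ := by
              gcongr
              exact Finset.single_le_sum (f := fun j =>
                (cell a δ j).indicator (fun _ => ENNReal.ofReal (b j)) x) (fun _ _ => zero_le)
                (Finset.mem_range.2 hj)
    _ = ENNReal.ofReal A * μ univ +
          ∑ j ∈ Finset.range m, ENNReal.ofReal (b j) * μ (cell a δ j) := by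
        rw [lintegral_add_left measurable_const, lintegral_const, lintegral_finsetSum _
          fun j _ => Measurable.indicator (f := fun _ => ENNReal.ofReal (b j)) measurable_const
            (measurableSet_cell a δ j)]
        congr 1
        exact Finset.sum_congr rfl fun j _ =>
          lintegral_indicator_const (measurableSet_cell a δ j) _
    _ ≤ ENNReal.ofReal A * 1 +
          ∑ j ∈ Finset.range m, ENNReal.ofReal (b j) * ENNReal.ofReal (1 / m) := by
        gcongr with j hj
        exact hμ j (Finset.mem_range.1 hj)
    _ = _ := by
        rw [mul_one, ENNReal.ofReal_add hA (div_nonneg (Finset.sum_nonneg fun j _ => hb j)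
          (Nat.cast_nonneg m)), Finset.sum_div, ENNReal.ofReal_sum_of_nonneg
          fun j _ => div_nonneg (hb j) (Nat.cast_nonneg m)]
        congr 1
        refine Finset.sum_congr rfl fun j _ => ?_
        rw [← ENNReal.ofReal_mul (hb j), mul_one_div]

end Estimator

/-! ### Loss of the threshold estimator along a path -/

section UpperRisk

open Polynomial

lemma cell_subset_Icc {a δ : ℝ} (ha : 0 ≤ a) (hδ : 0 < δ) {m j : ℕ} (haδ : a + m * δ ≤ 1)
    (hj : j < m) : cell a δ j ⊆ Icc 0 1 := by
  intro x hx
  have hj1 : (j : ℝ) + 1 ≤ m := by exact_mod_cast hj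
  have hj0 : (0 : ℝ) ≤ j := Nat.cast_nonneg j
  have h1 : 0 ≤ (j : ℝ) * δ := by positivity
  have h2 : ((j : ℝ) + 1) * δ ≤ m * δ := by gcongr
  exact ⟨by linarith [hx.1], by linarith [hx.2]⟩

/-- Above the threshold the error is that of the fit. Below it the error is `f₀ - f`, which is the
error of the fit minus the fit, and the latter is small because the squared increments sum to at
most `l`. -/
lemma lintegral_sq_thresholdEstimator_sub_le {α M : ℝ} (hα : 0 < α) (hM : 0 ≤ M) {r : ℕ}
    (hr : r = ⌈α⌉₊ - 1 + 1)
    {ω : ℕ → ℝ[X]} (hω : ∀ Q : ℝ[X], Q.natDegree ≤ r → ∀ u, Q.derivative.eval u =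
      ∑ i ∈ Finset.range r, (ω i).eval u * (Q.eval (((i : ℝ) + 1) / r) - Q.eval ((i : ℝ) / r)))
    {K : ℝ} (hK : ∀ i < r, ∀ u ∈ Icc (0 : ℝ) 1, |(ω i).eval u| ≤ K)
    {f f₀ : ℝ → ℝ} (hθ : (fun x => f x - f₀ x) ∈ holderClass α M) {a δ : ℝ} (ha : 0 ≤ a)
    (hδ : 0 < δ) {m : ℕ} (hm : m ≠ 0) (haδ : a + m * δ ≤ 1) {l : ℝ} (hl : 0 ≤ l)
    {z : unitInterval → ℝ} {ζ : ℕ → ℝ}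
    (hz : ∀ i < m * r, centredIncrement f₀ a (δ / r) z i =
      (∫ y in (a + i * (δ / r))..(a + (i + 1) * (δ / r)), (f y - f₀ y)) + ζ i)
    {μ : Measure ℝ} (hμ1 : μ univ ≤ 1) (hμ : ∀ j < m, μ (cell a δ j) ≤ ENNReal.ofReal (1 / m))
    (hμc : ∀ᵐ x ∂μ, ∃ j < m, x ∈ cell a δ j) :
    ∫⁻ x, ENNReal.ofReal ((thresholdEstimator f₀ ω r m a δ l z x - f x) ^ 2) ∂μ ≤
      ENNReal.ofReal (4 * ((K + 1) * M * δ ^ α) ^ 2 +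
        (4 * (K ^ 2 * r / δ ^ 2) * ∑ i ∈ Finset.range (m * r), ζ i ^ 2 +
          2 * (K ^ 2 * r / δ ^ 2) * l) / m) := by
  classical
  have hm0 : (0 : ℝ) < m := by exact_mod_cast Nat.pos_of_ne_zero hm
  set Y := centredIncrement f₀ a (δ / r) z with hYdef
  set S := ∑ i ∈ Finset.range (m * r), Y i ^ 2 with hS
  set G := K ^ 2 * r / δ ^ 2 with hG
  have hG0 : 0 ≤ G := by positivity
  set Z : ℕ → ℝ := fun j => ∑ i ∈ Finset.range r, ζ (j * r + i) ^ 2 with hZ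
  -- The extra loss from staying at `f₀`, set to zero when the fit is used; its total over the cells
  -- is at most `l` in either case.
  set V : ℕ → ℝ := fun j => if l < S then 0 else ∑ i ∈ Finset.range r, Y (j * r + i) ^ 2 with hV
  have hZ0 : ∀ j, 0 ≤ Z j := fun j => Finset.sum_nonneg fun i _ => sq_nonneg _
  have hV0 : ∀ j, 0 ≤ V j := by
    intro j
    simp only [hV]
    split_ifs
    · exact le_rfl
    · exact Finset.sum_nonneg fun i _ => sq_nonneg _
  refine (lintegral_le_of_cells hμ1 hμ hμc (A := 4 * ((K + 1) * M * δ ^ α) ^ 2)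
    (b := fun j => 4 * G * Z j + 2 * G * V j) (by positivity)
    (fun j => by have := hZ0 j; have := hV0 j; positivity) ?_).trans ?_
  · intro j hj x hx
    have hbias := localEstimate_sub_sq_le hα hM hr hω hK hθ ha hδ haδ hz hj hx
    have hsq := localEstimate_sq_le hK hδ Y hx
    have hx01 := cell_subset_Icc ha hδ haδ hj hx
    simp only [thresholdEstimator, ← hYdef, ← hS, indicator_of_mem hx01, cellEstimate_of_mem hδ hj hx]
    rw [← hG] at hbias hsq
    by_cases h : l < S
    · simp only [hV, if_pos h]
      have : 0 ≤ G * Z j := mul_nonneg hG0 (hZ0 j)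
      have e : f₀ x + localEstimate ω r a δ Y j x - f x =
        localEstimate ω r a δ Y j x - (f x - f₀ x) := by ring
      rw [e]
      have h0 : 0 ≤ ((K + 1) * M * δ ^ α) ^ 2 := sq_nonneg _
      simp only [hZ] at this ⊢
      linarith
    · simp only [hV, if_neg h, hZ]
      nlinarith [sq_nonneg ((localEstimate ω r a δ Y j x - (f x - f₀ x)) +
        localEstimate ω r a δ Y j x)]
  · refine ENNReal.ofReal_le_ofReal ?_
    gcongr
    rw [Finset.sum_add_distrib, ← Finset.mul_sum, ← Finset.mul_sum]
    have h1 : ∑ j ∈ Finset.range m, Z j = ∑ i ∈ Finset.range (m * r), ζ i ^ 2 :=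
      sum_range_mul (fun i => ζ i ^ 2) r m
    have h2 : ∑ j ∈ Finset.range m, V j ≤ l := by
      by_cases h : l < S
      · simpa only [hV, if_pos h, Finset.sum_const_zero] using hl
      · simp only [hV, if_neg h]
        rw [sum_range_mul (fun i => Y i ^ 2) r m]
        exact not_lt.1 h
    rw [h1]
    gcongr

/-- At `f₀` nothing is lost until the threshold is crossed; the loss is then the square of the fit,
controlled by the same sum that is tested. -/
lemma lintegral_sq_thresholdEstimator_sub_self_le {r : ℕ} {ω : ℕ → ℝ[X]}
    {K : ℝ} (hK : ∀ i < r, ∀ u ∈ Icc (0 : ℝ) 1, |(ω i).eval u| ≤ K)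
    {f₀ : ℝ → ℝ} {a δ : ℝ} (ha : 0 ≤ a)
    (hδ : 0 < δ) {m : ℕ} (haδ : a + m * δ ≤ 1) {l S : ℝ} {z : unitInterval → ℝ}
    (hS : S = ∑ i ∈ Finset.range (m * r), centredIncrement f₀ a (δ / r) z i ^ 2)
    {μ : Measure ℝ} (hμ1 : μ univ ≤ 1) (hμ : ∀ j < m, μ (cell a δ j) ≤ ENNReal.ofReal (1 / m))
    (hμc : ∀ᵐ x ∂μ, ∃ j < m, x ∈ cell a δ j) :
    ∫⁻ x, ENNReal.ofReal ((thresholdEstimator f₀ ω r m a δ l z x - f₀ x) ^ 2) ∂μ ≤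
      if l < S then ENNReal.ofReal (K ^ 2 * r / δ ^ 2 * S / m) else 0 := by
  set Y := centredIncrement f₀ a (δ / r) z with hYdef
  by_cases h : l < S
  · rw [if_pos h]
    refine (lintegral_le_of_cells hμ1 hμ hμc (A := 0)
      (b := fun j => K ^ 2 * r / δ ^ 2 * ∑ i ∈ Finset.range r, Y (j * r + i) ^ 2) le_rfl
      (fun j => mul_nonneg (by positivity) (Finset.sum_nonneg fun i _ => sq_nonneg _)) ?_).trans ?_
    · intro j hj x hx
      rw [hS] at h
      simp only [thresholdEstimator, ← hYdef, if_pos h,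
        indicator_of_mem (cell_subset_Icc ha hδ haδ hj hx), cellEstimate_of_mem hδ hj hx,
        add_sub_cancel_left, zero_add]
      exact localEstimate_sq_le hK hδ Y hx
    · rw [zero_add, ← Finset.mul_sum, sum_range_mul (fun i => Y i ^ 2) r m, hS]
  · rw [if_neg h, nonpos_iff_eq_zero]
    rw [hS] at h
    calc _ = ∫⁻ _, 0 ∂μ := by
          refine lintegral_congr_ae ?_
          filter_upwards [hμc] with x ⟨j, hj, hx⟩
          simp [thresholdEstimator, ← hYdef, if_neg h,
            indicator_of_mem (cell_subset_Icc ha hδ haδ hj hx)]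
      _ = 0 := lintegral_zero

/-- The grid points as times of the Brownian motion. -/
noncomputable def gridTime (a τ : ℝ) (i : ℕ) : ℝ≥0 := unitInterval.toNNReal (gridPoint a τ i)

lemma monotone_gridTime (a : ℝ) {τ : ℝ} (hτ : 0 ≤ τ) : Monotone (gridTime a τ) := by
  intro i j hij
  have h : gridPoint a τ i ≤ gridPoint a τ j := monotone_projIcc _ (by gcongr)
  exact h

lemma coe_gridPoint {a τ : ℝ} (ha : 0 ≤ a) (hτ : 0 ≤ τ) {N i : ℕ} (h : a + N * τ ≤ 1)
    (hi : i ≤ N) : (gridPoint a τ i : ℝ) = a + i * τ := by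
  have h1 : (i : ℝ) * τ ≤ N * τ := by gcongr
  have h2 : 0 ≤ (i : ℝ) * τ := by positivity
  have h3 : a + i * τ ∈ Icc (0 : ℝ) 1 := ⟨by linarith, by linarith⟩
  rw [gridPoint, projIcc_of_mem _ h3]

lemma gridTime_succ {a τ : ℝ} (ha : 0 ≤ a) (hτ : 0 ≤ τ) {N i : ℕ} (h : a + N * τ ≤ 1)
    (hi : i < N) : gridTime a τ (i + 1) = gridTime a τ i + τ.toNNReal := by
  refine NNReal.eq ?_
  change ((gridPoint a τ (i + 1) : unitInterval) : ℝ) = (gridPoint a τ i : ℝ) + (τ.toNNReal : ℝ)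
  rw [coe_gridPoint ha hτ h (Nat.succ_le_of_lt hi), coe_gridPoint ha hτ h hi.le,
    Real.coe_toNNReal _ hτ]
  push_cast
  ring

/-- Centring leaves the increments of `f - f₀`, which lies in a Hölder class, plus independent
noise. -/
lemma centredIncrement_observation {f f₀ : ℝ → ℝ} (hf : ContinuousOn f (Icc 0 1))
    (hf₀ : ContinuousOn f₀ (Icc 0 1)) {a τ : ℝ} (ha : 0 ≤ a) (hτ : 0 ≤ τ) {N i : ℕ}
    (h : a + N * τ ≤ 1) (hi : i < N) (n : ℕ) (w : ℝ≥0 → ℝ) :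
    centredIncrement f₀ a τ (observation n f w) i =
      (∫ y in (a + i * τ)..(a + (i + 1) * τ), (f y - f₀ y)) +
        (w (gridTime a τ (i + 1)) - w (gridTime a τ i)) / √n := by
  have hi1 : (i : ℝ) + 1 ≤ N := by exact_mod_cast hi
  have h1 : ((i : ℝ) + 1) * τ ≤ N * τ := by gcongr
  have h2 : 0 ≤ (i : ℝ) * τ := by positivity
  have hs : a + i * τ ∈ Icc (0 : ℝ) 1 := ⟨by linarith, by nlinarith⟩
  have ht : a + (i + 1) * τ ∈ Icc (0 : ℝ) 1 := ⟨by nlinarith, by linarith⟩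
  have hint : ∀ {g : ℝ → ℝ}, ContinuousOn g (Icc 0 1) → ∀ {u v : ℝ}, u ∈ Icc (0 : ℝ) 1 →
      v ∈ Icc (0 : ℝ) 1 → IntervalIntegrable g volume u v := fun hg _ _ hu hv =>
    (hg.mono (uIcc_subset_Icc hu hv)).intervalIntegrable
  have h0 : (0 : ℝ) ∈ Icc (0 : ℝ) 1 := ⟨le_rfl, zero_le_one⟩
  unfold centredIncrement observation
  rw [coe_gridPoint ha hτ h (Nat.succ_le_of_lt hi), coe_gridPoint ha hτ h hi.le]
  push_cast
  rw [intervalIntegral.integral_sub (hint hf hs ht) (hint hf₀ hs ht),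
    ← intervalIntegral.integral_interval_sub_left (hint hf h0 ht) (hint hf h0 hs)]
  unfold gridTime
  ring

end UpperRisk

/-! ### Expected loss of the threshold estimator -/

section UpperRiskExpectation

open Polynomial

variable {Ω : Type*} [MeasurableSpace Ω] {P : Measure Ω} {W : ℝ≥0 → Ω → ℝ}

/-- The threshold at `2 Λ` times the scale of the squared increments of noise. -/
noncomputable def noiseThreshold (n r : ℕ) (δ Λ : ℝ) : ℝ := 4 * (δ / r) / n * (2 * Λ)

/-- The three terms are the squared bias, the noise of `m * r` increments averaged over `m` cells,
and the price of the threshold. -/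
lemma risk_thresholdEstimator_le [IsProbabilityMeasure P] (hWm : ∀ t, Measurable (W t))
    (hW : IsPreBrownianReal W P) {α M : ℝ} (hα : 0 < α) (hM : 0 ≤ M) {r : ℕ}
    (hr : r = ⌈α⌉₊ - 1 + 1)
    {ω : ℕ → ℝ[X]} (hω : ∀ Q : ℝ[X], Q.natDegree ≤ r → ∀ u, Q.derivative.eval u =
      ∑ i ∈ Finset.range r, (ω i).eval u * (Q.eval (((i : ℝ) + 1) / r) - Q.eval ((i : ℝ) / r)))
    {K : ℝ} (hK : ∀ i < r, ∀ u ∈ Icc (0 : ℝ) 1, |(ω i).eval u| ≤ K)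
    {f f₀ : ℝ → ℝ} (hf : ContinuousOn f (Icc 0 1)) (hf₀ : ContinuousOn f₀ (Icc 0 1))
    (hθ : (fun x => f x - f₀ x) ∈ holderClass α M) {a δ : ℝ} (ha : 0 ≤ a)
    (hδ : 0 < δ) {m n : ℕ} (hm : m ≠ 0) (hn : n ≠ 0) (haδ : a + m * δ ≤ 1) {Λ : ℝ} (hΛ : 0 ≤ Λ)
    {x₀ c : ℝ} (hc : 0 ≤ c) (hμ : ∀ j < m, avgMeasure x₀ c (cell a δ j) ≤ ENNReal.ofReal (1 / m))
    (hμc : ∀ᵐ x ∂(avgMeasure x₀ c), ∃ j < m, x ∈ cell a δ j) :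
    risk P W n (thresholdEstimator f₀ ω r m a δ (noiseThreshold n r δ Λ)) f x₀ c ≤
      ENNReal.ofReal (4 * ((K + 1) * M * δ ^ α) ^ 2 + 32 * K ^ 2 * r / (n * δ) +
        16 * K ^ 2 * Λ / (n * m * δ)) := by
  have hr0 : (0 : ℝ) < r := by rw [hr]; positivity
  have hm0 : (0 : ℝ) < m := by exact_mod_cast Nat.pos_of_ne_zero hm
  have hn0 : (0 : ℝ) < n := by exact_mod_cast Nat.pos_of_ne_zero hn
  have hτ : 0 < δ / r := by positivity
  have haτ : a + (m * r : ℕ) * (δ / r) ≤ 1 := by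
    push_cast
    rwa [mul_assoc, mul_div_cancel₀ _ hr0.ne']
  have hl : 0 ≤ noiseThreshold n r δ Λ := by unfold noiseThreshold; positivity
  set t := gridTime a (δ / r) with ht
  set A := 4 * ((K + 1) * M * δ ^ α) ^ 2 + 16 * K ^ 2 * Λ / (n * m * δ) with hA
  have hA0 : 0 ≤ A := by positivity
  set H := 4 * (K ^ 2 * r / δ ^ 2) / n / m with hH
  have hH0 : 0 ≤ H := by positivity
  rw [risk_eq_lintegral_avgMeasure]
  calc _ ≤ ∫⁻ ω, (ENNReal.ofReal A + ∑ i ∈ Finset.range (m * r),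
        ENNReal.ofReal H * ENNReal.ofReal ((W (t (i + 1)) ω - W (t i) ω) ^ 2)) ∂P := by
        refine lintegral_mono fun ω' => ?_
        refine (lintegral_sq_thresholdEstimator_sub_le hα hM hr hω hK hθ ha hδ hm haδ hl
          (fun i hi => centredIncrement_observation hf hf₀ ha hτ.le haτ hi n (W · ω'))
          (avgMeasure_univ hc).le hμ hμc).trans_eq ?_
        simp_rw [← ENNReal.ofReal_mul hH0]
        rw [← ENNReal.ofReal_sum_of_nonneg fun i _ => mul_nonneg hH0 (sq_nonneg _),
          ← ENNReal.ofReal_add hA0 (Finset.sum_nonneg fun i _ => mul_nonneg hH0 (sq_nonneg _))]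
        congr 1
        rw [← Finset.mul_sum]
        simp_rw [div_pow, Real.sq_sqrt hn0.le]
        rw [← Finset.sum_div, hA, hH, noiseThreshold]
        field_simp
        ring
    _ = ENNReal.ofReal A + ∑ i ∈ Finset.range (m * r), ENNReal.ofReal H *
        ∫⁻ ω, ENNReal.ofReal ((W (t (i + 1)) ω - W (t i) ω) ^ 2) ∂P := by
        rw [lintegral_add_left measurable_const, lintegral_const, measure_univ, mul_one,
          lintegral_finsetSum _ fun i _ => by fun_prop]
        congr 1
        exact Finset.sum_congr rfl fun i _ => lintegral_const_mul' _ _ ENNReal.ofReal_ne_top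
    _ ≤ ENNReal.ofReal A + ∑ i ∈ Finset.range (m * r), ENNReal.ofReal H *
        ENNReal.ofReal (8 * (δ / r)) := by
        gcongr with i hi
        refine (lintegral_sq_increment_le hWm hW
          (gridTime_succ ha hτ.le haτ (Finset.mem_range.1 hi)) (Real.toNNReal_pos.2 hτ).ne').trans_eq ?_
        rw [Real.coe_toNNReal _ hτ.le]
    _ = _ := by
        rw [Finset.sum_const, Finset.card_range, ← ENNReal.ofReal_mul hH0, ← ENNReal.ofReal_nsmul,
          ← ENNReal.ofReal_add hA0 (by positivity)]
        congr 1
        rw [hA, hH, nsmul_eq_mul]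
        push_cast
        field_simp
        ring

/-- At `f₀` the tested sum is pure noise, and the chi-square tail at level `2 * Λ` with `m * r`
increments gives the exponential factor. -/
lemma risk_thresholdEstimator_self_le (hWm : ∀ t, Measurable (W t))
    (hW : IsPreBrownianReal W P) {r : ℕ} (hr : r ≠ 0) {ω : ℕ → ℝ[X]}
    {K : ℝ} (hK : ∀ i < r, ∀ u ∈ Icc (0 : ℝ) 1, |(ω i).eval u| ≤ K)
    {f₀ : ℝ → ℝ} (hf₀ : ContinuousOn f₀ (Icc 0 1)) {a δ : ℝ} (ha : 0 ≤ a)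
    (hδ : 0 < δ) {m n : ℕ} (hm : m ≠ 0) (hn : n ≠ 0) (haδ : a + m * δ ≤ 1) {Λ : ℝ}
    {x₀ c : ℝ} (hc : 0 ≤ c) (hμ : ∀ j < m, avgMeasure x₀ c (cell a δ j) ≤ ENNReal.ofReal (1 / m))
    (hμc : ∀ᵐ x ∂(avgMeasure x₀ c), ∃ j < m, x ∈ cell a δ j) :
    risk P W n (thresholdEstimator f₀ ω r m a δ (noiseThreshold n r δ Λ)) f₀ x₀ c ≤
      ENNReal.ofReal (8 * K ^ 2 / (n * m * δ) * Real.exp (r * m - Λ)) := by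
  have hr0 : (0 : ℝ) < r := by exact_mod_cast Nat.pos_of_ne_zero hr
  have hm0 : (0 : ℝ) < m := by exact_mod_cast Nat.pos_of_ne_zero hm
  have hn0 : (0 : ℝ) < n := by exact_mod_cast Nat.pos_of_ne_zero hn
  have hτ : 0 < δ / r := by positivity
  have haτ : a + (m * r : ℕ) * (δ / r) ≤ 1 := by
    push_cast
    rwa [mul_assoc, mul_div_cancel₀ _ hr0.ne']
  set t := gridTime a (δ / r) with ht
  have htail := lintegral_sum_sq_tail_le hWm hW (monotone_gridTime a hτ.le)
    (Real.toNNReal_pos.2 hτ).ne'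
    (fun i hi => gridTime_succ ha hτ.le haτ hi) (2 * Λ)
  rw [Real.coe_toNNReal _ hτ.le, ← ht] at htail
  have hq : 0 < 4 * (δ / r) / n := by positivity
  rw [risk_eq_lintegral_avgMeasure]
  calc _ ≤ ∫⁻ ω, ENNReal.ofReal (4 * K ^ 2 / (n * m * δ)) * (if 2 * Λ < ∑ i ∈ Finset.range (m * r),
          (W (t (i + 1)) ω - W (t i) ω) ^ 2 / (4 * (δ / r))
        then ENNReal.ofReal (∑ i ∈ Finset.range (m * r),
          (W (t (i + 1)) ω - W (t i) ω) ^ 2 / (4 * (δ / r))) else 0) ∂P := by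
        refine lintegral_mono fun ω' => ?_
        have hS : 4 * (δ / r) / n * ∑ i ∈ Finset.range (m * r),
            (W (t (i + 1)) ω' - W (t i) ω') ^ 2 / (4 * (δ / r)) =
            ∑ i ∈ Finset.range (m * r),
              centredIncrement f₀ a (δ / r) (observation n f₀ (W · ω')) i ^ 2 := by
          rw [Finset.mul_sum]
          refine Finset.sum_congr rfl fun i hi => ?_
          rw [centredIncrement_observation hf₀ hf₀ ha hτ.le haτ (Finset.mem_range.1 hi)]
          simp only [sub_self, intervalIntegral.integral_zero, zero_add, div_pow,
            Real.sq_sqrt hn0.le]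
          rw [ht]
          field_simp
        refine (lintegral_sq_thresholdEstimator_sub_self_le hK ha hδ haδ hS
          (avgMeasure_univ hc).le hμ hμc).trans ?_
        rw [noiseThreshold]
        simp only [mul_lt_mul_iff_right₀ hq]
        split_ifs
        · rw [← ENNReal.ofReal_mul (by positivity)]
          refine (congrArg ENNReal.ofReal ?_).le
          field_simp
        · exact zero_le
    _ ≤ ENNReal.ofReal (4 * K ^ 2 / (n * m * δ)) *
        ENNReal.ofReal (2 * Real.exp ((m * r : ℕ) - 2 * Λ / 2)) := by
        rw [lintegral_const_mul' _ _ ENNReal.ofReal_ne_top]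
        gcongr
    _ = _ := by
        rw [← ENNReal.ofReal_mul (by positivity)]
        congr 1
        push_cast
        rw [mul_div_cancel_left₀ _ (two_ne_zero), mul_comm (m : ℝ) r]
        ring

/-- Estimators with small risk at `f₀` and controlled risk over the Hölder class. -/
lemma exists_estimator_risk_le [IsProbabilityMeasure P] (hWm : ∀ t, Measurable (W t))
    (hW : IsPreBrownianReal W P) {α M M' : ℝ} (hα : 0 < α) (hM : 0 ≤ M) (hM' : 0 ≤ M') :
    ∃ C : ℝ, 0 < C ∧ ∀ f₀ ∈ holderClass α M', ∀ n m : ℕ, n ≠ 0 → m ≠ 0 → ∀ a δ Λ : ℝ, 0 ≤ a →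
      0 < δ → a + m * δ ≤ 1 → 0 ≤ Λ → ∃ fh : (unitInterval → ℝ) → ℝ → ℝ,
        Measurable (Function.uncurry fh) ∧ ∀ x₀ c : ℝ, 0 ≤ c →
          (∀ j < m, avgMeasure x₀ c (cell a δ j) ≤ ENNReal.ofReal (1 / m)) →
          (∀ᵐ x ∂(avgMeasure x₀ c), ∃ j < m, x ∈ cell a δ j) →
          risk P W n fh f₀ x₀ c ≤ ENNReal.ofReal (C / (n * m * δ) * Real.exp (C * m - Λ)) ∧
          maxRisk P W α M n fh x₀ c ≤
            ENNReal.ofReal (C * (δ ^ (2 * α) + 1 / (n * δ) + Λ / (n * m * δ))) := by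
  set r := ⌈α⌉₊ - 1 + 1 with hr
  have hr0 : r ≠ 0 := by omega
  obtain ⟨ω, hω⟩ := exists_increment_weights hr0
  obtain ⟨K, hK1, hK⟩ := exists_weight_bound r ω
  -- One constant dominates all of those in both risk bounds, including the `r` in the exponent. `M
  -- + M'` is the Hölder constant of `f - f₀`.
  set C := 4 * ((K + 1) * (M + M')) ^ 2 + 32 * K ^ 2 * r + r with hC
  have hrr : (1 : ℝ) ≤ r := by exact_mod_cast Nat.one_le_iff_ne_zero.2 hr0
  have hKr : K ^ 2 ≤ K ^ 2 * r := le_mul_of_one_le_right (sq_nonneg K) hrr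
  have hq : 0 ≤ 4 * ((K + 1) * (M + M')) ^ 2 := by positivity
  have hK2 : 0 ≤ K ^ 2 := sq_nonneg K
  refine ⟨C, by linarith, fun f₀ hf₀ n m hn hm a δ Λ ha hδ haδ hΛ =>
    ⟨thresholdEstimator f₀ ω r m a δ (noiseThreshold n r δ Λ),
      measurable_thresholdEstimator (continuousOn_of_mem_holderClass hf₀) ω r m a δ _,
      fun x₀ c hc hμ hμc => ⟨?_, iSup₂_le fun f hf => ?_⟩⟩⟩
  · refine (risk_thresholdEstimator_self_le hWm hW hr0 hK (continuousOn_of_mem_holderClass hf₀) ha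
      hδ hm hn haδ hc hμ hμc).trans (ENNReal.ofReal_le_ofReal ?_)
    have h1 : 8 * K ^ 2 ≤ C := by linarith
    have h2 : (r : ℝ) ≤ C := by linarith
    gcongr
  · refine (risk_thresholdEstimator_le hWm hW hα (add_nonneg hM hM') hr hω hK
      (continuousOn_of_mem_holderClass hf) (continuousOn_of_mem_holderClass hf₀)
      (sub_mem_holderClass hf hf₀) ha hδ hm hn haδ hΛ hc hμ hμc).trans
        (ENNReal.ofReal_le_ofReal ?_)
    have e : 4 * ((K + 1) * (M + M') * δ ^ α) ^ 2 =
        4 * ((K + 1) * (M + M')) ^ 2 * δ ^ (2 * α) := by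
      rw [mul_comm 2 α, Real.rpow_mul hδ.le, Real.rpow_two]
      ring
    have e2 : C * (δ ^ (2 * α) + 1 / (n * δ) + Λ / (n * m * δ)) =
        C * δ ^ (2 * α) + C / (n * δ) + C * Λ / (n * m * δ) := by ring
    rw [e, e2]
    gcongr <;> linarith

end UpperRiskExpectation

/-! ### Upper bounds in the three regimes -/

section UpperBounds

variable {Ω : Type*} [MeasurableSpace Ω] {P : Measure Ω} {W : ℝ≥0 → Ω → ℝ}

/-- A partition into `m` cells, each of mass at most `1 / m` under the averaging measure. -/
structure IsCellPartition (x₀ c a δ : ℝ) (m : ℕ) : Prop where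
  ne_zero : m ≠ 0
  left_nonneg : 0 ≤ a
  length_pos : 0 < δ
  right_le : a + m * δ ≤ 1
  avgMeasure_cell_le : ∀ j < m, avgMeasure x₀ c (cell a δ j) ≤ ENNReal.ofReal (1 / m)
  ae_mem : ∀ᵐ x ∂(avgMeasure x₀ c), ∃ j < m, x ∈ cell a δ j

/-- With one cell the mass condition is trivial, so `c = 0` is allowed. Strictness in `c < h`
matters because cells are open on the right. -/
lemma isCellPartition_single {x₀ c h : ℝ} (hc : 0 ≤ c) (hch : c < h) (h0 : 0 ≤ x₀ - h)
    (h1 : x₀ + h ≤ 1) : IsCellPartition x₀ c (x₀ - h) (2 * h) 1 where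
  ne_zero := one_ne_zero
  left_nonneg := h0
  length_pos := by linarith
  right_le := by push_cast; linarith
  avgMeasure_cell_le j _ := by
    refine (measure_mono (subset_univ _)).trans ?_
    rw [avgMeasure_univ hc]
    simp
  ae_mem := by
    filter_upwards [avgMeasure_absolutelyContinuous hc] with x hx
    refine ⟨0, one_pos, ?_, ?_⟩
    · push_cast; linarith [hx.1]
    · push_cast; linarith [hx.2]

lemma isCellPartition_window {x₀ c : ℝ} (hc : 0 < c) {m : ℕ} (hm : m ≠ 0) (h0 : 0 ≤ x₀ - c)
    (h1 : x₀ + c ≤ 1) : IsCellPartition x₀ c (x₀ - c) (2 * c / m) m := by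
  have hm0 : (0 : ℝ) < m := by exact_mod_cast Nat.pos_of_ne_zero hm
  have hδ : 0 < 2 * c / m := by positivity
  have hmδ : (m : ℝ) * (2 * c / m) = 2 * c := mul_div_cancel₀ _ hm0.ne'
  refine ⟨hm, h0, hδ, by rw [hmδ]; linarith, fun j hj => ?_, ?_⟩
  · have hj1 : (j : ℝ) + 1 ≤ m := by exact_mod_cast hj
    refine (measure_mono Ico_subset_Icc_self).trans ?_
    rw [avgMeasure_Icc hc (le_add_of_nonneg_right (by positivity))]
    · refine (congrArg ENNReal.ofReal ?_).le
      field_simp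
      ring
    · have : ((j : ℝ) + 1) * (2 * c / m) ≤ m * (2 * c / m) := by gcongr
      linarith
  · have hne : ∀ᵐ x ∂(avgMeasure x₀ c), x ≠ x₀ + c := by
      rw [avgMeasure, if_neg hc.ne']
      exact Measure.ae_smul_measure (ae_restrict_of_ae (Measure.ae_ne volume _)) _
    filter_upwards [avgMeasure_absolutelyContinuous hc.le, hne] with x hx hx'
    have hx2 : x < x₀ + c := lt_of_le_of_ne hx.2 hx'
    have hu0 : 0 ≤ (x - (x₀ - c)) / (2 * c / m) := div_nonneg (by linarith [hx.1]) hδ.le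
    refine ⟨⌊(x - (x₀ - c)) / (2 * c / m)⌋₊, ?_, ?_, ?_⟩
    · rw [Nat.floor_lt hu0, div_lt_iff₀ hδ, hmδ]
      linarith
    · have := Nat.floor_le hu0
      rw [le_div_iff₀ hδ] at this
      linarith
    · have := Nat.lt_floor_add_one ((x - (x₀ - c)) / (2 * c / m))
      rw [div_lt_iff₀ hδ] at this
      linarith

/-- The superefficient threshold estimators for a sequence of cell partitions. -/
lemma exists_superefficient_of_isCellPartition [IsProbabilityMeasure P]
    (hWm : ∀ t, Measurable (W t)) (hW : IsPreBrownianReal W P) {α M M' : ℝ} (hα : 0 < α)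
    (hM : 0 ≤ M) (hM' : 0 ≤ M') :
    ∃ C : ℝ, 0 < C ∧ ∀ f₀ ∈ holderClass α M', ∀ (m : ℕ → ℕ) (a δ Λ c B ρ : ℕ → ℝ) (x₀ K₁ K₂ : ℝ),
      (∀ᶠ n in atTop, IsCellPartition x₀ (c n) (a n) (δ n) (m n)) → (∀ᶠ n in atTop, 0 ≤ Λ n) →
      (∀ᶠ n in atTop, 0 ≤ c n) → (∀ᶠ n in atTop, 0 ≤ B n) → (∀ᶠ n in atTop, 0 ≤ ρ n) →
      (∀ᶠ n : ℕ in atTop, (n : ℝ) ^ (2 * α / (1 + 2 * α)) * B n *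
        (C / (n * m n * δ n) * Real.exp (C * m n - Λ n)) ≤ K₁) →
      (∀ᶠ n : ℕ in atTop, ρ n * (C * (δ n ^ (2 * α) + 1 / (n * δ n) +
        Λ n / (n * m n * δ n))) ≤ K₂) →
      ∃ fhat ∈ superefficient P W α B x₀ c f₀,
        limsup (fun n => ENNReal.ofReal (ρ n) * maxRisk P W α M n (fhat n) x₀ (c n)) atTop < ∞ := by
  obtain ⟨C, hC, H⟩ := exists_estimator_risk_le hWm hW hα hM hM'
  refine ⟨C, hC, fun f₀ hf₀ m a δ Λ c B ρ x₀ K₁ K₂ hcell hΛ hc hB hρ h₁ h₂ => ?_⟩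
  have key : ∀ n : ℕ, ∃ fh : (unitInterval → ℝ) → ℝ → ℝ, Measurable (Function.uncurry fh) ∧
      (n ≠ 0 → IsCellPartition x₀ (c n) (a n) (δ n) (m n) → 0 ≤ Λ n → 0 ≤ c n →
        risk P W n fh f₀ x₀ (c n) ≤
          ENNReal.ofReal (C / (n * m n * δ n) * Real.exp (C * m n - Λ n)) ∧
        maxRisk P W α M n fh x₀ (c n) ≤ ENNReal.ofReal (C * (δ n ^ (2 * α) + 1 / (n * δ n) +
          Λ n / (n * m n * δ n)))) := by
    intro n
    by_cases h : n ≠ 0 ∧ IsCellPartition x₀ (c n) (a n) (δ n) (m n) ∧ 0 ≤ Λ n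
    · obtain ⟨fh, hfh, hrisk⟩ := H f₀ hf₀ n (m n) h.1 h.2.1.ne_zero (a n) (δ n) (Λ n)
        h.2.1.left_nonneg h.2.1.length_pos h.2.1.right_le h.2.2
      exact ⟨fh, hfh, fun _ hp _ hcn => hrisk x₀ (c n) hcn hp.avgMeasure_cell_le hp.ae_mem⟩
    -- A default for the finitely many `n` that do not affect the limits: an estimator is needed for
    -- every `n`.
    · exact ⟨fun _ _ => 0, measurable_const, fun hn hp hl _ => absurd ⟨hn, hp, hl⟩ h⟩
  choose fhat hfhat hrisk using key
  refine ⟨fhat, ⟨hfhat, limsup_lt_top_of_eventually_le (K := K₁) ?_⟩,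
    limsup_lt_top_of_eventually_le (K := K₂) ?_⟩
  · filter_upwards [eventually_ne_atTop 0, hcell, hΛ, hc, hB, h₁] with n hn hp hl hcn hBn h
    refine le_trans ?_ (ENNReal.ofReal_le_ofReal h)
    rw [ENNReal.ofReal_mul (p := (n : ℝ) ^ (2 * α / (1 + 2 * α)) * B n) (by positivity)]
    gcongr
    exact (hrisk n hn hp hl hcn).1
  · filter_upwards [eventually_ne_atTop 0, hcell, hΛ, hc, hρ, h₂] with n hn hp hl hcn hρn h
    refine le_trans ?_ (ENNReal.ofReal_le_ofReal h)
    rw [ENNReal.ofReal_mul hρn]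
    gcongr
    exact (hrisk n hn hp hl hcn).2

/-- One cell of length `2 * h`, where `h` balances the bias `h ^ (2 * α)` against the threshold
price `log B / (n * h)`. The choice `Λ = log B + C` turns the exponential factor into `1 / B`. -/
lemma exists_superefficient_short_window [IsProbabilityMeasure P]
    (hWm : ∀ t, Measurable (W t)) (hW : IsPreBrownianReal W P) {α x₀ M M' : ℝ} (hα : 0 < α)
    (hx₀ : 0 < x₀) (hx₁ : x₀ < 1) (hM : 0 ≤ M) (hM' : 0 ≤ M') {d c B : ℕ → ℝ} (hd : ∀ n, 0 ≤ d n)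
    (hc : ∀ n, c n = d n * (n : ℝ) ^ (-1 / (1 + 2 * α))) (hB : Tendsto B atTop atTop)
    (hnB : Tendsto (fun n : ℕ => (n : ℝ) / Real.log (B n)) atTop atTop)
    {f₀ : ℝ → ℝ} (hf₀ : f₀ ∈ holderClass α M')
    (hlim : limsup (fun n => ENNReal.ofReal (d n * Real.log (B n) ^ (-1 / (1 + 2 * α)))) atTop = 0) :
    ∃ fhat ∈ superefficient P W α B x₀ c f₀,
      limsup (fun n : ℕ => ENNReal.ofReal (((n : ℝ) / Real.log (B n)) ^ (2 * α / (1 + 2 * α))) *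
        maxRisk P W α M n (fhat n) x₀ (c n)) atTop < ∞ := by
  obtain ⟨C, hC, H⟩ := exists_superefficient_of_isCellPartition (M := M) (M' := M') hWm hW hα hM hM'
  set p := 1 / (1 + 2 * α) with hp
  have hp0 : 0 < p := by positivity
  have hq : 2 * α / (1 + 2 * α) = 1 - p := by rw [hp]; field_simp; ring
  have hneg : -1 / (1 + 2 * α) = -p := by rw [hp, neg_div]
  have hpα : p * (2 * α) = 1 - p := by rw [hp]; field_simp; ring
  have hq0 : 0 < 1 - p := by rw [← hq]; positivity
  rw [hneg] at hlim hc
  have hL : Tendsto (fun n => Real.log (B n)) atTop atTop := Real.tendsto_log_atTop.comp hB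
  set h : ℕ → ℝ := fun n => (Real.log (B n) / n) ^ p with hh
  -- The cell may be wider than the window, so it fits into `[0, 1]` only because `h` tends to zero
  -- and `x₀` is an interior point.
  have hh0 : Tendsto h atTop (𝓝 0) := by
    have h1 : Tendsto (fun n : ℕ => Real.log (B n) / n) atTop (𝓝 0) := by
      simpa only [Function.comp_def, inv_div] using tendsto_inv_atTop_zero.comp hnB
    have h2 := h1.rpow_const (Or.inr hp0.le) (p := p)
    rwa [Real.zero_rpow hp0.ne'] at h2
  have hgood : ∀ᶠ n : ℕ in atTop, 1 ≤ Real.log (B n) ∧ (0 : ℝ) < n ∧ 0 < B n :=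
    (hL.eventually_ge_atTop 1).and
      (((tendsto_natCast_atTop_atTop (R := ℝ)).eventually_gt_atTop 0).and
        (hB.eventually_gt_atTop 0))
  have hnh : ∀ {n : ℕ}, 1 ≤ Real.log (B n) → (0 : ℝ) < n →
      (n : ℝ) * h n = (n : ℝ) ^ (1 - p) * Real.log (B n) ^ p := by
    intro n hLn hn
    simp only [hh]
    rw [Real.div_rpow (by linarith) hn.le, Real.rpow_sub hn, Real.rpow_one]
    ring
  refine H f₀ hf₀ (fun _ => 1) (fun n => x₀ - h n) (fun n => 2 * h n)
    (fun n => Real.log (B n) + C) c B _ x₀ (C / 2)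
    (C * (2 ^ (2 * α) + 1 / 2 + (1 + C) / 2)) ?_ ?_ ?_ ?_ ?_ ?_ ?_
  · filter_upwards [hgood, eventually_lt_of_limsup_ofReal_eq_zero hlim one_pos,
      hh0.eventually_le_const hx₀, hh0.eventually_le_const (sub_pos.2 hx₁)] with
      n ⟨hLn, hn, hBn⟩ hdn h1 h2
    have hL0 : 0 < Real.log (B n) := by linarith
    refine isCellPartition_single ?_ ?_ (by linarith) (by linarith)
    · rw [hc]; exact mul_nonneg (hd n) (by positivity)
    · rw [hc]
      rw [Real.rpow_neg hL0.le, ← div_eq_mul_inv, div_lt_one (by positivity)] at hdn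
      simp only [hh]
      rw [Real.div_rpow hL0.le hn.le, Real.rpow_neg hn.le, ← div_eq_mul_inv]
      gcongr
  · filter_upwards [hgood] with n hn
    linarith [hn.1]
  · exact Eventually.of_forall fun n => by rw [hc]; exact mul_nonneg (hd n) (by positivity)
  · filter_upwards [hgood] with n hn
    exact hn.2.2.le
  · filter_upwards [hgood] with n hn
    exact Real.rpow_nonneg (div_nonneg hn.2.1.le (by linarith [hn.1])) _
  · filter_upwards [hgood] with n ⟨hLn, hn, hBn⟩
    have hn' : 0 < (n : ℝ) ^ (1 - p) := by positivity
    have hLp : 1 ≤ Real.log (B n) ^ p := Real.one_le_rpow hLn hp0.le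
    rw [hq, Nat.cast_one, mul_one, mul_one,
      show C - (Real.log (B n) + C) = -Real.log (B n) by ring, Real.exp_neg, Real.exp_log hBn,
      mul_left_comm (n : ℝ), hnh hLn hn]
    calc (n : ℝ) ^ (1 - p) * B n * (C / (2 * ((n : ℝ) ^ (1 - p) * Real.log (B n) ^ p)) * (B n)⁻¹)
        = C / 2 / Real.log (B n) ^ p := by field_simp
      _ ≤ C / 2 := div_le_self (by positivity) hLp
  · filter_upwards [hgood] with n ⟨hLn, hn, hBn⟩
    have hL0 : 0 < Real.log (B n) := by linarith
    have hn' : 0 < (n : ℝ) ^ (1 - p) := by positivity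
    have hh2 : (2 * h n) ^ (2 * α) = 2 ^ (2 * α) * (Real.log (B n) / n) ^ (1 - p) := by
      rw [Real.mul_rpow zero_le_two (by positivity)]
      simp only [hh]
      rw [← Real.rpow_mul (by positivity), hpα]
    have hden : ((n : ℝ) * h n) = Real.log (B n) / (Real.log (B n) / n) ^ (1 - p) := by
      rw [hnh hLn hn, Real.div_rpow hL0.le hn.le, div_div_eq_mul_div, eq_div_iff (by positivity)]
      rw [mul_assoc, ← Real.rpow_add hL0]
      simp [mul_comm]
    have hinv : ((n : ℝ) / Real.log (B n)) ^ (1 - p) * (Real.log (B n) / n) ^ (1 - p) = 1 := by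
      rw [← Real.mul_rpow (by positivity) (by positivity)]
      field_simp
      exact Real.one_rpow _
    set u := (Real.log (B n) / n) ^ (1 - p) with hu
    have hu0 : 0 < u := by positivity
    rw [hq, Nat.cast_one, mul_one, hh2, mul_left_comm (n : ℝ), hden]
    set v := ((n : ℝ) / Real.log (B n)) ^ (1 - p) with hv
    have hv0 : 0 < v := by positivity
    calc v * (C * (2 ^ (2 * α) * u + 1 / (2 * (Real.log (B n) / u)) +
          (Real.log (B n) + C) / (2 * (Real.log (B n) / u))))
        = v * u * (C * (2 ^ (2 * α) + 1 / 2 * (1 / Real.log (B n)) +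
          (1 + C * (1 / Real.log (B n))) / 2)) := by field_simp
      _ ≤ 1 * (C * (2 ^ (2 * α) + 1 / 2 * 1 + (1 + C * 1) / 2)) := by
          have h1 : 1 / Real.log (B n) ≤ 1 := (div_le_one hL0).2 hLn
          rw [hinv]
          gcongr
      _ = _ := by ring

/-- Cells of length between one and two times `n ^ (-1 / (1 + 2 * α))` give bias and noise at the
minimax rate. The threshold price relative to that rate is of order `log B / d + 1`, and `g` is the
normalisation that absorbs it, so one statement serves two regimes. -/
lemma exists_superefficient_long_window [IsProbabilityMeasure P]
    (hWm : ∀ t, Measurable (W t)) (hW : IsPreBrownianReal W P) {α x₀ M M' : ℝ} (hα : 0 < α)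
    (hM : 0 ≤ M) (hM' : 0 ≤ M') {d c B : ℕ → ℝ}
    (hc : ∀ n, c n = d n * (n : ℝ) ^ (-1 / (1 + 2 * α)))
    (hcI : ∀ᶠ n in atTop, Icc (x₀ - c n) (x₀ + c n) ⊆ Icc 0 1) (hB : Tendsto B atTop atTop)
    {f₀ : ℝ → ℝ} (hf₀ : f₀ ∈ holderClass α M') (hd1 : ∀ᶠ n in atTop, 1 ≤ d n)
    {g : ℕ → ℝ} {K : ℝ} (hg0 : ∀ᶠ n in atTop, 0 ≤ g n) (hg1 : ∀ᶠ n in atTop, g n ≤ 1)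
    (hgK : ∀ᶠ n in atTop, g n * (Real.log (B n) / d n) ≤ K) :
    ∃ fhat ∈ superefficient P W α B x₀ c f₀,
      limsup (fun n : ℕ => ENNReal.ofReal ((n : ℝ) ^ (2 * α / (1 + 2 * α)) * g n) *
        maxRisk P W α M n (fhat n) x₀ (c n)) atTop < ∞ := by
  obtain ⟨C, hC, H⟩ := exists_superefficient_of_isCellPartition (M := M) (M' := M') hWm hW hα hM hM'
  set p := 1 / (1 + 2 * α) with hp
  have hq : 2 * α / (1 + 2 * α) = 1 - p := by rw [hp]; field_simp; ring
  have hneg : -1 / (1 + 2 * α) = -p := by rw [hp, neg_div]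
  have hpα : -p * (2 * α) = -(1 - p) := by rw [hp]; field_simp; ring
  rw [hneg] at hc
  have hL : Tendsto (fun n => Real.log (B n)) atTop atTop := Real.tendsto_log_atTop.comp hB
  have hgood : ∀ᶠ n : ℕ in atTop, 1 ≤ Real.log (B n) ∧ (0 : ℝ) < n ∧ 0 < B n ∧ 1 ≤ d n :=
    (hL.eventually_ge_atTop 1).and
      (((tendsto_natCast_atTop_atTop (R := ℝ)).eventually_gt_atTop 0).and
        ((hB.eventually_gt_atTop 0).and hd1))
  have hceil : ∀ {n : ℕ}, 1 ≤ d n → (d n ≤ ⌈d n⌉₊ ∧ (⌈d n⌉₊ : ℝ) ≤ 2 * d n) := by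
    intro n hdn
    have := Nat.ceil_lt_add_one (zero_le_one.trans hdn)
    exact ⟨Nat.le_ceil _, by linarith⟩
  have hns : ∀ {n : ℕ}, (0 : ℝ) < n → (n : ℝ) * (n : ℝ) ^ (-p) = (n : ℝ) ^ (1 - p) := by
    intro n hn
    rw [sub_eq_add_neg, Real.rpow_add hn, Real.rpow_one]
  refine H f₀ hf₀ (fun n => ⌈d n⌉₊) (fun n => x₀ - c n) (fun n => 2 * c n / ⌈d n⌉₊)
    (fun n => Real.log (B n) + 2 * C * d n) c B _ x₀ (C / 2)
    (C * (2 ^ (2 * α) + 1 + C) + C / 2 * K) ?_ ?_ ?_ ?_ ?_ ?_ ?_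
  · filter_upwards [hgood, hcI] with n ⟨hLn, hn, hBn, hdn⟩ hI
    have hd0 : 0 < d n := by linarith
    have hcn : 0 < c n := by rw [hc]; positivity
    have h1 := hI (left_mem_Icc.2 (by linarith))
    have h2 := hI (right_mem_Icc.2 (by linarith))
    exact isCellPartition_window hcn (Nat.ceil_pos.2 hd0).ne' h1.1 h2.2
  · filter_upwards [hgood] with n ⟨hLn, hn, hBn, hdn⟩
    have hd0 : 0 < d n := by linarith
    positivity
  · filter_upwards [hgood] with n ⟨hLn, hn, hBn, hdn⟩
    rw [hc]
    have hd0 : 0 < d n := by linarith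
    positivity
  · filter_upwards [hgood] with n hn
    exact hn.2.2.1.le
  · filter_upwards [hg0] with n hn
    positivity
  · filter_upwards [hgood] with n ⟨hLn, hn, hBn, hdn⟩
    have hd0 : 0 < d n := by linarith
    have hm0 : (0 : ℝ) < ⌈d n⌉₊ := hd0.trans_le (hceil hdn).1
    have hn' : 0 < (n : ℝ) ^ (1 - p) := by positivity
    have hden : (n : ℝ) * ⌈d n⌉₊ * (2 * c n / ⌈d n⌉₊) = 2 * d n * (n : ℝ) ^ (1 - p) := by
      rw [← hns hn, hc]
      field_simp
    -- As `⌈d n⌉₊ ≤ 2 * d n`, the summand `2 * C * d n` in `Λ` outweighs the growth `exp (C * m)`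
    -- due to the number of cells.
    have hexp : Real.exp (C * ⌈d n⌉₊ - (Real.log (B n) + 2 * C * d n)) ≤ (B n)⁻¹ := by
      rw [← Real.exp_log hBn, ← Real.exp_neg, Real.log_exp]
      refine Real.exp_le_exp.2 ?_
      have := mul_le_mul_of_nonneg_left (hceil hdn).2 hC.le
      linarith
    rw [hq, hden]
    calc (n : ℝ) ^ (1 - p) * B n * (C / (2 * d n * (n : ℝ) ^ (1 - p)) *
          Real.exp (C * ⌈d n⌉₊ - (Real.log (B n) + 2 * C * d n)))
        ≤ (n : ℝ) ^ (1 - p) * B n * (C / (2 * d n * (n : ℝ) ^ (1 - p)) * (B n)⁻¹) := by gcongr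
      _ = C / 2 / d n := by field_simp
      _ ≤ C / 2 := div_le_self (by positivity) hdn
  · filter_upwards [hgood, hg0, hg1, hgK] with n ⟨hLn, hn, hBn, hdn⟩ hg0 hg1 hgK
    have hd0 : 0 < d n := by linarith
    have hL0 : 0 < Real.log (B n) := by linarith
    obtain ⟨hm1, hm2⟩ := hceil hdn
    have hm0 : (0 : ℝ) < ⌈d n⌉₊ := hd0.trans_le hm1
    have hn' : 0 < (n : ℝ) ^ (1 - p) := by positivity
    have hs0 : 0 < (n : ℝ) ^ (-p) := by positivity
    have hden : (n : ℝ) * ⌈d n⌉₊ * (2 * c n / ⌈d n⌉₊) = 2 * d n * (n : ℝ) ^ (1 - p) := by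
      rw [← hns hn, hc]
      field_simp
    have hδl : (n : ℝ) ^ (-p) ≤ 2 * c n / ⌈d n⌉₊ := by
      rw [le_div_iff₀ hm0, hc]
      nlinarith
    have hδu : 2 * c n / ⌈d n⌉₊ ≤ 2 * (n : ℝ) ^ (-p) := by
      rw [div_le_iff₀ hm0, hc]
      nlinarith
    have h1 : (2 * c n / ⌈d n⌉₊) ^ (2 * α) ≤ 2 ^ (2 * α) * ((n : ℝ) ^ (1 - p))⁻¹ := by
      calc (2 * c n / ⌈d n⌉₊) ^ (2 * α) ≤ (2 * (n : ℝ) ^ (-p)) ^ (2 * α) :=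
            Real.rpow_le_rpow (hs0.le.trans hδl) hδu (by positivity)
        _ = _ := by
            rw [Real.mul_rpow zero_le_two hs0.le, ← Real.rpow_mul hn.le, hpα, Real.rpow_neg hn.le]
    have h2 : 1 / ((n : ℝ) * (2 * c n / ⌈d n⌉₊)) ≤ ((n : ℝ) ^ (1 - p))⁻¹ := by
      rw [one_div, ← hns hn]
      gcongr
    rw [hq, hden]
    set N := (n : ℝ) ^ (1 - p) with hN
    calc N * g n * (C * ((2 * c n / ⌈d n⌉₊) ^ (2 * α) + 1 / (n * (2 * c n / ⌈d n⌉₊)) +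
          (Real.log (B n) + 2 * C * d n) / (2 * d n * N)))
        ≤ N * g n * (C * (2 ^ (2 * α) * N⁻¹ + N⁻¹ +
          (Real.log (B n) + 2 * C * d n) / (2 * d n * N))) := by gcongr
      _ = g n * (C * (2 ^ (2 * α) + 1 + C)) + C / 2 * (g n * (Real.log (B n) / d n)) := by
          field_simp
          ring
      _ ≤ 1 * (C * (2 ^ (2 * α) + 1 + C)) + C / 2 * K := by gcongr
      _ = _ := by ring

end UpperBounds

lemma tendsto_atTop_of_liminf_rpow_log_pos {α : ℝ} (hα : 0 < α) {d B : ℕ → ℝ}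
    (hB : Tendsto B atTop atTop)
    (h : 0 < liminf (fun n => ENNReal.ofReal (d n * Real.log (B n) ^ (-1 / (1 + 2 * α)))) atTop) :
    Tendsto d atTop atTop := by
  obtain ⟨b, hb0, hb⟩ := exists_eventually_le_of_liminf_ofReal_pos h
  have hL : Tendsto (fun n => Real.log (B n)) atTop atTop := Real.tendsto_log_atTop.comp hB
  have hp : 0 < 1 / (1 + 2 * α) := by positivity
  refine tendsto_atTop_mono' _ ?_ (((tendsto_rpow_atTop hp).comp hL).const_mul_atTop hb0)
  filter_upwards [hb, hL.eventually_gt_atTop 0] with n hn hn1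
  rw [neg_div, Real.rpow_neg hn1.le, ← div_eq_mul_inv, le_div_iff₀ (by positivity)] at hn
  exact hn

end WhiteNoise

theorem theorem1
    {Ω : Type*} [MeasurableSpace Ω] (P : Measure Ω) [IsProbabilityMeasure P]
    (W : ℝ≥0 → Ω → ℝ) (hWm : ∀ t, Measurable (W t)) (hW : IsBrownianReal W P)
    (α x₀ M M' : ℝ) (hα : 0 < α) (hx₀ : 0 < x₀) (hx₁ : x₀ < 1) (hM' : 0 < M') (hM : M' < M)
    (d c B : ℕ → ℝ) (hd : ∀ n, 0 ≤ d n)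
    (hc : ∀ n, c n = d n * (n : ℝ) ^ (-1 / (1 + 2 * α)))
    (hcI : ∀ᶠ n in atTop, Icc (x₀ - c n) (x₀ + c n) ⊆ Icc 0 1)
    (hB : Tendsto B atTop atTop)
    (hnB : Tendsto (fun n : ℕ => (n : ℝ) / Real.log (B n)) atTop atTop)
    (f₀ : ℝ → ℝ) (hf₀ : f₀ ∈ WhiteNoise.holderClass α M') :
    -- first regime
    (limsup (fun n => ENNReal.ofReal (d n * Real.log (B n) ^ (-1 / (1 + 2 * α)))) atTop = 0 →
      (∀ fhat ∈ WhiteNoise.superefficient P W α B x₀ c f₀,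
        0 < liminf (fun n : ℕ =>
          ENNReal.ofReal (((n : ℝ) / Real.log (B n)) ^ (2 * α / (1 + 2 * α))) *
            WhiteNoise.maxRisk P W α M n (fhat n) x₀ (c n)) atTop) ∧
      (∃ fhat ∈ WhiteNoise.superefficient P W α B x₀ c f₀,
        limsup (fun n : ℕ =>
          ENNReal.ofReal (((n : ℝ) / Real.log (B n)) ^ (2 * α / (1 + 2 * α))) *
            WhiteNoise.maxRisk P W α M n (fhat n) x₀ (c n)) atTop < ∞)) ∧
    -- second regime
    (0 < liminf (fun n => ENNReal.ofReal (d n * Real.log (B n) ^ (-1 / (1 + 2 * α)))) atTop →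
      limsup (fun n => ENNReal.ofReal (d n * (Real.log (B n))⁻¹)) atTop = 0 →
      (∀ fhat ∈ WhiteNoise.superefficient P W α B x₀ c f₀,
        0 < liminf (fun n : ℕ =>
          ENNReal.ofReal ((n : ℝ) ^ (2 * α / (1 + 2 * α)) * (d n / Real.log (B n))) *
            WhiteNoise.maxRisk P W α M n (fhat n) x₀ (c n)) atTop) ∧
      (∃ fhat ∈ WhiteNoise.superefficient P W α B x₀ c f₀,
        limsup (fun n : ℕ =>
          ENNReal.ofReal ((n : ℝ) ^ (2 * α / (1 + 2 * α)) * (d n / Real.log (B n))) *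
            WhiteNoise.maxRisk P W α M n (fhat n) x₀ (c n)) atTop < ∞)) ∧
    -- third regime; the lower bound, for arbitrary estimators, is the minimax lower bound
    (0 < liminf (fun n => ENNReal.ofReal (d n / Real.log (B n))) atTop →
      (∃ fhat ∈ WhiteNoise.superefficient P W α B x₀ c f₀,
        limsup (fun n : ℕ =>
          ENNReal.ofReal ((n : ℝ) ^ (2 * α / (1 + 2 * α))) *
            WhiteNoise.maxRisk P W α M n (fhat n) x₀ (c n)) atTop < ∞) ∧
      (∀ fhat, WhiteNoise.IsEstimator fhat →
        0 < liminf (fun n : ℕ =>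
          ENNReal.ofReal ((n : ℝ) ^ (2 * α / (1 + 2 * α))) *
            WhiteNoise.maxRisk P W α M n (fhat n) x₀ (c n)) atTop)) := by
  have hW' := hW.toIsPreBrownianReal
  have hM0 : 0 ≤ M := hM'.le.trans hM.le
  have hL : Tendsto (fun n => Real.log (B n)) atTop atTop := Real.tendsto_log_atTop.comp hB
  refine ⟨fun h => ⟨fun fhat hfhat => ?_, ?_⟩, fun h₁ h₂ => ⟨fun fhat hfhat => ?_, ?_⟩,
    fun h => ⟨?_, fun fhat hfhat => ?_⟩⟩
  · exact WhiteNoise.lower_bound_short_window hWm hW' hα hM hd hc hcI hB hf₀ h hfhat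
  · exact WhiteNoise.exists_superefficient_short_window hWm hW' hα hx₀ hx₁ hM0 hM'.le hd hc hB hnB
      hf₀ h
  · exact WhiteNoise.lower_bound_middle_window hWm hW' hα hM hd hc hcI hB hf₀ h₁ h₂ hfhat
  · have hdt := WhiteNoise.tendsto_atTop_of_liminf_rpow_log_pos hα hB h₁
    have hlt := WhiteNoise.eventually_lt_of_limsup_ofReal_eq_zero h₂ one_pos
    -- Here `g = d / log B`, which cancels `log B / d` exactly.
    refine WhiteNoise.exists_superefficient_long_window (K := 1) hWm hW' hα hM0 hM'.le hc hcI hB hf₀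
      (hdt.eventually_ge_atTop 1) ?_ ?_ ?_
    · filter_upwards [hL.eventually_gt_atTop 0] with n hn
      exact div_nonneg (hd n) hn.le
    · filter_upwards [hlt] with n hn
      rw [div_eq_mul_inv]
      exact hn.le
    · filter_upwards [hL.eventually_gt_atTop 0, hdt.eventually_gt_atTop 0] with n hn hdn
      rw [div_mul_div_cancel₀' hdn.ne', div_self hn.ne']
  · have hdt := WhiteNoise.tendsto_atTop_of_liminf_div_log_pos hB h
    obtain ⟨b, hb0, hb⟩ := WhiteNoise.exists_eventually_le_of_liminf_ofReal_pos h
    -- Eventually `d ≥ b * log B`, so `log B / d ≤ 1 / b` and the minimax normalisation needs no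
    -- correction.
    have key := WhiteNoise.exists_superefficient_long_window (g := fun _ => 1) (K := 1 / b) hWm hW' hα
      hM0 hM'.le hc hcI hB hf₀ (hdt.eventually_ge_atTop 1) (Eventually.of_forall fun _ => zero_le_one)
      (Eventually.of_forall fun _ => le_rfl) (by
        filter_upwards [hb, hL.eventually_gt_atTop 0, hdt.eventually_gt_atTop 0] with n hbn hn hdn
        rw [one_mul, div_le_div_iff₀ hdn hb0, one_mul, mul_comm]
        exact (le_div_iff₀ hn).1 hbn)
    simpa only [mul_one] using key
  · exact WhiteNoise.lower_bound_long_window hWm hW' hα (hM'.trans hM) hc hcI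
      (WhiteNoise.tendsto_atTop_of_liminf_div_log_pos hB h) hfhat
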